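/- **Theorem 5.1.** Let $p$ be a prime number and let $G=\mathbf Z/p=\langle\sigma:\sigma^p=1\rangle$ act on a regular scheme $U$, with quotient $\pi\colon U\to U/G$ (an affine $G$-invariant morphism with $\mathcal O_{U/G}=(\pi_*\mathcal O_U)^G$). Let $G$ act on functions by $\sigma(f)=(\sigma^{-1})^*f$ and put $I(f)=\sigma(f)-f$. Let $P$ be a closed point of $U$ fixed by $G$ (that is, $\sigma(P)=P$ and $G$ acts trivially on the residue field $k_U$ of $P$), and assume that $k_U$ is perfect of characteristic $p$. Let $\mathfrak m_U$ be the maximal ideal of $\mathcal O_{U,P}$. Suppose that there are $e,s\in\mathfrak m_U\setminus\{0\}$, a unit $u\in\mathcal O_{U,P}^*$, and coordinates $x_1,\ldots,x_n\in\mathfrak m_U$ (elements mapping to a basis of $\mathfrak m_U/\mathfrak m_U^2$) such that $I(s)=esu$, $I(x_i)\in(e)$ for all $i$, and $p\in e^{p-1}\mathfrak m_U$. Assume moreover that $e$ is a greatest common divisor of $I(x_1),\ldots,I(x_n)$ in $\mathcal O_{U,P}$. (1) Let $y\in\mathfrak m_U$ be such that near $P$ the divisor $\{y=0\}$ is an irreducible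 (reduced) divisor $E\subset U$ through $P$, and suppose that $I(y)\in(ey)$. Then there is an irreducible Weil divisor $F$ on $U/G$ such that $E=\pi^*F$. (The coefficient of a prime divisor in the pullback of $F$ is the ramification index over $F$ if it dominates $F$, and $0$ otherwise.) Assume in addition that $I(x_i)\in e\mathfrak m_U$ for $i=1,\ldots,n$. Then $I(\mathfrak m_U)\subset e\mathfrak m_U$, and $\varphi(y)=I(y)/(eu)$ is a well-defined $k_U$-linear map $\mathfrak m_U/\mathfrak m_U^2\to\mathfrak m_U/\mathfrak m_U^2$ (so $\varphi(y)=I(y)/e$ if $I(s)=es$). There are an affine scheme $Q$ with an action of $\mu_p$ and a $\mu_p$-fixed point $z\in Q$ such that $Q/\mu_p$ is isomorphic to an affine open neighborhood of $\pi(P)$ in $U/G$, $z$ maps to $\pi(P)$, and $Q$ is regular at $z$. The map $\varphi$ is diagonalizable with eigenvalues $b_1,\ldots,b_n\in\mathbf F_p\subset k_U$, and $Q$ has coordinates at $z$ that are $\mu_p$-eigenfunctions of weights $b_1,\ldots,b_n$. Moreover, this $Q$ (which does not depend on the functions $y$, $y_j$ below) satisfies the following. (2) For each $y$, $E$, $F$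 as in (1), there is a $\mu_p$-eigenfunction $h$ on $Q$ such that the pullback of $F$ to $Q$ is the divisor $\{h=0\}$ near $z$. (3) Let $y_1,\ldots,y_r\in\mathfrak m_U$ be linearly independent in $\mathfrak m_U/\mathfrak m_U^2$ with $I(y_j)\in(ey_j)$ for all $j$. Then each $\{y_j=0\}$ is an irreducible divisor $E_j$ near $P$. For any divisors $F_j$ with $\pi^*F_j=E_j$ as in (1) and any $\mu_p$-eigenfunctions $h_j$ as in (2), the functions $h_1,\ldots,h_r$ vanish at $z$ and are linearly independent in $\mathfrak m_Q/\mathfrak m_Q^2$, where $\mathfrak m_Q$ is the maximal ideal of $\mathcal O_{Q,z}$; they are part of a toric coordinate system on $Q$ at $z$ (a coordinate system that consists of $\mu_p$-eigenfunctions). Finally, the class of $y_j$ in $\mathfrak m_U/\mathfrak m_U^2$ is an eigenvector of $\varphi$ whose eigenvalue is in $\mathbf F_p$ and is equal to the $\mu_p$-weight of $h_j$. -/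

import Mathlib

open AlgebraicGeometry CategoryTheory IsLocalRing

universe u

noncomputable section

namespace ToricDivisors

/-- A scheme is regular if it is locally noetherian and all its local rings are regular. -/
structure IsRegularScheme (U : Scheme.{u}) : Prop where
  isLocallyNoetherian : IsLocallyNoetherian U
  stalk_regular : ∀ x : U, IsRegularLocalRing (U.presheaf.stalk x)

/-- `π : U ⟶ X` is the quotient of `U` by the cyclic group generated by the automorphism `σ`:
`π` is affine and invariant, and `𝒪_X` is the sheaf of invariants of `π_* 𝒪_U`. -/
structure IsQuotientBy {U X : Scheme.{u}} (σ : U ≅ U) (π : U ⟶ X) : Prop where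
  isAffineHom : IsAffineHom π
  invariant : σ.hom ≫ π = π
  injective : ∀ V : X.Opens, Function.Injective (π.app V).hom
  mem_range_iff : ∀ (V : X.Opens) (f : Γ(U, π ⁻¹ᵁ V)),
    f ∈ Set.range (π.app V).hom ↔
      ∃ h : π ⁻¹ᵁ V ≤ σ.hom ⁻¹ᵁ (π ⁻¹ᵁ V), (σ.hom.appLE (π ⁻¹ᵁ V) (π ⁻¹ᵁ V) h).hom f = f

theorem inv_apply_eq {U : Scheme.{u}} (σ : U ≅ U) {P : U} (hP : σ.hom P = P) : σ.inv P = P := by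
  have h : σ.inv (σ.hom P) = P := by
    rw [← Scheme.Hom.comp_apply, Iso.hom_inv_id]
    rfl
  rwa [hP] at h

/-- The action of `σ` on the local ring at a point `P` with `σ(P) = P`. A group acts on functions
by `σ(f)(x) = f(σ⁻¹ x)`, so this is the pullback by `σ⁻¹`. -/
def stalkAction {U : Scheme.{u}} (σ : U ≅ U) (P : U) (hP : σ.hom P = P) :
    U.presheaf.stalk P →+* U.presheaf.stalk P :=
  ((U.presheaf.stalkCongr (.of_eq (inv_apply_eq σ hP).symm)).hom ≫ σ.inv.stalkMap P).hom

/-- `I(f) = σ(f) - f` on the local ring at `P`. -/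
def incr {U : Scheme.{u}} (σ : U ≅ U) (P : U) (hP : σ.hom P = P) (f : U.presheaf.stalk P) :
    U.presheaf.stalk P :=
  stalkAction σ P hP f - f

section LocalRing

variable {A : Type*} [CommRing A] [IsLocalRing A]

/-- The class in `𝔪/𝔪²` of an element of the maximal ideal. -/
def cotangentClass (y : A) (hy : y ∈ maximalIdeal A) : CotangentSpace A :=
  (maximalIdeal A).toCotangent ⟨y, hy⟩

/-- The `x i` lie in `𝔪` and are linearly independent in `𝔪/𝔪²`. -/
def IndepModSq {ι : Type*} (x : ι → A) : Prop :=
  ∃ hx : ∀ i, x i ∈ maximalIdeal A,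
    LinearIndependent (ResidueField A) (fun i => cotangentClass (x i) (hx i))

/-- The `x i` lie in `𝔪` and map to a basis of `𝔪/𝔪²`. -/
def IsCoordinateSystem {ι : Type*} (x : ι → A) : Prop :=
  ∃ hx : ∀ i, x i ∈ maximalIdeal A,
    LinearIndependent (ResidueField A) (fun i => cotangentClass (x i) (hx i)) ∧
    Submodule.span (ResidueField A) (Set.range fun i => cotangentClass (x i) (hx i)) = ⊤

end LocalRing

/-- Prime divisors (irreducible divisors) of a scheme, given by their generic points:
the points of codimension one. -/
def PrimeDivisor (X : Scheme.{u}) : Type u := {x : X // Order.coheight x = 1}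

/-- Near the point `x`, the divisor `{y = 0}` is the prime divisor `D`: the divisor `D` passes
through `x`, and its ideal in the local ring at `x` is generated by `y`. -/
def IsLocalEquation {X : Scheme.{u}} (x : X) (D : PrimeDivisor X) (y : X.presheaf.stalk x) :
    Prop :=
  ∃ h : D.1 ⤳ x,
    (maximalIdeal (X.presheaf.stalk D.1)).comap (X.presheaf.stalkSpecializes h).hom =
      Ideal.span {y}

open scoped Classical in
/-- The coefficient at the prime divisor `η` of `Y` of the pullback `f^* F` of a prime divisor `F`
on `X`: the ramification index of `𝒪_{X,F} → 𝒪_{Y,η}` if `η` maps to the generic point of `F`,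
and `0` otherwise. -/
def pullbackCoeff {X Y : Scheme.{u}} (f : Y ⟶ X) (F : PrimeDivisor X) (η : PrimeDivisor Y) : ℕ∞ :=
  if f η.1 = F.1 then
    Module.length (Y.presheaf.stalk η.1)
      (Y.presheaf.stalk η.1 ⧸
        (maximalIdeal (X.presheaf.stalk (f η.1))).map (f.stalkMap η.1).hom)
  else 0

open scoped Classical in
/-- `E = f^* F` as Weil divisors on `Y`. -/
def IsDivisorPullback {X Y : Scheme.{u}} (f : Y ⟶ X) (F : PrimeDivisor X) (E : PrimeDivisor Y) :
    Prop :=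
  ∀ η : PrimeDivisor Y, pullbackCoeff f F η = if η = E then 1 else 0

/-- An affine scheme `Q = Spec R` with an action of the group scheme `μ_p`, that is, a grading of
`R` by `ℤ/p` (the summand of degree `b` being the eigenfunctions of weight `b`), together with
an identification of its quotient `Q/μ_p = Spec R_0` with an affine open subset `V` of `X`. -/
structure MuQuotient (p : ℕ) (X : Scheme.{u}) where
  V : X.Opens
  isAffineOpen : IsAffineOpen V
  R : CommRingCat.{u}
  grading : ZMod p → AddSubgroup R
  [gradedRing : GradedRing grading]
  iso : Γ(X, V) ≃+* SetLike.GradeZero.subring grading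

namespace MuQuotient

attribute [instance] MuQuotient.gradedRing

variable {p : ℕ} {X : Scheme.{u}} (Q : MuQuotient p X)

/-- The scheme `Q` itself. -/
abbrev scheme : Scheme.{u} := Spec Q.R

/-- The quotient map `Q ⟶ Q/μ_p = V ⊆ X`. -/
def toX : Q.scheme ⟶ X :=
  Spec.map (CommRingCat.ofHom
    ((SetLike.GradeZero.subring Q.grading).subtype.comp Q.iso.toRingHom)) ≫ Q.isAffineOpen.fromSpec

/-- The germ at a point of `Q` of a function on `Q`. -/
def germ (z : Q.scheme) : Q.R →+* Q.scheme.presheaf.stalk z :=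
  ((Scheme.ΓSpecIso Q.R).inv ≫ Q.scheme.presheaf.germ ⊤ z trivial).hom

/-- The point `z` of `Q` lies over `x₀`, it is fixed by `μ_p` (the fixed point scheme of `μ_p` is
defined by the vanishing of all eigenfunctions of nonzero weight), and `Q` is regular at `z`. -/
structure IsRegularFixedPointOver (x₀ : X) (z : Q.scheme) : Prop where
  toX_eq : Q.toX z = x₀
  fixed : ∀ b : ZMod p, b ≠ 0 → ∀ h ∈ Q.grading b, Q.germ z h ∈ maximalIdeal _
  regular : IsRegularLocalRing (Q.scheme.presheaf.stalk z)

/-- `h` is a `μ_p`-eigenfunction of weight `b` on `Q`, and near the point `z` the pullback of the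
prime divisor `F` to `Q` is the divisor `{h = 0}`. -/
def IsEigenEquation (z : Q.scheme) (F : PrimeDivisor X) (h : Q.R) (b : ZMod p) : Prop :=
  h ∈ Q.grading b ∧
    ∀ η : PrimeDivisor Q.scheme, η.1 ⤳ z →
      pullbackCoeff Q.toX F η = Ring.ord (Q.scheme.presheaf.stalk η.1) (Q.germ η.1 h)

/-- The `t i` are `μ_p`-eigenfunctions of weights `c i` on `Q` that form a coordinate system
at `z`. -/
def IsToricCoordinates (z : Q.scheme) {n : ℕ} (t : Fin n → Q.R) (c : Fin n → ZMod p) : Prop :=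
  (∀ i, t i ∈ Q.grading (c i)) ∧ IsCoordinateSystem (fun i => Q.germ z (t i))

end MuQuotient

end ToricDivisors

end

noncomputable section

namespace ToricDivisors

section

open scoped Pointwise

/-! ### Dimension and height in integral extensions and finite quotients -/

section Integral

/-! Let `A` be the local ring at `P`, `ε = e u` and `c = 1 + ε`. The equation `I(s) = esu` says
`σ(s) = s c`, so `c` has norm one and defines a 1-cocycle of `ℤ/p` with values `coc k = c σ(c) ⋯
σ^{k-1}(c)`. Since the residue field is perfect, `ε` divides every increment `σ(a) - a` as soon as
it divides those of the coordinates (`sub_mem_of_span_eq`), and `coc k - 1` is `ε` times a unit for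
`0 < k < p` (`TwistDatum.isAdmissible`).

Under these conditions `σ` behaves like a diagonalizable action: `A` is the direct sum of the
eigengroups `A_k = {a : σ(a) = c^k a}`, `0 ≤ k < p`. The components of `a` are the coefficients of
the polynomial that takes the value `σ^j(a)` at `coc j`, and this interpolation needs no
denominators (`exists_eigen_decomposition`). The unit `τ = ∏ coc j` satisfies `c^p σ(τ) = τ`, so it
identifies `A_{k+p}` with `A_k`. Extend `σ` to `S = A[T]/(T^p - τ)` by `σ(T) = c⁻¹ T`. The ring of
invariants is `R = ⊕ A_k T^k`, graded by `ℤ/p`, with degree-zero part the invariants of `A`. The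
cocycle extends with norm one to an invariant affine neighborhood of `P`; the same construction
there gives `Q`, and localizing it gives `R` (`isLocalizationHom_mapFixed`).

If `ey` divides `I(y)`, decomposing `y` inside the ideal `(y)` shows that a unit multiple of `y`
lies in some `A_k`. As `e` is a gcd of the `I(x_i)`, some element of weight `-k` is not divisible by
`y`. The product of the two, corrected by a power of `τ`, is an invariant divisible exactly once by
`y`, so `E` is unramified over its image `F`; and `E` is alone over `F` because its ideal is
`σ`-stable.

If moreover `I(𝔪) ⊆ e𝔪`, then `A_k ⊆ 𝔪` for `0 < k < p`, so `R` is local and `𝔪` has coordinates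
`t_i ∈ A_{k_i}`, which may include unit multiples of the `y_j`. The elements `t_i T^{k_i}` generate
the maximal ideal of `R`, because `T` is a unit of `S` and ideals of `R` are contracted from `S`;
since `dim R = dim A`, the ring `R` is regular. From `c^k - 1 ∈ ε(k + 𝔪)` it follows that `φ` acts
on the class of an element of `A_k` as `k`. Finally `y w T^k` is an equation of the pullback of `F`.
It is prime in `R` when `y` is part of a coordinate system, and then any other eigenfunction with
the same divisor differs from it by a unit and has the same weight. -/

theorem ringKrullDim_eq_of_isIntegral (R S : Type*) [CommRing R] [CommRing S] [Algebra R S]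
    [Algebra.IsIntegral R S] (hinj : Function.Injective (algebraMap R S)) :
    ringKrullDim R = ringKrullDim S := by
  refine le_antisymm ?_ ?_
  · refine iSup_le fun l => ?_
    obtain ⟨P, hP, hPo⟩ : ∃ P : Ideal S, P.IsPrime ∧ P.LiesOver l.head.asIdeal := by
      obtain ⟨Q, -, hQ, hQ'⟩ := Ideal.exists_ideal_over_prime_of_isIntegral l.head.asIdeal (⊥ : Ideal S)
        (by
          intro x hx
          rw [Ideal.mem_comap, Ideal.mem_bot, map_eq_zero_iff _ hinj] at hx
          simp [hx])
      exact ⟨Q, hQ, ⟨hQ'.symm⟩⟩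
    obtain ⟨L, hL, -⟩ := Ideal.exists_ltSeries_of_hasGoingUp l P
    rw [← hL]
    exact le_iSup (fun L : LTSeries (PrimeSpectrum S) => (L.length : WithBot ℕ∞)) L
  · exact Order.krullDim_le_of_strictMono (PrimeSpectrum.comap (algebraMap R S))
      fun P Q h => Ideal.IsIntegral.comap_lt_comap (R := R) (I := P.asIdeal) (J := Q.asIdeal) h

/-- The point is going-down for a quotient by a finite group: lift the smaller prime arbitrarily, go
up from there, and move the result to `Q` by a group element. -/
theorem height_under_eq_of_isInvariant (B A : Type*) [CommRing B] [CommRing A] [Algebra B A]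
    (G : Type*) [Group G] [Finite G] [MulSemiringAction G A] [SMulCommClass G B A]
    [Algebra.IsInvariant B A G] (hinj : Function.Injective (algebraMap B A))
    (Q : Ideal A) [hQ : Q.IsPrime] : (Q.under B).height = Q.height := by
  have : Algebra.IsIntegral B A := Algebra.IsInvariant.isIntegral B A G
  have hgd : Algebra.HasGoingDown B A := by
    refine ⟨fun {q} hq Q hQ hlt => ?_⟩
    obtain ⟨P, -, hP, hP'⟩ := Ideal.exists_ideal_over_prime_of_isIntegral q (⊥ : Ideal A)
      (by
        intro x hx
        rw [Ideal.mem_comap, Ideal.mem_bot, map_eq_zero_iff _ hinj] at hx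
        simp [hx])
    have : P.LiesOver q := ⟨hP'.symm⟩
    obtain ⟨Q', hle, hQ', hQo⟩ := Ideal.exists_ideal_ge_liesOver_of_le (p := q) (q := Q.under B) P
      hlt.le
    obtain ⟨g, hg⟩ := Algebra.IsInvariant.exists_smul_of_under_eq B A G Q' Q hQo.over.symm
    refine ⟨g • P, ?_, hP.smul g, ⟨?_⟩⟩
    · rw [hg]
      exact Ideal.pointwise_smul_le_pointwise_smul_iff.2 hle
    · rw [← hP']
      ext x
      simp only [Ideal.mem_comap, Ideal.under_def, Ideal.mem_pointwise_smul_iff_inv_smul_mem,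
        smul_algebraMap]
  refine le_antisymm ?_ ?_
  · rw [PrimeSpectrum.height_eq_orderHeight ⟨Q.under B, inferInstance⟩,
      PrimeSpectrum.height_eq_orderHeight ⟨Q, hQ⟩]
    refine Order.height_le fun l hl => ?_
    have : Q.LiesOver l.last.asIdeal := ⟨by rw [hl]⟩
    obtain ⟨L, hL, hlast, -⟩ := Ideal.exists_ltSeries_of_hasGoingDown l Q
    rw [← hL]
    exact Order.length_le_height (by rw [hlast])
  · rw [PrimeSpectrum.height_eq_orderHeight ⟨Q.under B, inferInstance⟩,
      PrimeSpectrum.height_eq_orderHeight ⟨Q, hQ⟩]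
    exact Order.height_le_height_apply_of_strictMono (PrimeSpectrum.comap (algebraMap B A))
      (fun P Q h => Ideal.IsIntegral.comap_lt_comap (R := B) (I := P.asIdeal) (J := Q.asIdeal) h)
      ⟨Q, hQ⟩

end Integral

/-! ### Generators of the maximal ideal and coordinate systems -/

section Coordinates

theorem span_cotangentClass_eq_top_iff {A : Type*} [CommRing A] [IsLocalRing A]
    [IsNoetherianRing A] {ι : Type*} (x : ι → A) (hx : ∀ i, x i ∈ maximalIdeal A) :
    Submodule.span (ResidueField A) (Set.range fun i => cotangentClass (x i) (hx i)) = ⊤ ↔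
      Ideal.span (Set.range x) = maximalIdeal A := by
  have h := CotangentSpace.span_image_eq_top_iff
    (s := Set.range fun i => (⟨x i, hx i⟩ : maximalIdeal A))
  rw [← Set.range_comp] at h
  refine h.trans ?_
  rw [← (Submodule.map_injective_of_injective (maximalIdeal A).injective_subtype).eq_iff,
    Submodule.map_span, ← Set.range_comp, Submodule.map_top, Submodule.range_subtype]
  rfl

theorem IsCoordinateSystem.span_eq {A : Type*} [CommRing A] [IsLocalRing A]
    [IsNoetherianRing A] {ι : Type*} {x : ι → A} (h : IsCoordinateSystem x) :
    Ideal.span (Set.range x) = maximalIdeal A := by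
  obtain ⟨hx, -, h⟩ := h
  exact (span_cotangentClass_eq_top_iff x hx).1 h

theorem IsCoordinateSystem.finrank_eq {A : Type*} [CommRing A] [IsLocalRing A] {n : ℕ} {x : Fin n → A} (h : IsCoordinateSystem x) :
    Module.finrank (ResidueField A) (CotangentSpace A) = n := by
  obtain ⟨hx, hli, h⟩ := h
  simpa using Module.finrank_eq_card_basis (Module.Basis.mk hli h.ge)

theorem isCoordinateSystem_of_span_eq {A : Type*} [CommRing A] [IsLocalRing A]
    [IsNoetherianRing A] {n : ℕ} {x : Fin n → A}
    (hspan : Ideal.span (Set.range x) = maximalIdeal A)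
    (hn : n ≤ Module.finrank (ResidueField A) (CotangentSpace A)) : IsCoordinateSystem x := by
  have hx : ∀ i, x i ∈ maximalIdeal A := fun i => hspan ▸ Ideal.subset_span ⟨i, rfl⟩
  have htop := (span_cotangentClass_eq_top_iff x hx).2 hspan
  refine ⟨hx, linearIndependent_of_top_le_span_of_card_eq_finrank htop.ge ?_, htop⟩
  refine le_antisymm (by simpa using hn) ?_
  rw [← finrank_top (ResidueField A) (CotangentSpace A), ← htop]
  exact finrank_range_le_card _

/-- Basis extension in the cotangent space with the new vectors taken from a generating set `H`. For
`H` the eigenelements in `𝔪` this keeps all coordinates homogeneous. -/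
theorem IndepModSq.exists_coordinates {A : Type*} [CommRing A] [IsLocalRing A]
    [IsNoetherianRing A] {r n : ℕ} {y : Fin r → A} (hy : IndepModSq y) {H : Set A}
    (hH : Ideal.span H = maximalIdeal A) (hyH : ∀ j, y j ∈ H)
    (hn : Module.finrank (ResidueField A) (CotangentSpace A) = n) :
    ∃ (t : Fin n → A) (i : Fin r ↪ Fin n), IsCoordinateSystem t ∧ (∀ k, t k ∈ H) ∧
      ∀ j, t (i j) = y j := by
  obtain ⟨hym, hli⟩ := hy
  set v : maximalIdeal A → CotangentSpace A :=
    fun a => (maximalIdeal A).toCotangent a with hv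
  set y' : Fin r → maximalIdeal A := fun j => ⟨y j, hym j⟩ with hy'
  have hli' : LinearIndependent (ResidueField A) (v ∘ y') := hli
  have hinj : Function.Injective y' := hli'.injective.of_comp
  have hs : LinearIndepOn (ResidueField A) v (Set.range y') :=
    (linearIndepOn_range_iff hinj v).2 hli'
  have hst : Set.range y' ⊆ {a : maximalIdeal A | (a : A) ∈ H} := by
    rintro _ ⟨j, rfl⟩
    exact hyH j
  obtain ⟨b, hbH, hyb, hspan, hb⟩ := exists_linearIndepOn_extension hs hst
  have hHm : ∀ a ∈ H, a ∈ maximalIdeal A := fun a ha => hH ▸ Ideal.subset_span ha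
  have htop : Submodule.span (ResidueField A) (v '' {a : maximalIdeal A | (a : A) ∈ H}) = ⊤ := by
    rw [hv, CotangentSpace.span_image_eq_top_iff,
      ← (Submodule.map_injective_of_injective (maximalIdeal A).injective_subtype).eq_iff,
      Submodule.map_span, Submodule.map_top, Submodule.range_subtype]
    refine Eq.trans (congrArg _ ?_) hH
    ext a
    exact ⟨fun ⟨x, hx, hxa⟩ => hxa ▸ hx, fun ha => ⟨⟨a, hHm a ha⟩, ha, rfl⟩⟩
  have htop' : Submodule.span (ResidueField A) (v '' b) = ⊤ := by
    rw [eq_top_iff, ← htop]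
    exact Submodule.span_le.2 hspan
  have hb' : LinearIndependent (ResidueField A) (fun k : b => v k) := hb
  let bas : Module.Basis b (ResidueField A) (CotangentSpace A) := Module.Basis.mk hb' (by
    rw [← htop', Set.image_eq_range])
  have : Finite b := Module.Finite.finite_basis bas
  have : Fintype b := Fintype.ofFinite b
  let eq : b ≃ Fin n := Fintype.equivFinOfCardEq (by
    rw [← hn, Module.finrank_eq_card_basis bas])
  refine ⟨fun k => ((eq.symm k : maximalIdeal A) : A),
    ⟨fun j => eq ⟨y' j, hyb ⟨j, rfl⟩⟩, fun j k h => hinj (by simpa using h)⟩, ?_, ?_, ?_⟩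
  · refine ⟨fun k => (eq.symm k : maximalIdeal A).2, ?_, ?_⟩
    · exact hb'.comp _ eq.symm.injective
    · rw [← htop', Set.image_eq_range]
      exact congrArg _ (eq.symm.surjective.range_comp (fun k : b => v k))
  · exact fun k => hbH (eq.symm k).2
  · intro j
    simp [hy']

theorem IndepModSq.notMem_sq {A : Type*} [CommRing A] [IsLocalRing A] {ι : Type*} {y : ι → A} (hy : IndepModSq y) (j : ι) :
    y j ∉ maximalIdeal A ^ 2 := by
  obtain ⟨hym, hli⟩ := hy
  intro h
  exact hli.ne_zero j (((maximalIdeal A).toCotangent_eq_zero ⟨y j, hym j⟩).2 h)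

end Coordinates

/-! ### Quotients of regular local rings; regular local rings are domains -/

section Regular

theorem withBot_enat_le_of_add_one_le {a b : WithBot ℕ∞} (h : a + 1 ≤ b + 1) : a ≤ b :=
  (WithBot.add_le_add_iff_right' WithBot.one_ne_bot
    (fun h => ENat.one_ne_top (WithBot.coe_injective h))).1 h

/-- Completing `x` to a coordinate system shows that the quotient needs at least one generator
fewer, while the dimension drops by at most one; both are then equalities. -/
theorem isRegularLocalRing_quotient {R : Type*} [CommRing R] [IsRegularLocalRing R] {x : R}
    (hx : x ∈ maximalIdeal R) (hx2 : x ∉ maximalIdeal R ^ 2) :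
    IsRegularLocalRing (R ⧸ Ideal.span {x}) ∧
      ringKrullDim (R ⧸ Ideal.span {x}) + 1 = ringKrullDim R := by
  have hne : Ideal.span {x} ≠ ⊤ := fun h =>
    (maximalIdeal.isMaximal R).ne_top (top_le_iff.1 (h ▸ (Ideal.span_singleton_le_iff_mem _).2 hx))
  have : Nontrivial (R ⧸ Ideal.span {x}) := Ideal.Quotient.nontrivial_iff.2 hne
  have : IsLocalRing (R ⧸ Ideal.span {x}) :=
    IsLocalRing.of_surjective' (Ideal.Quotient.mk _) Ideal.Quotient.mk_surjective
  have hindep : IndepModSq (fun _ : Fin 1 => x) := by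
    refine ⟨fun _ => hx, LinearIndependent.of_subsingleton 0 ?_⟩
    exact fun h => hx2 (((maximalIdeal R).toCotangent_eq_zero ⟨x, hx⟩).1 h)
  obtain ⟨t, i, ht, -, hti⟩ := hindep.exists_coordinates (H := maximalIdeal R) (Ideal.span_eq _)
    (fun _ => hx) rfl
  have hti : t (i 0) = x := hti 0
  set mk := Ideal.Quotient.mk (Ideal.span {x})
  have hmax : maximalIdeal (R ⧸ Ideal.span {x}) =
      Ideal.span (mk '' (t '' {i 0}ᶜ)) := by
    have h1 : maximalIdeal (R ⧸ Ideal.span {x}) = (maximalIdeal R).map mk := by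
      refine le_antisymm (fun a ha => ?_) ?_
      · obtain ⟨a, rfl⟩ := Ideal.Quotient.mk_surjective a
        exact Ideal.mem_map_of_mem _ (fun hu => ha (hu.map mk))
      · refine le_maximalIdeal fun h => ?_
        have := Ideal.comap_map_of_surjective mk Ideal.Quotient.mk_surjective (maximalIdeal R)
        rw [h, Ideal.comap_top, ← RingHom.ker_eq_comap_bot, Ideal.mk_ker,
          sup_eq_left.2 ((Ideal.span_singleton_le_iff_mem _).2 hx)] at this
        exact (maximalIdeal.isMaximal R).ne_top this.symm
    have h2 := congrArg (Ideal.map mk) ht.span_eq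
    rw [h1, ← h2, Ideal.map_span]
    refine le_antisymm (Ideal.span_le.2 ?_) (Ideal.span_mono (Set.image_mono (Set.image_subset_range _ _)))
    rintro _ ⟨_, ⟨k, rfl⟩, rfl⟩
    by_cases hk : k = i 0
    · rw [hk, hti, show mk x = 0 from Ideal.Quotient.eq_zero_iff_mem.2 (Ideal.mem_span_singleton_self x)]
      exact Ideal.zero_mem _
    · exact Ideal.subset_span ⟨_, ⟨k, hk, rfl⟩, rfl⟩
  have hfin : (mk '' (t '' {i 0}ᶜ)).Finite := ((Set.toFinite _).image _).image _
  have hle : (maximalIdeal (R ⧸ Ideal.span {x})).spanFinrank + 1 ≤ (maximalIdeal R).spanFinrank := by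
    rw [spanFinrank_maximalIdeal_eq_finrank_cotangentSpace R]
    have h1 : ({i 0}ᶜ : Set (Fin _)).ncard + 1 =
        Module.finrank (ResidueField R) (CotangentSpace R) := by
      have := Set.ncard_add_ncard_compl ({i 0} : Set (Fin _))
      rw [Set.ncard_singleton, Nat.card_fin] at this
      omega
    rw [← h1, hmax]
    gcongr
    exact (Submodule.spanFinrank_span_le_ncard_of_finite hfin).trans
      ((Set.ncard_image_le ((Set.toFinite _).image _)).trans (Set.ncard_image_le (Set.toFinite _)))
  have hdim : ringKrullDim R ≤ ringKrullDim (R ⧸ Ideal.span {x}) + 1 := by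
    have := ringKrullDim_le_ringKrullDim_quotient_add_encard {x}
      (by simpa [IsLocalRing.ringJacobson_eq_maximalIdeal] using hx)
    simpa using this
  have hreg := (isRegularLocalRing_iff R).1 inferInstance
  have hkey : ((maximalIdeal (R ⧸ Ideal.span {x})).spanFinrank : WithBot ℕ∞) + 1 ≤
      ringKrullDim (R ⧸ Ideal.span {x}) + 1 := by
    refine le_trans ?_ hdim
    rw [← hreg]
    exact_mod_cast hle
  have hle' := ringKrullDim_le_spanFinrank_maximalIdeal (R ⧸ Ideal.span {x})
  refine ⟨IsRegularLocalRing.of_spanFinrank_maximalIdeal_le _ ?_, le_antisymm ?_ hdim⟩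
  · exact withBot_enat_le_of_add_one_le hkey
  · rw [← hreg]
    refine (add_le_add_left hle' 1).trans ?_
    exact_mod_cast hle

/-- Induction on the dimension. Prime avoidance gives `x ∈ 𝔪` outside `𝔪²` and all minimal primes.
By induction `(x)` is prime; a minimal prime `I ⊆ (x)` does not contain `x`, so `I = xI`, and `I =
0` by Nakayama. -/
theorem isDomain_of_isRegularLocalRing (R : Type*) [CommRing R] [IsRegularLocalRing R] :
    IsDomain R := by
  suffices h : ∀ (n : ℕ) (R : Type _) [CommRing R] [IsRegularLocalRing R],
      ringKrullDim R = n → IsDomain R from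
    h (maximalIdeal R).spanFinrank R ((isRegularLocalRing_iff R).1 inferInstance).symm
  intro n
  induction n with
  | zero =>
    intro R _ _ hR
    have h0 : (maximalIdeal R).spanFinrank = 0 := by
      have := (isRegularLocalRing_iff R).1 inferInstance
      rw [hR] at this
      exact_mod_cast this
    rw [Submodule.spanFinrank_eq_zero_iff_eq_bot (IsNoetherian.noetherian _)] at h0
    exact (isField_iff_maximalIdeal_eq.2 h0).isDomain
  | succ n ih =>
    intro R _ _ hR
    have hne : ringKrullDim R ≠ 0 := by
      rw [hR]
      exact_mod_cast n.succ_ne_zero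
    obtain ⟨x, hx, hx'⟩ : ∃ x ∈ maximalIdeal R,
        x ∉ ⋃ I ∈ insert (maximalIdeal R ^ 2) (minimalPrimes R), (I : Set R) := by
      refine Set.not_subset.1 fun h => ?_
      obtain ⟨I, hI, hle⟩ := (Ideal.subset_union_prime_finite (f := id)
        ((minimalPrimes.finite_of_isNoetherianRing R).insert _) (maximalIdeal R ^ 2)
        (maximalIdeal R ^ 2) (fun I hI h _ => ((Set.mem_insert_iff.1 hI).resolve_left h).1.1)).1 h
      rcases hI with rfl | hI
      · exact (maximalIdeal_sq_lt_of_ringKrullDim_ne_zero hne).not_ge hle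
      · have : I.IsPrime := hI.1.1
        have hI' : I = maximalIdeal R := le_antisymm (le_maximalIdeal this.ne_top) hle
        have := Ideal.height_eq_zero_iff.2 (hI' ▸ hI)
        rw [← maximalIdeal_height_eq_ringKrullDim, this] at hne
        exact hne rfl
    simp only [Set.mem_insert_iff, Set.iUnion_iUnion_eq_or_left, Set.mem_union, Set.mem_iUnion,
      not_or, not_exists] at hx'
    obtain ⟨hreg, hdim⟩ := isRegularLocalRing_quotient hx hx'.1
    have hdom : IsDomain (R ⧸ Ideal.span {x}) := by
      refine ih _ ?_
      rw [hR] at hdim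
      push_cast at hdim
      exact le_antisymm (withBot_enat_le_of_add_one_le hdim.le)
        (withBot_enat_le_of_add_one_le hdim.ge)
    have hprime : (Ideal.span {x}).IsPrime := (Ideal.Quotient.isDomain_iff_prime _).1 hdom
    obtain ⟨I, hI, hle⟩ := Ideal.exists_minimalPrimes_le (bot_le (a := Ideal.span {x}))
    have hxI : x ∉ I := hx'.2 I hI
    have hIp : I.IsPrime := hI.1.1
    have hbot : I = ⊥ := by
      refine Submodule.eq_bot_of_le_smul_of_le_jacobson_bot (maximalIdeal R) I
        (IsNoetherian.noetherian _) (fun y hy => ?_) (maximalIdeal_le_jacobson _)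
      obtain ⟨a, rfl⟩ := Ideal.mem_span_singleton'.1 (hle hy)
      rw [smul_eq_mul, mul_comm (maximalIdeal R)]
      exact Ideal.mul_mem_mul ((hIp.mem_or_mem hy).resolve_right hxI) hx
    subst hbot
    exact IsDomain.of_bot_isPrime R

theorem isPrime_span_singleton {R : Type*} [CommRing R] [IsRegularLocalRing R] {x : R}
    (hx : x ∈ maximalIdeal R) (hx2 : x ∉ maximalIdeal R ^ 2) : (Ideal.span {x}).IsPrime :=
  have := (isRegularLocalRing_quotient hx hx2).1
  (Ideal.Quotient.isDomain_iff_prime _).1 (isDomain_of_isRegularLocalRing _)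

end Regular

end

/-! ### Cocycles of norm one and their eigengroups -/

section

open Polynomial Finset

/-- An endomorphism `σ` of period `p` of a ring together with a 1-cocycle of `ℤ/p`, given by
an element `c` of norm one. -/
structure TwistDatum (p : ℕ) (A : Type*) [CommRing A] where
  σ : A →+* A
  c : A
  iterate_eq : ∀ a, σ^[p] a = a
  norm_eq_one : ∏ l ∈ range p, σ^[l] c = 1

theorem map_mem_nonZeroDivisors_of_bijective {A B : Type*} [CommRing A]
    [CommRing B] {f : A →+* B} (hf : Function.Bijective f) {a : A} (ha : a ∈ nonZeroDivisors A) :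
    f a ∈ nonZeroDivisors B := by
  rw [mem_nonZeroDivisors_iff_right] at ha ⊢
  intro x hx
  obtain ⟨x, rfl⟩ := hf.2 x
  rw [← map_mul, map_eq_zero_iff f hf.1] at hx
  rw [ha x hx, map_zero]

namespace TwistDatum

section Basic

variable {p : ℕ} {A : Type*} [CommRing A] (D : TwistDatum p A)

/-- The values of the cocycle. -/
def coc (k : ℕ) : A := ∏ l ∈ range k, D.σ^[l] D.c

@[simp] theorem coc_zero : D.coc 0 = 1 := by simp [coc]

theorem coc_period : D.coc p = 1 := D.norm_eq_one

theorem coc_succ (k : ℕ) : D.coc (k + 1) = D.c * D.σ (D.coc k) := by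
  simp only [coc, prod_range_succ', map_prod, Function.iterate_succ_apply', Function.iterate_zero,
    id_eq, mul_comm]

theorem coc_add (k l : ℕ) : D.coc (k + l) = D.coc k * D.σ^[k] (D.coc l) := by
  induction k with
  | zero => simp
  | succ k ih =>
    rw [add_right_comm, coc_succ, ih, coc_succ, map_mul, Function.iterate_succ_apply', mul_assoc]

/-- The elements on which `σ` acts through the `k`-th power of the cocycle. -/
def eigen (k : ℕ) : AddSubgroup A where
  carrier := {a | D.σ a = D.c ^ k * a}
  zero_mem' := by simp
  add_mem' := fun {a b} ha hb => by
    simp only [Set.mem_ofPred_eq] at *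
    rw [map_add, ha, hb, mul_add]
  neg_mem' := fun {a} ha => by
    simp only [Set.mem_ofPred_eq] at *
    rw [map_neg, ha, mul_neg]

theorem mem_eigen {k : ℕ} {a : A} : a ∈ D.eigen k ↔ D.σ a = D.c ^ k * a := Iff.rfl

theorem mul_mem_eigen {k l : ℕ} {a b : A} (ha : a ∈ D.eigen k) (hb : b ∈ D.eigen l) :
    a * b ∈ D.eigen (k + l) := by
  rw [mem_eigen] at *
  rw [map_mul, ha, hb, pow_add]
  ring

theorem one_mem_eigen : (1 : A) ∈ D.eigen 0 := by simp [mem_eigen]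

theorem pow_mem_eigen {k : ℕ} {a : A} (ha : a ∈ D.eigen k) (m : ℕ) : a ^ m ∈ D.eigen (m * k) := by
  rw [mem_eigen] at *
  rw [map_pow, ha, mul_pow, ← pow_mul, mul_comm k]

theorem iterate_of_mem_eigen {k : ℕ} {a : A} (ha : a ∈ D.eigen k) (j : ℕ) :
    D.σ^[j] a = D.coc j ^ k * a := by
  induction j with
  | zero => simp
  | succ j ih =>
    rw [Function.iterate_succ_apply', ih, map_mul, map_pow, ha, coc_succ, mul_pow]
    ring

variable [hp : Fact p.Prime]

theorem bijective : Function.Bijective D.σ := by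
  have h : ∀ a, D.σ (D.σ^[p - 1] a) = a := fun a => by
    rw [← Function.iterate_succ_apply' (f := D.σ), Nat.succ_eq_add_one, Nat.sub_add_cancel hp.out.one_le, D.iterate_eq]
  have h' : ∀ a, D.σ^[p - 1] (D.σ a) = a := fun a => by
    rw [← Function.iterate_succ_apply (f := D.σ), Nat.succ_eq_add_one, Nat.sub_add_cancel hp.out.one_le, D.iterate_eq]
  exact ⟨Function.LeftInverse.injective h', Function.RightInverse.surjective h⟩

/-- The inverse of `c`. -/
def cInv : A := D.σ (D.coc (p - 1))

theorem c_mul_cInv : D.c * D.cInv = 1 := by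
  rw [cInv, ← coc_succ, Nat.sub_add_cancel hp.out.one_le, coc_period]

theorem cInv_mul_c : D.cInv * D.c = 1 := by rw [mul_comm, c_mul_cInv]

theorem isUnit_c : IsUnit D.c := .of_mul_eq_one _ D.c_mul_cInv

theorem isUnit_coc (k : ℕ) : IsUnit (D.coc k) := by
  rw [coc]
  exact IsUnit.prod_iff.2 fun l _ => by
    simpa only [← RingHom.coe_pow] using D.isUnit_c.map (D.σ ^ l)

theorem cInv_pow_mul (k : ℕ) : D.cInv ^ k * D.c ^ k = 1 := by
  rw [← mul_pow, cInv_mul_c, one_pow]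

/-- A unit on which `σ` acts through the inverse of the `p`-th power of the cocycle. -/
def tau : A := ∏ j ∈ range p, D.coc j

theorem isUnit_tau : IsUnit D.tau := IsUnit.prod_iff.2 fun l _ => D.isUnit_coc l

/-- The map `a ↦ c * σ a` sends `coc j` to `coc (j + 1)`, and the shifted product is unchanged
because `coc p = coc 0 = 1`. -/
theorem c_pow_mul_σ_tau : D.c ^ p * D.σ D.tau = D.tau := by
  have h : D.c ^ p * D.σ D.tau = ∏ j ∈ range p, D.coc (j + 1) := by
    simp only [coc_succ, prod_mul_distrib, prod_const, card_range, tau, map_prod]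
  have h2 := prod_range_succ' D.coc p
  rw [prod_range_succ, coc_period, coc_zero, mul_one, mul_one] at h2
  rw [h, ← h2, tau]

/-- Weights are thereby periodic modulo `p` up to the unit `τ`, although `c ^ p` need not be `1`. -/
theorem mul_tau_mem_eigen {k : ℕ} {a : A} : a * D.tau ∈ D.eigen k ↔ a ∈ D.eigen (k + p) := by
  have hu : IsUnit (D.c ^ p * D.σ D.tau) := (D.isUnit_c.pow p).mul (D.isUnit_tau.map _)
  have h1 : D.σ (a * D.tau) * D.c ^ p = D.σ a * (D.c ^ p * D.σ D.tau) := by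
    rw [map_mul]
    ring
  have h2 : D.c ^ k * (a * D.tau) * D.c ^ p = D.c ^ (k + p) * a * (D.c ^ p * D.σ D.tau) := by
    rw [D.c_pow_mul_σ_tau]
    ring
  rw [mem_eigen, mem_eigen, ← (D.isUnit_c.pow p).mul_left_inj, h1, h2, hu.mul_left_inj]

end Basic

/-! ### Decomposition into eigengroups by interpolation -/

section Admissible

variable {p : ℕ} {A : Type*} [CommRing A] (D : TwistDatum p A)

/-- The conditions under which the ring is the direct sum of the eigengroups. -/
structure IsAdmissible (ε : A) : Prop where
  c_eq : D.c = 1 + ε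
  mem_nonZeroDivisors : ε ∈ nonZeroDivisors A
  dvd_sub : ∀ a, ε ∣ D.σ a - a
  coc_sub_one : ∀ k, 0 < k → k < p → ∃ v : Aˣ, D.coc k - 1 = ε * v

variable {D} [hp : Fact p.Prime] {ε : A}

/-- The polynomial that takes the value `σ (f x)` at `c * σ x`. -/
def shiftPoly (D : TwistDatum p A) (f : A[X]) : A[X] := (f.map D.σ).comp (C D.cInv * X)

theorem coeff_shiftPoly (f : A[X]) (i : ℕ) :
    (D.shiftPoly f).coeff i = D.σ (f.coeff i) * D.cInv ^ i := by
  rw [shiftPoly, comp_C_mul_X_coeff, coeff_map]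

theorem eval_shiftPoly (f : A[X]) (j : ℕ) :
    (D.shiftPoly f).eval (D.coc (j + 1)) = D.σ (f.eval (D.coc j)) := by
  rw [shiftPoly, eval_comp, eval_mul, eval_C, eval_X, coc_succ, ← mul_assoc, cInv_mul_c, one_mul,
    Polynomial.eval_map, eval₂_hom]

theorem IsAdmissible.dvd_one_sub_cInv_pow (h : D.IsAdmissible ε) (i : ℕ) :
    ε ∣ 1 - D.cInv ^ i := by
  have h1 : ε ∣ 1 - D.cInv := ⟨D.cInv, by linear_combination D.cInv * h.c_eq - D.cInv_mul_c⟩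
  exact h1.trans (by simpa using sub_dvd_pow_sub_pow (1 : A) D.cInv i)

/-- Neville's recursion at the nodes `coc j`. Its denominators are `ε` times units, and the
hypothesis on `M` puts a factor `ε` into the numerators, so the coefficients exist in `A` and stay
in `M`. -/
theorem IsAdmissible.exists_interpolation (h : D.IsAdmissible ε) {M : Ideal A}
    (hM : ∀ m ∈ M, ∃ m' ∈ M, D.σ m - m = ε * m') {a : A} (ha : a ∈ M) (k : ℕ) (hk : k < p) :
    ∃ f : A[X], f ∈ M.map C ∧ f.degree < (k + 1 : ℕ) ∧
      ∀ j ≤ k, f.eval (D.coc j) = D.σ^[j] a := by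
  induction k with
  | zero =>
    refine ⟨C a, Ideal.mem_map_of_mem _ ha, degree_C_le.trans_lt (by norm_num), fun j hj => ?_⟩
    obtain rfl : j = 0 := by omega
    simp
  | succ k ih =>
    obtain ⟨f, hfM, hfd, hf⟩ := ih (by omega)
    obtain ⟨v, hv⟩ := h.coc_sub_one (k + 1) k.succ_pos hk
    set g := D.shiftPoly f with hg
    have hgv : ∀ j ≤ k, g.eval (D.coc (j + 1)) = D.σ^[j + 1] a := fun j hj => by
      rw [hg, eval_shiftPoly, hf j hj, Function.iterate_succ_apply']
    -- `f` has the right values at the indices `0, …, k` and `g` at `1, …, k + 1`. At every index `j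
    -- ≤ k + 1` this combination has the value `-(coc (k + 1) - 1) * σ^[j] a`.
    set F := (X - C (D.coc (k + 1))) * f - (X - 1) * g with hF
    have hfg : f - g ∈ (Ideal.span {ε} * M).map C := by
      rw [Ideal.mem_map_C_iff]
      intro i
      have hi := Ideal.mem_map_C_iff.1 hfM i
      obtain ⟨m', hm', hm⟩ := hM _ hi
      obtain ⟨d, hd⟩ := h.dvd_one_sub_cInv_pow i
      refine Ideal.mem_span_singleton_mul.2 ⟨f.coeff i * d - m' * D.cInv ^ i,
        sub_mem (Ideal.mul_mem_right _ _ hi) (Ideal.mul_mem_right _ _ hm'), ?_⟩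
      rw [coeff_sub, hg, coeff_shiftPoly]
      linear_combination - f.coeff i * hd + D.cInv ^ i * hm
    have hFM : F ∈ (Ideal.span {ε} * M).map C := by
      -- In this form both terms visibly have coefficients in `ε M`.
      have : F = (X - 1) * (f - g) - C (D.coc (k + 1) - 1) * f := by
        rw [hF, C_sub, C_1]
        ring
      rw [this]
      refine sub_mem (Ideal.mul_mem_left _ _ hfg) ?_
      rw [hv, C_mul, mul_assoc, Ideal.map_mul, Ideal.map_span, Set.image_singleton]
      exact Ideal.mul_mem_mul (Ideal.mem_span_singleton_self _) (Ideal.mul_mem_left _ _ hfM)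
    rw [Ideal.map_mul, Ideal.map_span, Set.image_singleton, Ideal.mem_span_singleton_mul] at hFM
    obtain ⟨H, hHM, hH⟩ := hFM
    refine ⟨C (-(↑v⁻¹ : A)) * H, Ideal.mul_mem_left _ _ hHM, ?_, fun j hj => ?_⟩
    · have hFd : F.degree < (k + 1 + 1 : ℕ) := by
        rw [degree_lt_iff_coeff_zero] at hfd ⊢
        intro m hm
        obtain ⟨m, rfl⟩ : ∃ l, m = l + 1 := ⟨m - 1, by omega⟩
        have e1 := hfd m (by omega)
        have e2 := hfd (m + 1) (by omega)
        simp [hF, sub_mul, coeff_X_mul, hg, coeff_shiftPoly, e1, e2]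
      rw [degree_lt_iff_coeff_zero] at hFd ⊢
      intro m hm
      have hm' := hFd m hm
      rw [← hH, coeff_C_mul] at hm'
      rw [coeff_C_mul, (mem_nonZeroDivisors_iff.1 h.mem_nonZeroDivisors).1 _ hm', mul_zero]
    · have hval : F.eval (D.coc j) = - (ε * v) * D.σ^[j] a := by
        have hFe : F.eval (D.coc j) = (D.coc j - D.coc (k + 1)) * f.eval (D.coc j) -
            (D.coc j - 1) * g.eval (D.coc j) := by simp [hF]
        rw [hFe, ← hv]
        rcases j with _ | j
        · have := hf 0 (Nat.zero_le _)
          simp only [coc_zero, Function.iterate_zero, id_eq] at this ⊢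
          rw [this]
          ring
        · rw [hgv j (by omega)]
          rcases (show j + 1 ≤ k ∨ j = k by omega) with hj' | rfl
          · rw [hf _ hj']
            ring
          · ring
      rw [← hH, eval_mul, eval_C] at hval
      refine (mul_cancel_left_mem_nonZeroDivisors h.mem_nonZeroDivisors).1 ?_
      rw [eval_mul, eval_C]
      linear_combination -(↑v⁻¹ : A) * hval + ε * D.σ^[j] a * v.inv_mul

theorem IsAdmissible.coc_sub_mem_nonZeroDivisors (h : D.IsAdmissible ε) {i j : ℕ} (hij : i < j)
    (hj : j < p) : D.coc j - D.coc i ∈ nonZeroDivisors A := by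
  obtain ⟨v, hv⟩ := h.coc_sub_one (j - i) (by omega) (by omega)
  have : D.coc j - D.coc i = D.coc i * D.σ^[i] (ε * v) := by
    conv_lhs => rw [← Nat.add_sub_cancel' hij.le, coc_add]
    rw [← hv, ← RingHom.coe_pow, map_sub, map_one]
    ring
  rw [this]
  refine mul_mem (D.isUnit_coc i).mem_nonZeroDivisors ?_
  have hinj : Function.Bijective (D.σ ^ i) := by
    rw [RingHom.coe_pow]
    exact D.bijective.iterate i
  rw [← RingHom.coe_pow]
  exact map_mem_nonZeroDivisors_of_bijective hinj
    (mul_mem h.mem_nonZeroDivisors v.isUnit.mem_nonZeroDivisors)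

/-- The system is a Vandermonde system in the nodes `coc j`, whose differences are nonzerodivisors.
-/
theorem IsAdmissible.eq_zero_of_forall_sum_eq_zero (h : D.IsAdmissible ε) {f : ℕ → A}
    (hf : ∀ j < p, ∑ i ∈ range p, D.coc j ^ i * f i = 0) : ∀ i < p, f i = 0 := by
  intro i hi
  set V := Matrix.vandermonde (fun j : Fin p => D.coc j)
  have hdet : V.det ∈ nonZeroDivisors A := by
    rw [Matrix.det_vandermonde]
    refine prod_mem fun i _ => prod_mem fun j hj => ?_
    exact h.coc_sub_mem_nonZeroDivisors (i := i) (j := j) (Fin.lt_def.1 (Finset.mem_Ioi.1 hj)) j.2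
  have hV : V.mulVec (fun i => f i) = 0 := by
    ext j
    have := hf j j.2
    rw [← Fin.sum_univ_eq_sum_range (fun i => D.coc j ^ i * f i) p] at this
    exact this
  have h1 := congrArg (V.adjugate.mulVec) hV
  rw [Matrix.mulVec_mulVec, Matrix.adjugate_mul, Matrix.mulVec_zero, Matrix.smul_mulVec,
    Matrix.one_mulVec] at h1
  exact (mem_nonZeroDivisors_iff.1 hdet).1 _ (congrFun h1 ⟨i, hi⟩)

/-- Applying `σ^[j]` multiplies the `i`-th term by `coc j ^ i`, which gives the Vandermonde system
above. -/
theorem IsAdmissible.eq_zero_of_sum_eigen_eq_zero (h : D.IsAdmissible ε) {f : ℕ → A}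
    (hf : ∀ i, f i ∈ D.eigen i) (hsum : ∑ i ∈ range p, f i = 0) : ∀ i < p, f i = 0 := by
  refine h.eq_zero_of_forall_sum_eq_zero fun j _ => ?_
  have := congrArg (D.σ ^ j) hsum
  rw [map_sum, map_zero] at this
  simpa only [RingHom.coe_pow, D.iterate_of_mem_eigen (hf _)] using this

/-- Interpolate the orbit of `a` by `f` of degree below `p`. Then `f` and its shift agree at all `p`
nodes, so they are equal; this says that the `i`-th coefficient has weight `i`, and `a = f(1)` is
the sum of the coefficients. The ideal `M` is carried along so that `y` can be decomposed inside
`(y)`. -/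
theorem IsAdmissible.exists_eigen_decomposition (h : D.IsAdmissible ε) {M : Ideal A}
    (hM : ∀ m ∈ M, ∃ m' ∈ M, D.σ m - m = ε * m') {a : A} (ha : a ∈ M) :
    ∃ f : ℕ → A, (∀ i, f i ∈ M) ∧ (∀ i, f i ∈ D.eigen i) ∧ ∑ i ∈ range p, f i = a := by
  obtain ⟨f, hfM, hfd, hf⟩ := h.exists_interpolation hM ha (p - 1)
    (Nat.sub_lt hp.out.pos one_pos)
  rw [Nat.sub_add_cancel hp.out.one_le] at hfd
  have hfp : ∀ i, p ≤ i → f.coeff i = 0 := (degree_lt_iff_coeff_zero _ _).1 hfd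
  have hev : ∀ (g : A[X]), (∀ i, p ≤ i → g.coeff i = 0) → ∀ x,
      g.eval x = ∑ i ∈ range p, x ^ i * g.coeff i := fun g hg x => by
    rw [eval_eq_sum_range' (n := p)]
    · simp only [mul_comm]
    · by_contra! hlt
      rcases eq_or_ne g 0 with rfl | h0
      · simp [hp.out.ne_zero] at hlt
      · exact h0 (leadingCoeff_eq_zero.1 (hg _ hlt))
  have hzero : ∀ i < p, f.coeff i - (D.shiftPoly f).coeff i = 0 := by
    refine h.eq_zero_of_forall_sum_eq_zero (f := fun i => f.coeff i - (D.shiftPoly f).coeff i)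
      fun j hj => ?_
    simp only [mul_sub, sum_sub_distrib]
    rw [← hev f hfp, ← hev (D.shiftPoly f) fun i hi => by simp [coeff_shiftPoly, hfp i hi],
      sub_eq_zero]
    -- The node `coc 0` is also `coc p`, where the shifted polynomial takes the value `σ^[p] a = a`.
    rcases j with _ | j
    · have h1 := eval_shiftPoly (D := D) f (p - 1)
      rw [Nat.sub_add_cancel hp.out.one_le, coc_period, hf _ le_rfl,
        ← Function.iterate_succ_apply' (f := D.σ), Nat.succ_eq_add_one,
        Nat.sub_add_cancel hp.out.one_le, D.iterate_eq] at h1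
      rw [hf 0 (Nat.zero_le _), coc_zero, h1]
      rfl
    · rw [eval_shiftPoly, hf _ (by omega), hf _ (by omega), Function.iterate_succ_apply']
  refine ⟨f.coeff, Ideal.mem_map_C_iff.1 hfM, fun i => ?_, ?_⟩
  · rcases lt_or_ge i p with hi | hi
    · have := hzero i hi
      rw [coeff_shiftPoly] at this
      rw [mem_eigen]
      linear_combination -D.c ^ i * this - D.σ (f.coeff i) * D.cInv_pow_mul i
    · rw [hfp i hi]
      exact zero_mem _
  · have := hf 0 (Nat.zero_le _)
    rw [hev f hfp] at this
    simpa using this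

end Admissible

end TwistDatum

end

namespace TwistDatum

open Polynomial Finset

/-! ### The cover obtained by adjoining a root of `T ^ p = τ` -/

section Cover

variable {p : ℕ} {A : Type u} [CommRing A] (D : TwistDatum p A)

/-- The algebra obtained by adjoining a `p`-th root of `τ`. -/
abbrev Cover : Type u := AdjoinRoot (X ^ p - C D.tau : A[X])

/-- The adjoined `p`-th root of `τ`. -/
def T : D.Cover := AdjoinRoot.root _

/-- The structure map of the cover. -/
def incl : A →+* D.Cover := AdjoinRoot.of _

theorem T_pow : D.T ^ p = D.incl D.tau := by
  have := AdjoinRoot.eval₂_root (X ^ p - C D.tau : A[X])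
  rw [eval₂_sub, eval₂_C, eval₂_X_pow, sub_eq_zero] at this
  exact this

variable [hp : Fact p.Prime]

theorem monic_poly : (X ^ p - C D.tau : A[X]).Monic :=
  monic_X_pow_sub_C _ hp.out.ne_zero

/-- The coefficient of `T ^ k`. -/
def coef (k : ℕ) : D.Cover →ₗ[A] A :=
  (lcoeff A k).comp (AdjoinRoot.modByMonicHom D.monic_poly)

theorem coef_eq_zero_of_le {k : ℕ} (hk : p ≤ k) (s : D.Cover) : D.coef k s = 0 := by
  nontriviality A
  obtain ⟨f, rfl⟩ := AdjoinRoot.mk_surjective s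
  rw [coef, LinearMap.comp_apply, AdjoinRoot.modByMonicHom_mk, lcoeff_apply]
  refine coeff_eq_zero_of_degree_lt ((degree_modByMonic_lt _ D.monic_poly).trans_le ?_)
  rw [degree_X_pow_sub_C hp.out.pos]
  exact_mod_cast hk

theorem sum_coef (s : D.Cover) : ∑ k ∈ range p, D.incl (D.coef k s) * D.T ^ k = s := by
  have h0 := AdjoinRoot.mk_leftInverse D.monic_poly s
  set f := AdjoinRoot.modByMonicHom D.monic_poly s with hf
  have h1 : f = ∑ k ∈ range p, C (f.coeff k) * X ^ k := by
    refine f.as_sum_range_C_mul_X_pow' ?_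
    by_contra! hlt
    have h2 : f.leadingCoeff = 0 := D.coef_eq_zero_of_le (Nat.lt_succ_iff.1 (Nat.lt_succ_of_le hlt)) s
    rw [leadingCoeff_eq_zero.1 h2, natDegree_zero] at hlt
    exact hp.out.ne_zero (Nat.le_zero.1 hlt)
  conv_rhs => rw [← h0, h1, map_sum]
  refine sum_congr rfl fun k _ => ?_
  rw [map_mul, map_pow, AdjoinRoot.mk_X, AdjoinRoot.mk_C]
  rfl

theorem coef_incl_mul_T_pow {j : ℕ} (hj : j < p) (a : A) (k : ℕ) :
    D.coef k (D.incl a * D.T ^ j) = if k = j then a else 0 := by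
  nontriviality A
  have h : D.incl a * D.T ^ j = AdjoinRoot.mk _ (C a * X ^ j) := by
    rw [map_mul, map_pow, AdjoinRoot.mk_X, AdjoinRoot.mk_C]
    rfl
  rw [h, coef, LinearMap.comp_apply, AdjoinRoot.modByMonicHom_mk,
    (modByMonic_eq_self_iff D.monic_poly).2, lcoeff_apply, coeff_C_mul_X_pow]
  rw [degree_X_pow_sub_C hp.out.pos]
  exact (degree_C_mul_X_pow_le _ _).trans_lt (by exact_mod_cast hj)

theorem cover_ext {s t : D.Cover} (h : ∀ k < p, D.coef k s = D.coef k t) : s = t := by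
  rw [← D.sum_coef s, ← D.sum_coef t]
  exact sum_congr rfl fun k hk => by rw [h k (mem_range.1 hk)]

theorem coef_sum (f : ℕ → A) {k : ℕ} (hk : k < p) :
    D.coef k (∑ j ∈ range p, D.incl (f j) * D.T ^ j) = f k := by
  rw [map_sum, sum_congr rfl fun j hj => D.coef_incl_mul_T_pow (mem_range.1 hj) (f j) k]
  simp [hk]

theorem coef_incl_mul (a : A) (s : D.Cover) (k : ℕ) : D.coef k (D.incl a * s) = a * D.coef k s := by
  rw [← smul_eq_mul a, ← map_smul, Algebra.smul_def]
  rfl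

theorem incl_injective : Function.Injective D.incl := fun a b h => by
  have ha := D.coef_incl_mul_T_pow hp.out.pos a 0
  have hb := D.coef_incl_mul_T_pow hp.out.pos b 0
  rw [h, hb] at ha
  simpa using ha.symm

theorem isUnit_T : IsUnit D.T := by
  rw [← isUnit_pow_iff hp.out.ne_zero, T_pow]
  exact D.isUnit_tau.map _

theorem incl_mul_T_pow (a : A) (k : ℕ) :
    D.incl a * D.T ^ k = D.incl (a * D.tau ^ (k / p)) * D.T ^ (k % p) := by
  conv_lhs => rw [← Nat.div_add_mod k p, pow_add, pow_mul, T_pow]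
  rw [map_mul, map_pow, mul_assoc]

/-- The semilinear extension of `σ` to the cover. -/
def coverσ : D.Cover →+* D.Cover :=
  AdjoinRoot.lift (D.incl.comp D.σ) (D.incl D.cInv * D.T) (by
    -- The relation is respected: `(c⁻¹ T) ^ p = c⁻ᵖ τ = σ τ`.
    rw [eval₂_sub, eval₂_C, eval₂_X_pow, mul_pow, T_pow, RingHom.comp_apply, ← map_pow, ← map_mul,
      sub_eq_zero]
    congr 1
    linear_combination (-D.cInv ^ p) * D.c_pow_mul_σ_tau + D.σ D.tau * D.cInv_pow_mul p)

@[simp] theorem coverσ_incl (a : A) : D.coverσ (D.incl a) = D.incl (D.σ a) :=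
  AdjoinRoot.lift_of _

@[simp] theorem coverσ_T : D.coverσ D.T = D.incl D.cInv * D.T := AdjoinRoot.lift_root _

theorem coverσ_incl_mul_T_pow (a : A) (k : ℕ) :
    D.coverσ (D.incl a * D.T ^ k) = D.incl (D.σ a * D.cInv ^ k) * D.T ^ k := by
  rw [map_mul, map_pow, coverσ_incl, coverσ_T, mul_pow, ← map_pow, map_mul, mul_assoc]

theorem coef_coverσ (s : D.Cover) {k : ℕ} (hk : k < p) :
    D.coef k (D.coverσ s) = D.σ (D.coef k s) * D.cInv ^ k := by
  conv_lhs => rw [← D.sum_coef s, map_sum, sum_congr rfl fun j _ => D.coverσ_incl_mul_T_pow _ _]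
  exact D.coef_sum (fun j => D.σ (D.coef j s) * D.cInv ^ j) hk

theorem coverσ_iterate_incl (j : ℕ) (a : A) : D.coverσ^[j] (D.incl a) = D.incl (D.σ^[j] a) := by
  induction j with
  | zero => rfl
  | succ j ih => rw [Function.iterate_succ_apply', ih, coverσ_incl, Function.iterate_succ_apply']

theorem incl_coc_mul_coverσ_iterate_T (j : ℕ) : D.incl (D.coc j) * D.coverσ^[j] D.T = D.T := by
  induction j with
  | zero => simp
  | succ j ih =>
    rw [Function.iterate_succ_apply', coc_succ, map_mul, mul_assoc, ← coverσ_incl, ← map_mul, ih,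
      coverσ_T, ← mul_assoc, ← map_mul, c_mul_cInv, map_one, one_mul]

theorem coverσ_iterate_period (s : D.Cover) : D.coverσ^[p] s = s := by
  have hT : D.coverσ^[p] D.T = D.T := by
    have := D.incl_coc_mul_coverσ_iterate_T p
    rwa [coc_period, map_one, one_mul] at this
  rw [← D.sum_coef s, ← RingHom.coe_pow, map_sum]
  refine sum_congr rfl fun k _ => ?_
  rw [map_mul, map_pow, RingHom.coe_pow, hT, coverσ_iterate_incl, D.iterate_eq]

/-- The action of `σ` and the cocycle on the cover. -/
@[simps]
def cover : TwistDatum p D.Cover where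
  σ := D.coverσ
  c := D.incl D.c
  iterate_eq := D.coverσ_iterate_period
  norm_eq_one := by
    simp only [coverσ_iterate_incl, ← map_prod, D.norm_eq_one, map_one]

theorem coc_cover (k : ℕ) : D.cover.coc k = D.incl (D.coc k) := by
  simp only [coc, cover_c, cover_σ, coverσ_iterate_incl, ← map_prod]

/-- With this the eigendecomposition also applies to the cover, where the weight-zero elements are
exactly `fixedRing`. -/
theorem IsAdmissible.cover {D : TwistDatum p A} {ε : A} (h : D.IsAdmissible ε) :
    D.cover.IsAdmissible (D.incl ε) where
  c_eq := by rw [cover_c, h.c_eq, map_add, map_one]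
  mem_nonZeroDivisors := by
    rw [mem_nonZeroDivisors_iff_right]
    intro s hs
    refine D.cover_ext fun k _ => ?_
    have := congrArg (D.coef k) hs
    rw [mul_comm, coef_incl_mul, map_zero] at this
    rw [(mem_nonZeroDivisors_iff.1 h.mem_nonZeroDivisors).1 _ this, map_zero]
  dvd_sub := fun s => by
    have h1 : ∀ k, ε ∣ D.σ (D.coef k s) * D.cInv ^ k - D.coef k s := fun k => by
      have := ((h.dvd_sub (D.coef k s)).mul_right (D.cInv ^ k)).sub
        ((h.dvd_one_sub_cInv_pow k).mul_right (D.coef k s))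
      convert this using 1
      ring
    choose f hf using h1
    refine ⟨∑ k ∈ range p, D.incl (f k) * D.T ^ k, D.cover_ext fun k hk => ?_⟩
    rw [cover_σ, map_sub, D.coef_coverσ s hk, coef_incl_mul, coef_sum _ _ hk, hf]
  coc_sub_one := fun k h0 hk => by
    obtain ⟨v, hv⟩ := h.coc_sub_one k h0 hk
    refine ⟨Units.map D.incl v, ?_⟩
    rw [coc_cover, ← map_one D.incl, ← map_sub, hv, map_mul]
    rfl

end Cover

/-! ### The invariants of the cover as a graded ring -/

section FixedRing

variable {p : ℕ} {A : Type u} [CommRing A] (D : TwistDatum p A) [hp : Fact p.Prime]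

/-- The ring of invariants of the cover. -/
def fixedRing : Subring D.Cover := D.coverσ.eqLocus (RingHom.id _)

theorem mem_fixedRing {s : D.Cover} : s ∈ D.fixedRing ↔ D.coverσ s = s := Iff.rfl

/-- `σ` multiplies `T ^ k` by `c⁻ᵏ`, which is compensated exactly by a coefficient of weight `k`. -/
theorem mem_fixedRing_iff_coef {s : D.Cover} :
    s ∈ D.fixedRing ↔ ∀ k < p, D.coef k s ∈ D.eigen k := by
  have key : ∀ k, D.σ (D.coef k s) * D.cInv ^ k = D.coef k s ↔ D.coef k s ∈ D.eigen k := fun k => by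
    rw [mem_eigen]
    constructor <;> intro h
    · linear_combination D.c ^ k * h - D.σ (D.coef k s) * D.cInv_pow_mul k
    · linear_combination D.cInv ^ k * h + D.coef k s * D.cInv_pow_mul k
  constructor
  · intro h k hk
    rw [← key, ← D.coef_coverσ s hk, D.mem_fixedRing.1 h]
  · intro h
    refine D.mem_fixedRing.2 (D.cover_ext fun k hk => ?_)
    rw [D.coef_coverσ s hk, (key k).2 (h k hk)]

theorem incl_mul_T_pow_mem_fixedRing {k : ℕ} {a : A} (ha : a ∈ D.eigen k) :
    D.incl a * D.T ^ k ∈ D.fixedRing := by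
  rw [mem_fixedRing, coverσ_incl_mul_T_pow, ha]
  congr 2
  linear_combination a * D.cInv_pow_mul k

/-- The homogeneous element `a T ^ k`. -/
def mono (k : ℕ) (a : A) (ha : a ∈ D.eigen k) : D.fixedRing :=
  ⟨D.incl a * D.T ^ k, D.incl_mul_T_pow_mem_fixedRing ha⟩

@[simp] theorem coe_mono (k : ℕ) (a : A) (ha : a ∈ D.eigen k) :
    (D.mono k a ha : D.Cover) = D.incl a * D.T ^ k := rfl

theorem mono_mul_mono {k l : ℕ} {a b : A} (ha : a ∈ D.eigen k) (hb : b ∈ D.eigen l) :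
    D.mono k a ha * D.mono l b hb = D.mono (k + l) (a * b) (D.mul_mem_eigen ha hb) := by
  ext
  simp only [Subring.coe_mul, coe_mono, map_mul, pow_add]
  ring

theorem coef_mem_eigen (r : D.fixedRing) (k : ℕ) : D.coef k (r : D.Cover) ∈ D.eigen k := by
  rcases lt_or_ge k p with hk | hk
  · exact (D.mem_fixedRing_iff_coef.1 r.2) k hk
  · rw [D.coef_eq_zero_of_le hk]
    exact zero_mem _

theorem sum_mono_coef (r : D.fixedRing) :
    ∑ k ∈ range p, D.mono k (D.coef k (r : D.Cover)) (D.coef_mem_eigen r k) = r := by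
  ext
  rw [AddSubmonoidClass.coe_finsetSum]
  exact D.sum_coef r

/-- The grading of the ring of invariants by powers of `T`. -/
def grading (b : ZMod p) : AddSubgroup D.fixedRing where
  carrier := {r | ∀ k < p, k ≠ b.val → D.coef k (r : D.Cover) = 0}
  zero_mem' := by simp
  add_mem' := fun {r s} hr hs k hk hkb => by
    rw [Subring.coe_add, map_add, hr k hk hkb, hs k hk hkb, add_zero]
  neg_mem' := fun {r} hr k hk hkb => by
    rw [Subring.coe_neg, map_neg, hr k hk hkb, neg_zero]

theorem mem_grading_iff {b : ZMod p} {r : D.fixedRing} :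
    r ∈ D.grading b ↔ r = D.mono b.val (D.coef b.val (r : D.Cover)) (D.coef_mem_eigen r _) := by
  constructor
  · intro h
    refine Subtype.ext (D.cover_ext fun k hk => ?_)
    rw [coe_mono, D.coef_incl_mul_T_pow (ZMod.val_lt b)]
    split_ifs with hkb
    · rw [hkb]
    · exact h k hk hkb
  · intro h k hk hkb
    rw [h, coe_mono, D.coef_incl_mul_T_pow (ZMod.val_lt b), if_neg hkb]

theorem mono_mem_grading {k : ℕ} {a : A} (ha : a ∈ D.eigen k) {b : ZMod p} (hb : (k : ZMod p) = b) :
    D.mono k a ha ∈ D.grading b := by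
  subst hb
  intro l hl hlk
  rw [coe_mono, incl_mul_T_pow, D.coef_incl_mul_T_pow (Nat.mod_lt _ hp.out.pos), if_neg]
  rwa [ZMod.val_natCast] at hlk

theorem exists_mono_of_mem_grading {b : ZMod p} {r : D.fixedRing} (hr : r ∈ D.grading b) :
    ∃ (a : A) (ha : a ∈ D.eigen b.val), r = D.mono b.val a ha :=
  ⟨_, _, D.mem_grading_iff.1 hr⟩

instance : SetLike.GradedMonoid D.grading where
  one_mem := by
    have : (1 : D.fixedRing) = D.mono 0 1 D.one_mem_eigen := by
      ext
      simp
    rw [this]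
    exact D.mono_mem_grading _ (by simp)
  mul_mem := fun i j r s hr hs => by
    obtain ⟨a, ha, rfl⟩ := D.exists_mono_of_mem_grading hr
    obtain ⟨b, hb, rfl⟩ := D.exists_mono_of_mem_grading hs
    rw [mono_mul_mono]
    exact D.mono_mem_grading _ (by simp)

/-- The homogeneous components of an invariant. -/
def component (b : ZMod p) : D.fixedRing →+ D.grading b where
  toFun r := ⟨D.mono b.val (D.coef b.val (r : D.Cover)) (D.coef_mem_eigen r _),
    D.mono_mem_grading _ (by simp)⟩
  map_zero' := by
    ext
    simp
  map_add' r s := by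
    ext
    simp [add_mul]

instance : DirectSum.Decomposition D.grading :=
  DirectSum.Decomposition.ofAddHom D.grading
    (∑ b : ZMod p, (DirectSum.of (fun b => D.grading b) b).comp (D.component b))
    (by
      ext r : 1
      simp only [AddMonoidHom.comp_apply, AddMonoidHom.finsetSum_apply, map_sum,
        DirectSum.coeAddMonoidHom_of, AddMonoidHom.id_apply]
      conv_rhs => rw [← D.sum_mono_coef r]
      refine sum_nbij (fun b : ZMod p => b.val) (fun b _ => mem_range.2 (ZMod.val_lt b))
        (fun a _ b _ h => ZMod.val_injective p h)
        (fun k hk => ⟨(k : ZMod p), by simp, ZMod.val_cast_of_lt (by simpa using hk)⟩)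
        (fun b _ => rfl))
    (by
      ext b r : 2
      simp only [AddMonoidHom.comp_apply, AddMonoidHom.finsetSum_apply,
        DirectSum.coeAddMonoidHom_of, AddMonoidHom.id_apply]
      rw [sum_eq_single b]
      · congr 1
        exact Subtype.ext (D.mem_grading_iff.1 r.2).symm
      · intro c _ hcb
        have : D.component c r = 0 := by
          refine Subtype.ext (Subtype.ext ?_)
          have h0 := r.2 c.val (ZMod.val_lt c) fun h => hcb (ZMod.val_injective p h)
          simp [component, h0]
        rw [this, map_zero]
      · simp)

instance : GradedRing D.grading where

/-- A ring that maps isomorphically to the invariants of `σ` is the part of weight zero. -/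
def gradeZeroEquiv {B : Type*} [CommRing B] (φ : B →+* A) (hφ : Function.Injective φ)
    (hrange : ∀ a, a ∈ Set.range φ ↔ D.σ a = a) : B ≃+* SetLike.GradeZero.subring D.grading :=
  have hφ0 : ∀ b, φ b ∈ D.eigen 0 := fun b => by
    rw [mem_eigen, pow_zero, one_mul]
    exact (hrange _).1 ⟨b, rfl⟩
  have hmem : ∀ b, D.incl (φ b) ∈ D.fixedRing := fun b => by
    simpa using D.incl_mul_T_pow_mem_fixedRing (hφ0 b)
  RingEquiv.ofBijective
    (((D.incl.comp φ).codRestrict D.fixedRing hmem).codRestrict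
      (SetLike.GradeZero.subring D.grading) fun b => by
        have : ((D.incl.comp φ).codRestrict D.fixedRing hmem) b = D.mono 0 (φ b) (hφ0 b) := by
          ext
          simp
        rw [this]
        exact D.mono_mem_grading _ (by simp)) (by
    constructor
    · intro a b h
      have h' : D.incl (φ a) = D.incl (φ b) := congrArg Subtype.val (congrArg Subtype.val h)
      exact hφ (D.incl_injective h')
    · intro r
      obtain ⟨a, ha, hr⟩ := D.exists_mono_of_mem_grading r.2
      rw [ZMod.val_zero] at ha
      obtain ⟨b, rfl⟩ := (hrange a).2 (by simpa [mem_eigen] using ha)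
      refine ⟨b, Subtype.ext ?_⟩
      rw [hr]
      ext
      simp)

end FixedRing

/-! ### Functoriality of the graded ring -/

section Functoriality

variable {p : ℕ} {A A' : Type u} [CommRing A] [CommRing A'] {D : TwistDatum p A}
  {D' : TwistDatum p A'} {φ : A →+* A'}

/-- Compatibility of a ring homomorphism with the actions of `ℤ/p` and the cocycles. -/
structure IsCompatible (D : TwistDatum p A) (D' : TwistDatum p A') (φ : A →+* A') : Prop where
  map_σ : ∀ a, φ (D.σ a) = D'.σ (φ a)
  map_c : φ D.c = D'.c

namespace IsCompatible

theorem map_coc (h : IsCompatible D D' φ) (k : ℕ) : φ (D.coc k) = D'.coc k := by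
  induction k with
  | zero => simp
  | succ k ih => rw [coc_succ, map_mul, h.map_c, h.map_σ, ih, coc_succ]

theorem map_tau (h : IsCompatible D D' φ) : φ D.tau = D'.tau := by
  simp only [tau, map_prod, h.map_coc]

theorem map_mem_eigen (h : IsCompatible D D' φ) {k : ℕ} {a : A} (ha : a ∈ D.eigen k) :
    φ a ∈ D'.eigen k := by
  rw [mem_eigen] at *
  rw [← h.map_σ, ha, map_mul, map_pow, h.map_c]

/-- The induced homomorphism of covers. -/
def mapCover (h : IsCompatible D D' φ) : D.Cover →+* D'.Cover :=
  AdjoinRoot.lift (D'.incl.comp φ) D'.T (by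
    rw [eval₂_sub, eval₂_C, eval₂_X_pow, T_pow, RingHom.comp_apply, h.map_tau, sub_self])

@[simp] theorem mapCover_incl (h : IsCompatible D D' φ) (a : A) :
    h.mapCover (D.incl a) = D'.incl (φ a) :=
  AdjoinRoot.lift_of _

@[simp] theorem mapCover_T (h : IsCompatible D D' φ) : h.mapCover D.T = D'.T :=
  AdjoinRoot.lift_root _

variable [hp : Fact p.Prime]

theorem coef_mapCover (h : IsCompatible D D' φ) (s : D.Cover) {k : ℕ} (hk : k < p) :
    D'.coef k (h.mapCover s) = φ (D.coef k s) := by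
  conv_lhs => rw [← D.sum_coef s]
  simp only [map_sum, map_mul, map_pow, mapCover_incl, mapCover_T]
  rw [← map_sum]
  exact D'.coef_sum (fun j => φ (D.coef j s)) hk

/-- The induced homomorphism of rings of invariants. -/
def mapFixed (h : IsCompatible D D' φ) : D.fixedRing →+* D'.fixedRing :=
  (h.mapCover.comp D.fixedRing.subtype).codRestrict D'.fixedRing fun r => by
    rw [mem_fixedRing_iff_coef]
    intro k hk
    rw [RingHom.comp_apply, h.coef_mapCover _ hk]
    exact h.map_mem_eigen (D.coef_mem_eigen r k)

theorem coef_mapFixed (h : IsCompatible D D' φ) (r : D.fixedRing) {k : ℕ} (hk : k < p) :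
    D'.coef k (h.mapFixed r : D'.Cover) = φ (D.coef k (r : D.Cover)) :=
  h.coef_mapCover _ hk

theorem mapFixed_mono (h : IsCompatible D D' φ) {k : ℕ} {a : A} (ha : a ∈ D.eigen k) :
    h.mapFixed (D.mono k a ha) = D'.mono k (φ a) (h.map_mem_eigen ha) := by
  refine Subtype.ext ?_
  change h.mapCover (D.incl a * D.T ^ k) = _
  simp

theorem mapFixed_mem_grading (h : IsCompatible D D' φ) {b : ZMod p} {r : D.fixedRing}
    (hr : r ∈ D.grading b) : h.mapFixed r ∈ D'.grading b := by
  obtain ⟨a, ha, rfl⟩ := D.exists_mono_of_mem_grading hr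
  rw [h.mapFixed_mono]
  exact D'.mono_mem_grading _ (by simp)

end IsCompatible

end Functoriality

end TwistDatum

namespace TwistDatum

open Polynomial Finset

open scoped Pointwise

/-! ### The quotient by `σ`: fibres, heights, contraction of ideals -/

section Invariants

variable {p : ℕ} {A : Type*} [CommRing A] (D : TwistDatum p A) [hp : Fact p.Prime]
  {B : Type*} [CommRing B]

/-- The automorphism `σ`. -/
def aut : RingAut A := RingEquiv.ofBijective D.σ D.bijective

theorem aut_pow_apply (k : ℕ) (a : A) : (D.aut ^ k) a = D.σ^[k] a := by
  induction k with
  | zero => rfl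
  | succ k ih =>
    rw [pow_succ', RingAut.mul_apply, ih, Function.iterate_succ_apply']
    rfl

/-- The cyclic group generated by `σ`. -/
abbrev group : Subgroup (RingAut A) := Subgroup.zpowers D.aut

theorem isOfFinOrder_aut : IsOfFinOrder D.aut :=
  isOfFinOrder_iff_pow_eq_one.2
    ⟨p, hp.out.pos, RingEquiv.ext fun a => by rw [aut_pow_apply, D.iterate_eq]; rfl⟩

instance : Finite D.group := D.isOfFinOrder_aut.finite_zpowers

theorem exists_pow_of_mem_group (g : D.group) : ∃ k : ℕ, (g : RingAut A) = D.aut ^ k := by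
  obtain ⟨k, hk⟩ := D.isOfFinOrder_aut.mem_powers_iff_mem_zpowers.2 g.2
  exact ⟨k, hk.symm⟩

theorem group_smul_eq {a : A} (ha : D.σ a = a) (g : D.group) : g • a = a := by
  obtain ⟨k, hk⟩ := D.exists_pow_of_mem_group g
  change (g : RingAut A) a = a
  rw [hk, aut_pow_apply]
  exact Function.iterate_fixed ha k

theorem isInvariant [Algebra B A] (hrange : ∀ a, a ∈ Set.range (algebraMap B A) ↔ D.σ a = a) :
    Algebra.IsInvariant B A D.group :=
  ⟨fun a ha => (hrange a).2 (ha ⟨D.aut, Subgroup.mem_zpowers _⟩)⟩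

theorem smulCommClass [Algebra B A] (hrange : ∀ a, a ∈ Set.range (algebraMap B A) ↔ D.σ a = a) :
    SMulCommClass D.group B A :=
  ⟨fun g b a => by
    rw [Algebra.smul_def, Algebra.smul_def, smul_mul', D.group_smul_eq ((hrange _).1 ⟨b, rfl⟩)]⟩

theorem isIntegral [Algebra B A] (hrange : ∀ a, a ∈ Set.range (algebraMap B A) ↔ D.σ a = a) :
    Algebra.IsIntegral B A :=
  have := D.isInvariant hrange
  Algebra.IsInvariant.isIntegral B A D.group

theorem height_comap (φ : B →+* A) (hφ : Function.Injective φ)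
    (hrange : ∀ a, a ∈ Set.range φ ↔ D.σ a = a) (Q : Ideal A) [hQ : Q.IsPrime] :
    (Q.comap φ).height = Q.height := by
  let := φ.toAlgebra
  have := D.isInvariant hrange
  have := D.smulCommClass hrange
  exact height_under_eq_of_isInvariant B A D.group hφ Q

/-- The fibres of the quotient are orbits, and a `σ`-stable prime is its own orbit. -/
theorem eq_of_comap_eq (φ : B →+* A) (hrange : ∀ a, a ∈ Set.range φ ↔ D.σ a = a) {P Q : Ideal A}
    [hP : P.IsPrime] [hQ : Q.IsPrime] (hstable : ∀ a ∈ P, D.σ a ∈ P) (h : P.comap φ = Q.comap φ) :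
    Q = P := by
  let := φ.toAlgebra
  have := D.isInvariant hrange
  have := D.smulCommClass hrange
  have := D.isIntegral hrange
  obtain ⟨g, rfl⟩ := Algebra.IsInvariant.exists_smul_of_under_eq B A D.group P Q h
  have hle : g • P ≤ P := by
    intro a ha
    replace ha : g⁻¹ • a ∈ P := Ideal.mem_pointwise_smul_iff_inv_smul_mem.1 ha
    obtain ⟨k, hk⟩ := D.exists_pow_of_mem_group g
    have hiter : ∀ k : ℕ, ∀ a ∈ P, D.σ^[k] a ∈ P := by
      intro k
      induction k with
      | zero => exact fun a ha => ha
      | succ k ih =>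
        intro a ha
        rw [Function.iterate_succ_apply']
        exact hstable _ (ih a ha)
    have := hiter k _ ha
    rw [← aut_pow_apply, ← hk] at this
    have e : g • (g⁻¹ • a) = a := smul_inv_smul g a
    exact e ▸ this
  by_contra hne
  exact (Ideal.IsIntegral.comap_lt_comap (R := B) (lt_of_le_of_ne hle hne)).ne h.symm

/-- The projection to weight zero is linear over the invariants, maps the extension of `I` back into
`I` and fixes `φ r`; it plays the role of a Reynolds operator. -/
theorem IsAdmissible.comap_map_eq {D : TwistDatum p A} {ε : A} (h : D.IsAdmissible ε)
    (φ : B →+* A) (hφ : Function.Injective φ) (hrange : ∀ a, a ∈ Set.range φ ↔ D.σ a = a)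
    (I : Ideal B) : (I.map φ).comap φ = I := by
  refine le_antisymm (fun r hr => ?_) Ideal.le_comap_map
  -- The additional factor `a` makes the claim stable under scalars in the induction over the span.
  have key : ∀ x ∈ I.map φ, ∀ a : A, ∃ f : ℕ → A, (∀ i, f i ∈ D.eigen i) ∧
      ∑ i ∈ range p, f i = a * x ∧ ∃ b ∈ I, φ b = f 0 := by
    intro x hx
    refine Submodule.span_induction ?_ ?_ ?_ ?_ hx
    · rintro _ ⟨b, hb, rfl⟩ a
      have hb0 : φ b ∈ D.eigen 0 := by
        rw [mem_eigen, pow_zero, one_mul]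
        exact (hrange _).1 ⟨b, rfl⟩
      obtain ⟨f, -, hf, hsum⟩ := h.exists_eigen_decomposition (M := ⊤) (a := a)
        (fun m _ => by
          obtain ⟨m', hm'⟩ := h.dvd_sub m
          exact ⟨m', trivial, hm'⟩) trivial
      obtain ⟨b', hb'⟩ := (hrange (f 0)).2 (by simpa [mem_eigen] using hf 0)
      refine ⟨fun i => f i * φ b, fun i => by simpa using D.mul_mem_eigen (hf i) hb0, ?_,
        b' * b, I.mul_mem_left _ hb, by rw [map_mul, hb']⟩
      rw [← sum_mul, hsum]
    · exact fun a => ⟨0, fun i => zero_mem _, by simp, 0, I.zero_mem, by simp⟩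
    · intro x y _ _ hx hy a
      obtain ⟨f, hf, hfs, b, hb, hbf⟩ := hx a
      obtain ⟨g, hg, hgs, c, hc, hcg⟩ := hy a
      refine ⟨f + g, fun i => add_mem (hf i) (hg i), ?_, b + c, I.add_mem hb hc, by
        rw [map_add, hbf, hcg]; rfl⟩
      simp only [Pi.add_apply, sum_add_distrib, hfs, hgs, mul_add]
    · intro c x _ hx a
      obtain ⟨f, hf, hfs, hb⟩ := hx (a * c)
      exact ⟨f, hf, by rw [hfs, smul_eq_mul, mul_assoc], hb⟩
  obtain ⟨f, hf, hfs, b, hb, hbf⟩ := key (φ r) hr 1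
  have hr0 : φ r ∈ D.eigen 0 := by
    rw [mem_eigen, pow_zero, one_mul]
    exact (hrange _).1 ⟨r, rfl⟩
  have h0 := h.eq_zero_of_sum_eigen_eq_zero (f := fun i => f i - if i = 0 then φ r else 0)
    (fun i => by
      split_ifs with hi
      · subst hi
        exact sub_mem (hf 0) hr0
      · simpa using hf i)
    (by
      rw [sum_sub_distrib, hfs, sum_ite_eq' (range p) 0, if_pos (mem_range.2 hp.out.pos)]
      simp) 0 hp.out.pos
  simp only [if_true, ← hbf] at h0
  rw [sub_eq_zero] at h0
  rwa [← hφ h0]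

theorem IsAdmissible.isNoetherianRing {D : TwistDatum p A} {ε : A} (h : D.IsAdmissible ε)
    [IsNoetherianRing A] (φ : B →+* A) (hφ : Function.Injective φ)
    (hrange : ∀ a, a ∈ Set.range φ ↔ D.σ a = a) : IsNoetherianRing B := by
  have hmono : StrictMono (Ideal.map φ : Ideal B → Ideal A) :=
    Monotone.strictMono_of_injective (fun _ _ h => Ideal.map_mono h)
      (Function.LeftInverse.injective (h.comap_map_eq φ hφ hrange))
  rw [isNoetherianRing_iff, isNoetherian_iff']
  exact hmono.wellFoundedGT

end Invariants

/-! ### The graded ring over a local ring -/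

section Local

variable {p : ℕ} {A : Type u} [CommRing A] {D : TwistDatum p A} [hp : Fact p.Prime] {ε : A}

variable (D) in
theorem mem_range_subtype_iff (s : D.Cover) :
    s ∈ Set.range D.fixedRing.subtype ↔ D.cover.σ s = s := by
  rw [cover_σ, ← mem_fixedRing]
  exact ⟨fun ⟨r, hr⟩ => hr ▸ r.2, fun h => ⟨⟨s, h⟩, rfl⟩⟩

variable (D) in
theorem finite_cover : Module.Finite A D.Cover := D.monic_poly.finite_adjoinRoot

theorem IsAdmissible.isNoetherianRing_fixedRing (h : D.IsAdmissible ε) [IsNoetherianRing A] :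
    IsNoetherianRing D.fixedRing :=
  have := D.finite_cover
  have : IsNoetherianRing D.Cover := IsNoetherianRing.of_finite A D.Cover
  h.cover.isNoetherianRing D.fixedRing.subtype Subtype.val_injective D.mem_range_subtype_iff

variable (D) in
-- The cover is integral over both rings.
theorem ringKrullDim_fixedRing : ringKrullDim D.fixedRing = ringKrullDim A := by
  have := D.finite_cover
  have h1 := ringKrullDim_eq_of_isIntegral A D.Cover D.incl_injective
  have : Algebra.IsIntegral D.fixedRing D.Cover := D.cover.isIntegral D.mem_range_subtype_iff
  rw [h1]
  exact ringKrullDim_eq_of_isIntegral D.fixedRing D.Cover Subtype.val_injective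

theorem isUnit_of_isUnit_coe {r : D.fixedRing} (hr : IsUnit (r : D.Cover)) : IsUnit r := by
  obtain ⟨s, hs⟩ := isUnit_iff_exists_inv.1 hr
  have hfix : D.coverσ s = s := by
    have := congrArg D.coverσ hs
    rw [map_mul, D.mem_fixedRing.1 r.2, map_one, ← hs] at this
    exact hr.mul_left_cancel this
  exact isUnit_iff_exists_inv.2 ⟨⟨s, hfix⟩, Subtype.ext hs⟩

variable [IsLocalRing A]

variable (D) in
theorem map_incl_le_of_isMaximal (M : Ideal D.Cover) [hM : M.IsMaximal] :
    (maximalIdeal A).map D.incl ≤ M := by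
  have := D.finite_cover
  have hmax : (M.comap (algebraMap A D.Cover)).IsMaximal :=
    Ideal.isMaximal_comap_of_isIntegral_of_isMaximal M
  rw [Ideal.map_le_iff_le_comap]
  exact (eq_maximalIdeal hmax).ge

theorem mem_map_incl {r : D.fixedRing} (hE : ∀ k, 0 < k → k < p → ∀ a ∈ D.eigen k, a ∈ maximalIdeal A)
    (h0 : D.coef 0 (r : D.Cover) ∈ maximalIdeal A) :
    (r : D.Cover) ∈ (maximalIdeal A).map D.incl := by
  rw [← D.sum_coef (r : D.Cover)]
  refine sum_mem fun k hk => Ideal.mul_mem_right _ _ (Ideal.mem_map_of_mem _ ?_)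
  rcases Nat.eq_zero_or_pos k with rfl | hk0
  · exact h0
  · exact hE k hk0 (mem_range.1 hk) _ (D.coef_mem_eigen r k)

/-- By `hE` an invariant is congruent modulo `𝔪` to its coefficient of degree zero, and every
maximal ideal of the cover contains `𝔪` since the cover is finite over `A`. -/
theorem isUnit_fixedRing_iff (hE : ∀ k, 0 < k → k < p → ∀ a ∈ D.eigen k, a ∈ maximalIdeal A)
    (r : D.fixedRing) : IsUnit r ↔ IsUnit (D.coef 0 (r : D.Cover)) := by
  constructor
  · intro hr
    by_contra h0
    have hJ := mem_map_incl hE ((mem_maximalIdeal _).2 h0)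
    have : Nontrivial D.Cover := D.incl_injective.nontrivial
    obtain ⟨M, hM⟩ := Ideal.exists_maximal D.Cover
    exact hM.ne_top (Ideal.eq_top_of_isUnit_mem _ (D.map_incl_le_of_isMaximal M hJ)
      (hr.map D.fixedRing.subtype))
  · intro h0
    refine isUnit_of_isUnit_coe ?_
    by_contra hr
    obtain ⟨M, hM, hrM⟩ := exists_max_ideal_of_mem_nonunits hr
    have h1 : (r : D.Cover) - D.incl (D.coef 0 (r : D.Cover)) ∈ M := by
      refine D.map_incl_le_of_isMaximal M ?_
      have := D.sum_coef (r : D.Cover)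
      rw [← add_sum_erase _ _ (mem_range.2 hp.out.pos), pow_zero, mul_one] at this
      rw [← eq_sub_iff_add_eq'.2 this]
      refine sum_mem fun k hk => Ideal.mul_mem_right _ _ (Ideal.mem_map_of_mem _ ?_)
      rw [mem_erase, mem_range] at hk
      exact hE k (Nat.pos_of_ne_zero hk.1) hk.2 _ (D.coef_mem_eigen r _)
    have h2 : D.incl (D.coef 0 (r : D.Cover)) ∈ M := by
      have := sub_mem hrM h1
      rwa [sub_sub_cancel] at this
    exact hM.ne_top (Ideal.eq_top_of_isUnit_mem _ h2 (h0.map D.incl))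

theorem isLocalRing_fixedRing
    (hE : ∀ k, 0 < k → k < p → ∀ a ∈ D.eigen k, a ∈ maximalIdeal A) : IsLocalRing D.fixedRing := by
  have : Nontrivial D.Cover := D.incl_injective.nontrivial
  refine IsLocalRing.of_nonunits_add fun a b ha hb => ?_
  rw [mem_nonunits_iff, isUnit_fixedRing_iff hE] at *
  rw [Subring.coe_add, map_add]
  exact add_mem (S := Ideal A) (s := maximalIdeal A) ha hb

theorem mem_maximalIdeal_fixedRing_iff [IsLocalRing D.fixedRing]
    (hE : ∀ k, 0 < k → k < p → ∀ a ∈ D.eigen k, a ∈ maximalIdeal A) (r : D.fixedRing) :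
    r ∈ maximalIdeal D.fixedRing ↔ D.coef 0 (r : D.Cover) ∈ maximalIdeal A := by
  rw [mem_maximalIdeal, mem_maximalIdeal, mem_nonunits_iff, mem_nonunits_iff,
    isUnit_fixedRing_iff hE]

theorem mono_mem_maximalIdeal [IsLocalRing D.fixedRing]
    (hE : ∀ k, 0 < k → k < p → ∀ a ∈ D.eigen k, a ∈ maximalIdeal A) {k : ℕ} {a : A}
    (ha : a ∈ D.eigen k) (ham : a ∈ maximalIdeal A) : D.mono k a ha ∈ maximalIdeal D.fixedRing := by
  rw [mem_maximalIdeal_fixedRing_iff hE, coe_mono, incl_mul_T_pow,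
    D.coef_incl_mul_T_pow (Nat.mod_lt _ hp.out.pos)]
  split_ifs
  · exact Ideal.mul_mem_right _ _ ham
  · exact zero_mem _

/-- In the cover `T` is a unit, so the monomials generate the same ideal as the `t i`; contraction
to the invariants loses nothing by `comap_map_eq`. -/
theorem IsAdmissible.span_mono_eq [IsLocalRing D.fixedRing] (h : D.IsAdmissible ε)
    (hE : ∀ k, 0 < k → k < p → ∀ a ∈ D.eigen k, a ∈ maximalIdeal A) {ι : Type*} {t : ι → A}
    {c : ι → ℕ} (ht : ∀ i, t i ∈ D.eigen (c i)) (hspan : Ideal.span (Set.range t) = maximalIdeal A) :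
    Ideal.span (Set.range fun i => D.mono (c i) (t i) (ht i)) = maximalIdeal D.fixedRing := by
  refine le_antisymm ?_ fun r hr => ?_
  · rw [Ideal.span_le]
    rintro _ ⟨i, rfl⟩
    exact mono_mem_maximalIdeal hE _ (hspan ▸ Ideal.subset_span ⟨i, rfl⟩)
  · rw [← h.cover.comap_map_eq D.fixedRing.subtype Subtype.val_injective D.mem_range_subtype_iff
      (Ideal.span (Set.range fun i => D.mono (c i) (t i) (ht i))), Ideal.mem_comap]
    have hle : (maximalIdeal A).map D.incl ≤
        (Ideal.span (Set.range fun i => D.mono (c i) (t i) (ht i))).map D.fixedRing.subtype := by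
      rw [← hspan, Ideal.map_span, Ideal.span_le]
      rintro _ ⟨_, ⟨i, rfl⟩, rfl⟩
      have : D.fixedRing.subtype (D.mono (c i) (t i) (ht i)) ∈
          (Ideal.span (Set.range fun i => D.mono (c i) (t i) (ht i))).map D.fixedRing.subtype :=
        Ideal.mem_map_of_mem _ (Ideal.subset_span ⟨i, rfl⟩)
      exact (Ideal.mul_unit_mem_iff_mem _ (D.isUnit_T.pow (c i))).1 this
    exact hle (mem_map_incl hE ((mem_maximalIdeal_fixedRing_iff hE r).1 hr))

/-- The components of weight `0 < k < p` lie in `𝔪` by `hE`; for `a ∈ 𝔪` the remaining one is then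
in `𝔪` by subtraction. -/
theorem IsAdmissible.span_homogeneous (h : D.IsAdmissible ε)
    (hE : ∀ k, 0 < k → k < p → ∀ a ∈ D.eigen k, a ∈ maximalIdeal A) :
    Ideal.span {a : A | a ∈ maximalIdeal A ∧ ∃ k < p, a ∈ D.eigen k} = maximalIdeal A := by
  refine le_antisymm (Ideal.span_le.2 fun a ha => ha.1) fun a ha => ?_
  obtain ⟨f, -, hf, hsum⟩ := h.exists_eigen_decomposition (M := ⊤) (a := a)
    (fun m _ => by
      obtain ⟨m', hm'⟩ := h.dvd_sub m
      exact ⟨m', trivial, hm'⟩) trivial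
  have hpos : ∀ k, 0 < k → k < p → f k ∈ maximalIdeal A := fun k h0 hk => hE k h0 hk _ (hf k)
  have hall : ∀ k < p, f k ∈ maximalIdeal A := by
    intro k hk
    rcases Nat.eq_zero_or_pos k with rfl | h0
    · rw [← add_sum_erase _ _ (mem_range.2 hk)] at hsum
      rw [eq_sub_of_add_eq hsum]
      refine sub_mem ha (sum_mem fun j hj => ?_)
      rw [mem_erase, mem_range] at hj
      exact hpos j (Nat.pos_of_ne_zero hj.1) hj.2
    · exact hpos k h0 hk
  rw [← hsum]
  exact sum_mem fun k hk => Ideal.subset_span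
    ⟨hall k (mem_range.1 hk), k, mem_range.1 hk, hf k⟩

end Local

/-! ### Regularity of the graded ring -/

section Regular

variable {p : ℕ} {A : Type u} [CommRing A] [IsRegularLocalRing A] {D : TwistDatum p A}
  [hp : Fact p.Prime] {ε : A}

theorem IsAdmissible.isRegularLocalRing_fixedRing (h : D.IsAdmissible ε)
    (hE : ∀ k, 0 < k → k < p → ∀ a ∈ D.eigen k, a ∈ maximalIdeal A) {n : ℕ} {t : Fin n → A}
    {c : Fin n → ℕ} (ht : ∀ i, t i ∈ D.eigen (c i)) (hcoord : IsCoordinateSystem t) :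
    IsRegularLocalRing D.fixedRing := by
  have := isLocalRing_fixedRing hE
  have := h.isNoetherianRing_fixedRing
  refine IsRegularLocalRing.of_spanFinrank_maximalIdeal_le _ ?_
  rw [D.ringKrullDim_fixedRing, ← (IsRegularLocalRing.iff_finrank_cotangentSpace A).1 inferInstance,
    hcoord.finrank_eq, ← h.span_mono_eq hE ht hcoord.span_eq]
  have h1 : (Set.range fun i => D.mono (c i) (t i) (ht i)).ncard ≤ n := by
    rw [← Set.image_univ]
    simpa [Set.ncard_univ] using Set.ncard_image_le (f := fun i => D.mono (c i) (t i) (ht i))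
      (Set.finite_univ (α := Fin n))
  exact_mod_cast (Submodule.spanFinrank_span_le_ncard_of_finite (R := D.fixedRing)
    (Set.finite_range fun i => D.mono (c i) (t i) (ht i))).trans h1

theorem IsAdmissible.isCoordinateSystem_mono (h : D.IsAdmissible ε)
    [IsRegularLocalRing D.fixedRing]
    (hE : ∀ k, 0 < k → k < p → ∀ a ∈ D.eigen k, a ∈ maximalIdeal A) {n : ℕ} {t : Fin n → A}
    {c : Fin n → ℕ} (ht : ∀ i, t i ∈ D.eigen (c i)) (hcoord : IsCoordinateSystem t) :
    IsCoordinateSystem fun i => D.mono (c i) (t i) (ht i) := by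
  refine isCoordinateSystem_of_span_eq (h.span_mono_eq hE ht hcoord.span_eq) ?_
  have h1 := (IsRegularLocalRing.iff_finrank_cotangentSpace A).1 inferInstance
  have h2 := (IsRegularLocalRing.iff_finrank_cotangentSpace D.fixedRing).1 inferInstance
  rw [D.ringKrullDim_fixedRing, ← h1, hcoord.finrank_eq] at h2
  have : Module.finrank (ResidueField D.fixedRing) (CotangentSpace D.fixedRing) = n := by
    exact_mod_cast h2
  exact this.ge

end Regular

end TwistDatum

/-! ### Minimal primes, height one and divisors -/

theorem exists_pow_mul_mem_of_mem_minimalPrimes {R : Type*} [CommRing R] {I q : Ideal R}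
    (hq : q ∈ I.minimalPrimes) {f : R} (hf : f ∈ q) : ∃ (N : ℕ) (t : R), t ∉ q ∧ f ^ N * t ∈ I := by
  have hqp : q.IsPrime := hq.1.1
  by_contra! hcon
  have hdisj : Disjoint (I : Set R) (Submonoid.powers f ⊔ q.primeCompl : Submonoid R) := by
    rw [Set.disjoint_left]
    intro x hx hx'
    obtain ⟨_, ⟨N, rfl⟩, t, ht, rfl⟩ := Submonoid.mem_sup.1 hx'
    exact hcon N t ht hx
  obtain ⟨Q, hQ, hIQ, hQd⟩ := Ideal.exists_le_prime_disjoint I _ hdisj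
  rw [Set.disjoint_left] at hQd
  have hle : Q ≤ q := fun x hx => by
    by_contra hxq
    exact hQd hx (Submonoid.mem_sup_right (show x ∈ q.primeCompl from hxq))
  exact hQd (hq.2 ⟨hQ, hIQ⟩ hle hf) (Submonoid.mem_sup_left ⟨1, pow_one f⟩)

theorem mem_minimalPrimes_span_of_height_le_one {R : Type*} [CommRing R] [IsDomain R]
    {q : Ideal R} [q.IsPrime] (hq : q.height ≤ 1) {x : R} (hx : x ∈ q) (hx0 : x ≠ 0) :
    q ∈ (Ideal.span {x}).minimalPrimes := by
  refine ⟨⟨inferInstance, (Ideal.span_singleton_le_iff_mem _).2 hx⟩, fun Q hQ hQq => ?_⟩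
  by_contra hne
  have hlt : Q < q := lt_of_le_not_ge hQq hne
  have hQp := hQ.1
  have h1 := Ideal.height_add_one_le_of_lt_of_isPrime hlt
  have h0 : Q.height = 0 := by
    have : Q.height + 1 ≤ 0 + 1 := by simpa using h1.trans hq
    exact nonpos_iff_eq_zero.1 ((ENat.add_le_add_iff_right ENat.one_ne_top).1 this)
  rw [Ideal.height_eq_zero_iff, IsDomain.minimalPrimes_eq_singleton_bot,
    Set.mem_singleton_iff] at h0
  subst h0
  exact hx0 (hQ.2 (Ideal.mem_span_singleton_self x))

/-- Two elements of a noetherian domain with the same divisor are associated, if one of them is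
prime. -/
theorem exists_unit_of_same_divisor {R : Type*} [CommRing R] [IsDomain R] [IsNoetherianRing R]
    {x y : R} (hx : Prime x) (hxy : x ∣ y) (hyx : ∃ w, ¬ x ∣ w ∧ y ∣ w * x)
    (h : ∀ q : Ideal R, q.IsPrime → q.height = 1 → x ∉ q → y ∉ q) : ∃ v : Rˣ, y = x * v := by
  obtain ⟨k, rfl⟩ := hxy
  obtain ⟨w, hw, m, hm⟩ := hyx
  have hw' : w = k * m := mul_left_cancel₀ hx.ne_zero (by linear_combination hm)
  have hk0 : k ≠ 0 := by
    rintro rfl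
    exact hw ⟨0, by rw [hw']; ring⟩
  by_contra hcon
  -- A minimal prime `q` of the cofactor `k` has height one. If it avoids `x`, this contradicts `h`;
  -- otherwise `q = (x)`, so `x` divides `k` and hence `w = k * m`.
  have hku : ¬ IsUnit k := fun hu => hcon ⟨hu.unit, rfl⟩
  have hne : Ideal.span {k} ≠ ⊤ := fun h => hku (Ideal.span_singleton_eq_top.1 h)
  obtain ⟨q, hq⟩ := Ideal.nonempty_minimalPrimes hne
  have hqp : q.IsPrime := hq.1.1
  have hkq : k ∈ q := hq.1.2 (Ideal.mem_span_singleton_self k)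
  have hq1 : q.height ≤ 1 := Ideal.height_le_one_of_isPrincipal_of_mem_minimalPrimes _ q hq
  have hq1' : q.height = 1 := by
    refine le_antisymm hq1 (Order.one_le_iff_ne_zero.2 fun h0 => ?_)
    rw [Ideal.height_eq_zero_iff, IsDomain.minimalPrimes_eq_singleton_bot,
      Set.mem_singleton_iff] at h0
    subst h0
    exact hk0 hkq
  have hxq : x ∈ q := by
    by_contra hxq
    exact h q hqp hq1' hxq (q.mul_mem_left _ hkq)
  have hprime : (Ideal.span {x}).IsPrime := (Ideal.span_singleton_prime hx.ne_zero).2 hx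
  have hqx := (mem_minimalPrimes_span_of_height_le_one hq1 hxq hx.ne_zero).2 ⟨hprime, le_rfl⟩
    ((Ideal.span_singleton_le_iff_mem _).2 hxq)
  obtain ⟨c, hc⟩ := Ideal.mem_span_singleton.1 (hqx hkq)
  exact hw ⟨c * m, by rw [hw', hc]; ring⟩

namespace TwistDatum

open Finset

/-! ### Arithmetic of homogeneous elements -/

section Monomials

variable {p : ℕ} {A : Type u} [CommRing A] (D : TwistDatum p A) [hp : Fact p.Prime]

theorem mul_tau_pow_mem_eigen {k l : ℕ} {a : A} :
    a * D.tau ^ l ∈ D.eigen k ↔ a ∈ D.eigen (k + p * l) := by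
  induction l generalizing a with
  | zero => simp
  | succ l ih =>
    rw [pow_succ', ← mul_assoc, ih, mul_tau_mem_eigen]
    ring_nf

theorem mono_pow {k : ℕ} {a : A} (ha : a ∈ D.eigen k) (m : ℕ) :
    D.mono k a ha ^ m = D.mono (m * k) (a ^ m) (D.pow_mem_eigen ha m) := by
  ext
  rw [Subring.coe_pow, coe_mono, coe_mono, mul_pow, map_pow, ← pow_mul, mul_comm k]

theorem mono_eq_mono_zero {l : ℕ} {a : A} (ha : a ∈ D.eigen (p * l)) :
    D.mono (p * l) a ha =
      D.mono 0 (a * D.tau ^ l) (D.mul_tau_pow_mem_eigen.2 (by rwa [zero_add])) := by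
  ext
  rw [coe_mono, coe_mono, pow_mul, T_pow, map_mul, map_pow, pow_zero, mul_one]

theorem mono_congr {k l : ℕ} {a b : A} (ha : a ∈ D.eigen k) (hb : b ∈ D.eigen l) (hkl : k = l)
    (hab : a = b) : D.mono k a ha = D.mono l b hb := by
  subst hkl hab
  rfl

theorem mono_mul_unit {k : ℕ} {a : A} (ha : a ∈ D.eigen k) (hu : IsUnit a) :
    IsUnit (D.mono k a ha) :=
  isUnit_of_isUnit_coe ((hu.map D.incl).mul (D.isUnit_T.pow k))

theorem coef_mono_mul {k : ℕ} {a : A} (ha : a ∈ D.eigen k) (r : D.fixedRing) (i : ℕ) :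
    a ∣ D.coef i ((D.mono k a ha * r : D.fixedRing) : D.Cover) :=
  ⟨D.coef i (D.T ^ k * r), by
    rw [Subring.coe_mul, coe_mono, mul_assoc, coef_incl_mul]⟩

/-- If `z` times a unit is homogeneous, the weights agree. -/
theorem eq_of_mono_mul_mem_grading {k : ℕ} {a : A} (ha : a ∈ D.eigen k) {v : D.fixedRing}
    (hv : a * D.coef 0 (v : D.Cover) ≠ 0) {b : ZMod p} (hb : D.mono k a ha * v ∈ D.grading b) :
    b = k := by
  obtain ⟨a', ha', h⟩ := D.exists_mono_of_mem_grading hb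
  -- Multiplication by `T ^ ((p - 1) * k)` moves degree `k` to degree `p * k`, that is, to degree
  -- zero, where coefficients are compared.
  have h1 := congrArg (fun r : D.fixedRing => D.coef 0 ((r : D.Cover) * D.T ^ ((p - 1) * k))) h
  simp only [Subring.coe_mul, coe_mono] at h1
  have e : k + (p - 1) * k = p * k := by
    obtain ⟨q, hq⟩ : ∃ q, p = q + 1 := ⟨p - 1, (Nat.sub_add_cancel hp.out.one_le).symm⟩
    rw [hq, Nat.add_sub_cancel]
    ring
  have e1 : D.incl a * D.T ^ k * (v : D.Cover) * D.T ^ ((p - 1) * k) =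
      D.incl (D.tau ^ k * a) * v := by
    have : D.T ^ k * D.T ^ ((p - 1) * k) = D.incl (D.tau ^ k) := by
      rw [← pow_add, e, pow_mul, T_pow, map_pow]
    rw [map_mul, ← this]
    ring
  rw [e1, coef_incl_mul, mul_assoc (D.incl a'), ← pow_add, incl_mul_T_pow,
    D.coef_incl_mul_T_pow (Nat.mod_lt _ hp.out.pos)] at h1
  split_ifs at h1 with h0
  · have h2 : ((b.val + (p - 1) * k : ℕ) : ZMod p) = 0 :=
      (ZMod.natCast_eq_zero_iff _ _).2 (Nat.dvd_of_mod_eq_zero h0.symm)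
    have h3 : ((k + (p - 1) * k : ℕ) : ZMod p) = 0 := by
      rw [e]
      simp
    rw [Nat.cast_add, ZMod.natCast_zmod_val] at h2
    rw [Nat.cast_add] at h3
    exact add_right_cancel (h2.trans h3.symm)
  · rw [mul_assoc] at h1
    exact absurd ((D.isUnit_tau.pow k).mul_left_eq_zero.1 (by rwa [mul_comm])) hv

end Monomials

/-! ### Prime elements of `A` and homogeneous elements of the graded ring -/

section PrimeElements

variable {p : ℕ} {A : Type u} [CommRing A] [IsDomain A] {D : TwistDatum p A} [hp : Fact p.Prime]
  {ε : A}

/-- The ideal `(y)` is stable under `(σ - 1)/ε`, so `y` decomposes inside it. The components are `y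
* c i` with `∑ c i = 1`, and in a local ring some `c i` is a unit. -/
theorem IsAdmissible.exists_mul_mem_eigen [IsLocalRing A] (h : D.IsAdmissible ε) {y : A}
    (hy : y ≠ 0) (hstab : ε * y ∣ D.σ y - y) : ∃ (w : Aˣ) (k : ℕ), k < p ∧ y * w ∈ D.eigen k := by
  obtain ⟨b, hb⟩ := hstab
  obtain ⟨f, hfM, hf, hsum⟩ := h.exists_eigen_decomposition (M := Ideal.span {y}) (a := y)
    (by
      intro m hm
      obtain ⟨a, rfl⟩ := Ideal.mem_span_singleton'.1 hm
      obtain ⟨d, hd⟩ := h.dvd_sub a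
      refine ⟨(D.σ a * b + d) * y, Ideal.mem_span_singleton'.2 ⟨_, rfl⟩, ?_⟩
      rw [map_mul]
      linear_combination D.σ a * hb + y * hd) (Ideal.mem_span_singleton_self y)
  choose c hc using fun i => Ideal.mem_span_singleton.1 (hfM i)
  have hsum' : ∑ i ∈ range p, c i = 1 := by
    refine mul_left_cancel₀ hy ?_
    rw [mul_sum, ← sum_congr rfl fun i _ => hc i, hsum, mul_one]
  obtain ⟨k, hk, hku⟩ : ∃ k < p, IsUnit (c k) := by
    by_contra! hcon
    have : (1 : A) ∈ maximalIdeal A := by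
      rw [← hsum']
      exact sum_mem fun i hi => (mem_maximalIdeal _).2 (hcon i (mem_range.1 hi))
    exact (mem_maximalIdeal _).1 this isUnit_one
  refine ⟨hku.unit, k, hk, ?_⟩
  rw [IsUnit.unit_spec, ← hc]
  exact hf k

/-- If `y` divided all eigenelements of weight `0 < i < p`, then `ε y` would divide every `σ a - a =
∑ (c ^ i - 1) f i`. Powers of one exception reach all weights modulo `p`, and powers of `τ` adjust
the multiple of `p`. -/
theorem IsAdmissible.exists_eigen_not_dvd (h : D.IsAdmissible ε) {y : A} (hy : Prime y)
    (hnot : ¬ ∀ a, ε * y ∣ D.σ a - a) (k : ℕ) : ∃ a ∈ D.eigen k, ¬ y ∣ a := by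
  obtain ⟨i, hi0, hip, a, ha, hya⟩ : ∃ i, 0 < i ∧ i < p ∧ ∃ a ∈ D.eigen i, ¬ y ∣ a := by
    by_contra! hcon
    refine hnot fun a => ?_
    obtain ⟨f, -, hf, hsum⟩ := h.exists_eigen_decomposition (M := ⊤) (a := a)
      (fun m _ => by
        obtain ⟨m', hm'⟩ := h.dvd_sub m
        exact ⟨m', trivial, hm'⟩) trivial
    rw [← hsum, map_sum, ← sum_sub_distrib]
    refine dvd_sum fun i hi => ?_
    rw [D.mem_eigen.1 (hf i)]
    rcases Nat.eq_zero_or_pos i with rfl | hi0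
    · simp
    · have h1 : ε ∣ D.c ^ i - 1 := by
        have h2 : ε ∣ D.c - 1 := ⟨1, by rw [h.c_eq]; ring⟩
        exact h2.trans (by simpa using sub_dvd_pow_sub_pow D.c 1 i)
      have := mul_dvd_mul h1 (hcon i hi0 (mem_range.1 hi) _ (hf i))
      rwa [sub_mul, one_mul] at this
  have hi' : (i : ZMod p) ≠ 0 := fun h0 =>
    absurd (Nat.le_of_dvd hi0 ((ZMod.natCast_eq_zero_iff _ _).1 h0)) (not_le.2 hip)
  -- The summand `p * k` does not change `m` modulo `p`; it ensures `k ≤ m * i`, so that `m * i - k`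
  -- is a true difference.
  set m := ((k : ZMod p) / i).val + p * k
  have hmk : ((m * i : ℕ) : ZMod p) = (k : ℕ) := by
    simp [m, div_mul_cancel₀ _ hi']
  have hle : k ≤ m * i := by
    calc k ≤ p * k := Nat.le_mul_of_pos_left k hp.out.pos
      _ ≤ m := Nat.le_add_left _ _
      _ ≤ m * i := Nat.le_mul_of_pos_right m hi0
  obtain ⟨l, hl⟩ : p ∣ m * i - k :=
    (Nat.modEq_iff_dvd' hle).1 ((ZMod.natCast_eq_natCast_iff _ _ _).1 hmk).symm
  refine ⟨a ^ m * D.tau ^ l, D.mul_tau_pow_mem_eigen.2 ?_, fun hdvd => ?_⟩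
  · rw [← hl, Nat.add_sub_cancel' hle]
    exact D.pow_mem_eigen ha m
  · exact hya (hy.dvd_of_dvd_pow ((D.isUnit_tau.pow l).dvd_mul_right.1 hdvd))

variable {k : ℕ} {z : A}

/-- `(p - 1) * k` is a natural number representing the weight `-k`; the leftover `T ^ (p * k)` is `τ
^ k`. -/
theorem mono_mul_mono_eq_mono_zero {a : A} (hz : z ∈ D.eigen k) (ha : a ∈ D.eigen ((p - 1) * k)) :
    ∃ hza : z * a * D.tau ^ k ∈ D.eigen 0,
      D.mono k z hz * D.mono ((p - 1) * k) a ha = D.mono 0 (z * a * D.tau ^ k) hza := by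
  have e : k + (p - 1) * k = p * k := by
    obtain ⟨q, hq⟩ : ∃ q, p = q + 1 := ⟨p - 1, (Nat.sub_add_cancel hp.out.one_le).symm⟩
    rw [hq, Nat.add_sub_cancel]
    ring
  have h1 := D.mul_mem_eigen hz ha
  rw [e] at h1
  refine ⟨D.mul_tau_pow_mem_eigen.2 (by rwa [zero_add]), ?_⟩
  rw [mono_mul_mono, D.mono_congr _ h1 e rfl, mono_eq_mono_zero]

/-- For `f = z * b` the cofactor of `z T ^ k` is `b τ⁻ᵏ T ^ ((p - 1) * k)`. -/
theorem mono_zero_mem_span (hz0 : z ≠ 0) (hz : z ∈ D.eigen k) {f : A} (hf : f ∈ D.eigen 0)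
    (hzf : z ∣ f) : D.mono 0 f hf ∈ Ideal.span {D.mono k z hz} := by
  obtain ⟨b, rfl⟩ := hzf
  obtain ⟨t, ht⟩ := (D.isUnit_tau.pow k).exists_right_inv
  have e : k + (p - 1) * k = p * k := by
    obtain ⟨q, hq⟩ : ∃ q, p = q + 1 := ⟨p - 1, (Nat.sub_add_cancel hp.out.one_le).symm⟩
    rw [hq, Nat.add_sub_cancel]
    ring
  have h1 : z * (b * t) ∈ D.eigen (k + (p - 1) * k) := by
    rw [e, ← zero_add (p * k), ← mul_tau_pow_mem_eigen]
    convert hf using 1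
    linear_combination z * b * ht
  have h2 : b * t ∈ D.eigen ((p - 1) * k) := by
    rw [mem_eigen] at h1 hz ⊢
    rw [map_mul, hz, pow_add] at h1
    refine mul_left_cancel₀ (mul_ne_zero (D.isUnit_c.pow k).ne_zero hz0) ?_
    linear_combination h1
  obtain ⟨h3, h4⟩ := mono_mul_mono_eq_mono_zero hz h2
  refine Ideal.mem_span_singleton.2 ⟨D.mono _ _ h2, ?_⟩
  rw [h4]
  refine D.mono_congr _ _ rfl ?_
  linear_combination -z * b * ht

/-- The `p`-th power of a homogeneous element has degree zero, where `hqz` applies. -/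
theorem mono_notMem_of_not_dvd (hzp : Prime z) {q : Ideal D.fixedRing} [hq : q.IsPrime]
    (hqz : ∀ f (hf : f ∈ D.eigen 0), D.mono 0 f hf ∈ q → z ∣ f) {l : ℕ} {a : A}
    (ha : a ∈ D.eigen l) (hza : ¬ z ∣ a) : D.mono l a ha ∉ q := by
  intro h
  have h1 := q.pow_mem_of_mem h p hp.out.pos
  rw [mono_pow, mono_eq_mono_zero] at h1
  exact hza (hzp.dvd_of_dvd_pow ((D.isUnit_tau.pow l).dvd_mul_right.1 (hqz _ _ h1)))

/-- `q` is minimal over `(z T ^ k)`, so `f ∈ q` gives `f ^ N * t ∈ (z T ^ k)` with `t ∉ q`. Some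
homogeneous component of `t` is outside `q`. Its coefficient is not divisible by `z`, since
otherwise its `p`-th power, of degree zero, would lie in `(z T ^ k)`; hence `z` divides `f`. -/
theorem mono_zero_mem_iff [IsDomain D.fixedRing] (hzp : Prime z) (hz : z ∈ D.eigen k)
    {q : Ideal D.fixedRing} [hq : q.IsPrime] (hq1 : q.height ≤ 1) (hzq : D.mono k z hz ∈ q) {f : A}
    (hf : f ∈ D.eigen 0) : D.mono 0 f hf ∈ q ↔ z ∣ f := by
  have hspan : Ideal.span {D.mono k z hz} ≤ q := (Ideal.span_singleton_le_iff_mem _).2 hzq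
  constructor
  · intro hfq
    have hH0 : D.mono k z hz ≠ 0 := fun h0 => by
      have h1 := congrArg Subtype.val h0
      have h2 : D.incl z * D.T ^ k = 0 := h1
      rw [(D.isUnit_T.pow k).mul_left_eq_zero] at h2
      exact hzp.ne_zero (D.incl_injective (by rw [h2, map_zero]))
    obtain ⟨N, t, ht, hft⟩ := exists_pow_mul_mem_of_mem_minimalPrimes
      (mem_minimalPrimes_span_of_height_le_one hq1 hzq hH0) hfq
    obtain ⟨r, hr⟩ := Ideal.mem_span_singleton.1 hft
    obtain ⟨i, hi⟩ : ∃ i, D.mono i (D.coef i (t : D.Cover)) (D.coef_mem_eigen t i) ∉ q := by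
      by_contra! hcon
      refine ht ?_
      rw [← D.sum_mono_coef t]
      exact sum_mem fun i _ => hcon i
    have h1 : z ∣ f ^ N * D.coef i (t : D.Cover) := by
      have h2 := D.coef_mono_mul hz r i
      rw [← hr, mono_pow, Subring.coe_mul, coe_mono, mul_zero, pow_zero, mul_one,
        coef_incl_mul] at h2
      exact h2
    rcases hzp.dvd_or_dvd h1 with h1 | h1
    · exact hzp.dvd_of_dvd_pow h1
    · refine absurd (hq.mem_of_pow_mem p ?_) hi
      rw [mono_pow, mono_eq_mono_zero]
      exact hspan (mono_zero_mem_span hzp.ne_zero hz _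
        (((h1.pow hp.out.ne_zero)).mul_right _))
  · exact fun h => hspan (mono_zero_mem_span hzp.ne_zero hz hf h)

end PrimeElements

end TwistDatum

/-! ### Cotangent classes and multiplication by units -/

section CotangentClass

variable {A : Type*} [CommRing A] [IsLocalRing A]

theorem cotangentClass_mul (a : A) {y : A} (hy : y ∈ maximalIdeal A) (hay : a * y ∈ maximalIdeal A) :
    cotangentClass (a * y) hay = residue A a • cotangentClass y hy := by
  have : (⟨a * y, hay⟩ : maximalIdeal A) = a • ⟨y, hy⟩ := rfl
  rw [cotangentClass, this, map_smul]
  exact (algebraMap_smul (ResidueField A) a _).symm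

theorem cotangentClass_congr {y z : A} (hy : y ∈ maximalIdeal A) (hz : z ∈ maximalIdeal A)
    (h : y = z) : cotangentClass y hy = cotangentClass z hz := by
  subst h
  rfl

theorem indepModSq_mul_unit_iff {ι : Type*} {y : ι → A} (w : ι → Aˣ) :
    IndepModSq (fun i => y i * w i) ↔ IndepModSq y := by
  have key : ∀ (y : ι → A) (w : ι → Aˣ), IndepModSq y → IndepModSq (fun i => y i * w i) := by
    rintro y w ⟨hy, hli⟩
    have hy' : ∀ i, y i * w i ∈ maximalIdeal A := fun i => Ideal.mul_mem_right _ _ (hy i)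
    refine ⟨hy', ?_⟩
    have := hli.units_smul (fun i => (w i).map (residue A : A →* ResidueField A))
    convert this using 1
    funext i
    have h := cotangentClass_mul (w i : A) (hy i) (by rw [mul_comm]; exact hy' i)
    rw [cotangentClass_congr (hy' i) (by rw [mul_comm]; exact hy' i) (mul_comm _ _), h]
    rfl
  refine ⟨fun h => ?_, key y w⟩
  have := key _ (fun i => (w i)⁻¹) h
  simpa [mul_assoc] using this

theorem IsCoordinateSystem.indepModSq_comp {ι κ : Type*} {t : ι → A} (ht : IsCoordinateSystem t)
    (i : κ ↪ ι) : IndepModSq (fun j => t (i j)) := by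
  obtain ⟨hm, hli, -⟩ := ht
  exact ⟨fun j => hm (i j), hli.comp i i.injective⟩

theorem IsCoordinateSystem.mul_unit [IsNoetherianRing A] {n : ℕ} {t : Fin n → A}
    (ht : IsCoordinateSystem t) (w : Fin n → Aˣ) : IsCoordinateSystem (fun i => t i * w i) := by
  refine isCoordinateSystem_of_span_eq ?_ ht.finrank_eq.ge
  rw [← ht.span_eq]
  refine le_antisymm (Ideal.span_le.2 ?_) (Ideal.span_le.2 ?_)
  · rintro _ ⟨i, rfl⟩
    exact Ideal.mul_mem_right _ _ (Ideal.subset_span ⟨i, rfl⟩)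
  · rintro _ ⟨i, rfl⟩
    have : t i = t i * w i * ↑(w i)⁻¹ := by rw [mul_assoc, Units.mul_inv, mul_one]
    rw [SetLike.mem_coe, this]
    exact Ideal.mul_mem_right _ _ (Ideal.subset_span ⟨i, rfl⟩)

/-- The basis of the cotangent space given by a coordinate system. -/
def IsCoordinateSystem.basis {ι : Type*} {t : ι → A} (ht : IsCoordinateSystem t) :
    Module.Basis ι (ResidueField A) (CotangentSpace A) :=
  Module.Basis.mk ht.choose_spec.1 ht.choose_spec.2.ge

theorem IsCoordinateSystem.basis_apply {ι : Type*} {t : ι → A} (ht : IsCoordinateSystem t) (i : ι)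
    (hi : t i ∈ maximalIdeal A) : ht.basis i = cotangentClass (t i) hi :=
  Module.Basis.mk_apply _ _ i

end CotangentClass

/-! ### Increments `σ a - a` in a local ring of residue characteristic `p` -/

section Increments

variable {p : ℕ} [hp : Fact p.Prime] {A : Type*} [CommRing A] [IsLocalRing A] {σ : A →+* A}

theorem exists_sub_pow_mem [CharP (ResidueField A) p] [PerfectField (ResidueField A)] (a : A) :
    ∃ c, a - c ^ p ∈ maximalIdeal A := by
  obtain ⟨c, hc⟩ := surjective_frobenius (ResidueField A) p (residue A a)
  obtain ⟨c, rfl⟩ := residue_surjective c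
  refine ⟨c, ?_⟩
  rw [← residue_eq_zero_iff, map_sub, map_pow, sub_eq_zero]
  exact hc.symm

theorem residue_apply_eq (hσ : ∀ a, σ a - a ∈ maximalIdeal A) (a : A) :
    residue A (σ a) = residue A a := by
  rw [← sub_eq_zero, ← map_sub, residue_eq_zero_iff]
  exact hσ a

theorem residue_iterate_eq (hσ : ∀ a, σ a - a ∈ maximalIdeal A) (l : ℕ) (a : A) :
    residue A (σ^[l] a) = residue A a := by
  induction l with
  | zero => rfl
  | succ l ih => rw [Function.iterate_succ_apply', residue_apply_eq hσ, ih]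

/-- Nakayama for the ideal `J` of all increments: `J ⊆ K + 𝔪 J`. On `𝔪` this is the twisted Leibniz
rule. By perfectness every element is `c ^ p` plus an element of `𝔪`, and the increment of `c ^ p`
is that of `c` times an element with residue `p c^{p-1} = 0`. -/
theorem sub_mem_of_span_eq [CharP (ResidueField A) p] [PerfectField (ResidueField A)]
    [IsNoetherianRing A] (hσ : ∀ a, σ a - a ∈ maximalIdeal A) {ι : Type*} {x : ι → A}
    (hx : Ideal.span (Set.range x) = maximalIdeal A) {K : Ideal A} (hK : ∀ i, σ (x i) - x i ∈ K)
    (a : A) : σ a - a ∈ K := by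
  set J : Ideal A := Ideal.span (Set.range fun a => σ a - a) with hJ
  have hJm : ∀ a, σ a - a ∈ J := fun a => Ideal.subset_span ⟨a, rfl⟩
  suffices h : J ≤ K from h (hJm a)
  refine Submodule.le_of_le_smul_of_le_jacobson_bot (I := maximalIdeal A)
    (IsNoetherian.noetherian J) (jacobson_eq_maximalIdeal ⊥ bot_ne_top).ge ?_
  rw [hJ, Ideal.span_le, ← hJ]
  have hmJ : ∀ b ∈ maximalIdeal A, ∀ j ∈ J, b * j ∈ K ⊔ maximalIdeal A • J := fun b hb j hj =>
    le_sup_right (a := K) (Submodule.smul_mem_smul hb hj)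
  have hm : ∀ b ∈ maximalIdeal A, σ b - b ∈ K ⊔ maximalIdeal A • J := by
    intro b hb
    rw [← hx] at hb
    induction hb using Submodule.span_induction with
    | mem b hb =>
      obtain ⟨i, rfl⟩ := hb
      exact le_sup_left (a := K) (hK i)
    | zero => simp
    | add b c _ _ hb hc =>
      rw [map_add, add_sub_add_comm]
      exact add_mem hb hc
    | smul a b hb ih =>
      rw [show σ (a • b) - a • b = σ (a * b) - a * b from rfl, show σ (a * b) - a * b = σ a * (σ b - b) + b * (σ a - a) by
        rw [map_mul]; ring]
      exact add_mem (Ideal.mul_mem_left _ _ ih) (hmJ b (hx ▸ hb) _ (hJm a))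
  rintro _ ⟨a, rfl⟩
  obtain ⟨c, hc⟩ := exists_sub_pow_mem (p := p) a
  have h1 : σ a - a = (σ (a - c ^ p) - (a - c ^ p)) +
      (∑ i ∈ Finset.range p, σ c ^ i * c ^ (p - 1 - i)) * (σ c - c) := by
    rw [Commute.geom_sum₂_mul (Commute.all _ _), map_sub, map_pow]
    ring
  change σ a - a ∈ K ⊔ maximalIdeal A • J
  rw [h1]
  refine add_mem (hm _ hc) (hmJ _ ?_ _ (hJm c))
  rw [← residue_eq_zero_iff, map_sum]
  have h2 : ∀ i ∈ Finset.range p, residue A (σ c ^ i * c ^ (p - 1 - i)) = residue A c ^ (p - 1) := by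
    intro i hi
    rw [map_mul, map_pow, map_pow, residue_apply_eq hσ, ← pow_add,
      Nat.add_sub_cancel' (Nat.le_sub_one_of_lt (Finset.mem_range.1 hi))]
  rw [Finset.sum_congr rfl h2, Finset.sum_const, Finset.card_range, nsmul_eq_mul, CharP.cast_eq_zero,
    zero_mul]

/-- The norm telescopes: `c` is the coboundary of `s` in the fraction field. -/
theorem prod_iterate_eq_one {R : Type*} [CommRing R] [IsDomain R] {σ : R →+* R}
    (hper : ∀ a, σ^[p] a = a) {s c : R} (hs : s ≠ 0) (h : σ s = s * c) :
    ∏ l ∈ Finset.range p, σ^[l] c = 1 := by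
  have key : ∀ k, σ^[k] s = s * ∏ l ∈ Finset.range k, σ^[l] c := by
    intro k
    induction k with
    | zero => simp
    | succ k ih =>
      rw [Function.iterate_succ_apply, h, ← RingHom.coe_pow, map_mul, RingHom.coe_pow, ih,
        Finset.prod_range_succ, mul_assoc]
  have := key p
  rw [hper] at this
  exact mul_left_cancel₀ hs (by rw [mul_one, ← this])

variable {D : TwistDatum p A} {ε : A}

/-- By induction `coc k - 1 = ε w` with `w ≡ k` modulo `𝔪`, a unit for `0 < k < p`. This needs `σ ε
= ε (1 + δ)` with `δ ∈ 𝔪`: since `1 + δ` has norm one and `σ` is trivial on the residue field, the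
residue of `1 + δ` is a `p`-th root of one, hence one. -/
theorem TwistDatum.isAdmissible [CharP (ResidueField A) p] [IsDomain A] (hc : D.c = 1 + ε)
    (hε : ε ∈ maximalIdeal A) (hε0 : ε ≠ 0) (hdvd : ∀ a, ε ∣ D.σ a - a) : D.IsAdmissible ε := by
  have hσ : ∀ a, D.σ a - a ∈ maximalIdeal A := fun a => Ideal.mem_of_dvd _ (hdvd a) hε
  obtain ⟨δ, hδ⟩ := hdvd ε
  have hδm : residue A δ = 0 := by
    have h1 := prod_iterate_eq_one (σ := D.σ) D.iterate_eq hε0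
      (show D.σ ε = ε * (1 + δ) by linear_combination hδ)
    have h2 := congrArg (residue A) h1
    rw [map_prod, Finset.prod_congr rfl fun l _ => residue_iterate_eq hσ l _, Finset.prod_const,
      Finset.card_range, map_one, map_add, map_one, add_pow_char, one_pow, add_eq_left] at h2
    exact pow_eq_zero_iff hp.out.ne_zero |>.1 h2
  have hε' : residue A ε = 0 := (residue_eq_zero_iff _).2 hε
  have key : ∀ k, ∃ w, D.coc k - 1 = ε * w ∧ residue A w = k := by
    intro k
    induction k with
    | zero => exact ⟨0, by simp⟩
    | succ k ih =>
      obtain ⟨w, hw, hwk⟩ := ih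
      refine ⟨1 + (1 + ε) * (1 + δ) * D.σ w, ?_, ?_⟩
      · have : D.σ (D.coc k) = 1 + D.σ ε * D.σ w := by
          rw [← map_mul, ← hw]
          simp
        rw [D.coc_succ, this, hc]
        linear_combination (1 + ε) * D.σ w * hδ
      · simp [hδm, hε', residue_apply_eq hσ, hwk, add_comm]
  refine ⟨hc, mem_nonZeroDivisors_of_ne_zero hε0, hdvd, fun k hk hkp => ?_⟩
  obtain ⟨w, hw, hwk⟩ := key k
  have hwu : IsUnit w := by
    rw [← residue_ne_zero_iff_isUnit, hwk, Ne, CharP.cast_eq_zero_iff _ p]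
    exact Nat.not_dvd_of_pos_of_lt hk hkp
  exact ⟨hwu.unit, hw⟩

theorem exists_pow_sub_one_eq (hc : D.c = 1 + ε) (hε : ε ∈ maximalIdeal A) (k : ℕ) :
    ∃ w, D.c ^ k - 1 = ε * w ∧ residue A w = k := by
  refine ⟨∑ i ∈ Finset.range k, D.c ^ i, ?_, ?_⟩
  · rw [← geom_sum_mul, hc]
    ring
  · simp [hc, (residue_eq_zero_iff _).2 hε]

/-- The gcd property would turn divisibility of all increments by `ε y` into `ε y ∣ ε`, making `y` a
unit. -/
theorem TwistDatum.IsAdmissible.not_dvd_of_gcd (h : D.IsAdmissible ε) [IsDomain A] {ι : Type*}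
    {x : ι → A} (hgcd : ∀ d, (∀ i, d ∣ D.σ (x i) - x i) → d ∣ ε) {y : A}
    (hy : y ∈ maximalIdeal A) : ¬ ∀ a, ε * y ∣ D.σ a - a := fun hcon => by
  obtain ⟨k, hk⟩ := hgcd (ε * y) fun i => hcon _
  have : y * k = 1 := mul_left_cancel₀ (nonZeroDivisors.ne_zero h.mem_nonZeroDivisors)
    (by linear_combination -hk)
  exact (mem_maximalIdeal _).1 hy (.of_mul_eq_one _ this)

/-- For `a` of weight `k` the divided increment is `w * a` with `w ≡ k` modulo `𝔪`; it lies in `𝔪`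
while `w` is a unit. -/
theorem TwistDatum.IsAdmissible.mem_maximalIdeal_of_mem_eigen [CharP (ResidueField A) p] [IsDomain A]
    (h : D.IsAdmissible ε) (hε : ε ∈ maximalIdeal A)
    (hm : ∀ a, ∃ b ∈ maximalIdeal A, D.σ a - a = ε * b) (k : ℕ) (hk : 0 < k) (hkp : k < p) (a : A)
    (ha : a ∈ D.eigen k) : a ∈ maximalIdeal A := by
  obtain ⟨b, hb, hab⟩ := hm a
  obtain ⟨w, hw, hwk⟩ := exists_pow_sub_one_eq h.c_eq hε k
  have h1 : w * a = b := by
    refine mul_left_cancel₀ (nonZeroDivisors.ne_zero h.mem_nonZeroDivisors) ?_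
    rw [← hab, D.mem_eigen.1 ha]
    linear_combination -a * hw
  rw [← residue_eq_zero_iff] at hb ⊢
  rw [← h1, map_mul, hwk] at hb
  refine (mul_eq_zero.1 hb).resolve_left ?_
  rw [CharP.cast_eq_zero_iff _ p]
  exact Nat.not_dvd_of_pos_of_lt hk hkp

/-- `φ` is the linear map `y ↦ (σ y - y) / ε` of the cotangent space. -/
def IsDivided (σ : A →+* A) (ε : A) (φ : Module.End (ResidueField A) (CotangentSpace A)) : Prop :=
  ∀ (y : A) (hy : y ∈ maximalIdeal A), ∃ (a : A) (ha : a ∈ maximalIdeal A),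
    σ y - y = ε * a ∧ φ (cotangentClass y hy) = cotangentClass a ha

/-- The divided increment `d` satisfies `d (a b) = a d b + (σ a - a) d b + b d a`. The last two
terms are in `𝔪²` when `b ∈ 𝔪`, which gives linearity, and all of it is when `a, b ∈ 𝔪`, which makes
`d` vanish on `𝔪²` modulo `𝔪²`. -/
theorem exists_isDivided [IsDomain A] (hε : ε ∈ maximalIdeal A) (hε0 : ε ≠ 0)
    (hm : ∀ a, ∃ b ∈ maximalIdeal A, σ a - a = ε * b) : ∃ φ, IsDivided σ ε φ := by
  choose d hdm hd using hm
  have hσ : ∀ a, σ a - a ∈ maximalIdeal A := fun a => hd a ▸ Ideal.mul_mem_right _ _ hε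
  have hdadd : ∀ a b, d (a + b) = d a + d b := fun a b => mul_left_cancel₀ hε0 (by
    rw [← hd, mul_add, ← hd, ← hd, map_add]
    ring)
  have hdmul : ∀ a b, d (a * b) = a * d b + ((σ a - a) * d b + b * d a) := fun a b =>
    mul_left_cancel₀ hε0 (by
      rw [← hd, map_mul]
      linear_combination σ a * hd b + b * hd a)
  let f : maximalIdeal A →ₗ[A] CotangentSpace A :=
    { toFun := fun y => cotangentClass (d y) (hdm y)
      map_add' := fun y z => by
        refine (cotangentClass_congr (hdm _) (add_mem (hdm y) (hdm z)) (hdadd y z)).trans ?_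
        exact map_add (maximalIdeal A).toCotangent ⟨_, hdm y⟩ ⟨_, hdm z⟩
      map_smul' := fun a y => by
        rw [RingHom.id_apply]
        refine ((maximalIdeal A).toCotangent_eq (x := ⟨_, hdm _⟩) (y := a • ⟨_, hdm y⟩)).2 ?_
        change d (a * y) - a * d y ∈ maximalIdeal A ^ 2
        rw [hdmul, add_sub_cancel_left, pow_two]
        exact add_mem (Ideal.mul_mem_mul (hσ a) (hdm _)) (Ideal.mul_mem_mul y.2 (hdm _)) }
  have hf : ∀ y z : maximalIdeal A, f (y * z) = 0 := fun y z => by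
    have : y * z = (y : A) • z := rfl
    rw [this, map_smul]
    exact Ideal.Cotangent.smul_eq_zero_of_mem y.2 _
  refine ⟨LinearMap.extendScalarsOfSurjective residue_surjective (Ideal.Cotangent.lift f hf),
    fun y hy => ⟨d y, hdm y, hd y, ?_⟩⟩
  exact Ideal.Cotangent.lift_toCotangent f hf ⟨y, hy⟩

theorem IsDivided.apply_eq [IsDomain A] (hε0 : ε ≠ 0)
    {φ : Module.End (ResidueField A) (CotangentSpace A)} (hφ : IsDivided σ ε φ) {y a : A}
    (hy : y ∈ maximalIdeal A) (ha : a ∈ maximalIdeal A) (h : σ y - y = ε * a) :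
    φ (cotangentClass y hy) = cotangentClass a ha := by
  obtain ⟨b, hb, hab, hφ⟩ := hφ y hy
  rw [hφ, cotangentClass_congr hb ha (mul_left_cancel₀ hε0 (hab.symm.trans h))]

theorem IsDivided.apply_of_mem_eigen [IsDomain A] (hε : ε ∈ maximalIdeal A) (hε0 : ε ≠ 0)
    (hc : D.c = 1 + ε) {φ : Module.End (ResidueField A) (CotangentSpace A)}
    (hφ : IsDivided D.σ ε φ) {y : A} (hy : y ∈ maximalIdeal A) {k : ℕ} (hk : y ∈ D.eigen k) :
    φ (cotangentClass y hy) = (k : ResidueField A) • cotangentClass y hy := by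
  obtain ⟨w, hw, hwk⟩ := exists_pow_sub_one_eq hc hε k
  have hwy : w * y ∈ maximalIdeal A := Ideal.mul_mem_left _ _ hy
  rw [hφ.apply_eq hε0 hy hwy, cotangentClass_mul w hy hwy, hwk]
  rw [D.mem_eigen.1 hk]
  linear_combination y * hw

theorem IsDivided.apply_of_mul_mem_eigen [IsDomain A] (hε : ε ∈ maximalIdeal A) (hε0 : ε ≠ 0)
    (hc : D.c = 1 + ε) {φ : Module.End (ResidueField A) (CotangentSpace A)}
    (hφ : IsDivided D.σ ε φ) {y : A} (hy : y ∈ maximalIdeal A) {k : ℕ} (w : Aˣ)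
    (hk : y * w ∈ D.eigen k) :
    φ (cotangentClass y hy) = (k : ResidueField A) • cotangentClass y hy := by
  have hwy : (w : A) * y ∈ maximalIdeal A := Ideal.mul_mem_left _ _ hy
  have h1 := hφ.apply_of_mem_eigen hε hε0 hc hwy (by rwa [mul_comm])
  rw [cotangentClass_mul _ hy hwy, map_smul, smul_comm] at h1
  have h2 : residue A (w : A) ≠ 0 := (residue_ne_zero_iff_isUnit _).2 w.isUnit
  exact smul_right_injective _ h2 h1

end Increments

/-- A ring homomorphism to a local ring that is the localization at the preimage of the maximal
ideal. -/
structure IsLocalizationHom {R O : Type*} [CommRing R] [CommRing O] (f : R →+* O) : Prop where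
  surj : ∀ s, ∃ a b, IsUnit (f b) ∧ s * f b = f a
  exists_of_map_eq_zero : ∀ a, f a = 0 → ∃ t, IsUnit (f t) ∧ t * a = 0

/-! ### Homomorphisms that are localizations at a prime -/

namespace IsLocalizationHom

variable {R O O' : Type*} [CommRing R] [CommRing O] [CommRing O']

theorem of_isLocalization [Algebra R O] (q : Ideal R) [q.IsPrime] [IsLocalization.AtPrime O q] :
    IsLocalizationHom (algebraMap R O) where
  surj s := by
    obtain ⟨⟨a, b⟩, h⟩ := IsLocalization.surj q.primeCompl s
    exact ⟨a, b, IsLocalization.map_units O b, h⟩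
  exists_of_map_eq_zero a ha := by
    obtain ⟨t, ht⟩ := (IsLocalization.map_eq_zero_iff q.primeCompl O a).1 ha
    exact ⟨t, IsLocalization.map_units O t, ht⟩

theorem of_comp {f : R →+* O} (hf : IsLocalizationHom f) {l : O →+* O'}
    (hl : IsLocalizationHom (l.comp f)) : IsLocalizationHom l where
  surj s := by
    obtain ⟨a, b, hb, h⟩ := hl.surj s
    exact ⟨f a, f b, hb, h⟩
  exists_of_map_eq_zero s hs := by
    obtain ⟨a, b, hb, h⟩ := hf.surj s
    obtain ⟨t, ht, hta⟩ := hl.exists_of_map_eq_zero a (by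
      rw [RingHom.comp_apply, ← h, map_mul, hs, zero_mul])
    refine ⟨f t, ht, hb.mul_left_injective ?_⟩
    dsimp only
    rw [mul_assoc, h, ← map_mul, hta, map_zero, zero_mul]

variable [IsLocalRing O] {f : R →+* O} (hf : IsLocalizationHom f)

theorem isLocalization (hf : IsLocalizationHom f) :
    @IsLocalization.AtPrime R _ O _ f.toAlgebra ((maximalIdeal O).comap f) inferInstance := by
  let := f.toAlgebra
  refine ⟨?_, ?_, ?_⟩
  · rintro ⟨y, hy⟩
    exact notMem_maximalIdeal.1 hy
  · intro s
    obtain ⟨a, b, hb, h⟩ := hf.surj s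
    exact ⟨⟨a, b, notMem_maximalIdeal.2 hb⟩, h⟩
  · intro a b hab
    obtain ⟨t, ht, h⟩ := hf.exists_of_map_eq_zero (a - b) (by
      rw [map_sub, sub_eq_zero]
      exact hab)
    refine ⟨⟨t, notMem_maximalIdeal.2 ht⟩, ?_⟩
    rw [mul_sub, sub_eq_zero] at h
    exact h

theorem map_comap (hf : IsLocalizationHom f) (J : Ideal O) : (J.comap f).map f = J := by
  refine le_antisymm Ideal.map_comap_le fun s hs => ?_
  obtain ⟨a, b, hb, h⟩ := hf.surj s
  have ha : a ∈ J.comap f := by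
    rw [Ideal.mem_comap, ← h]
    exact J.mul_mem_right _ hs
  obtain ⟨c, hc⟩ := hb.exists_right_inv
  have : s = c * f a := by rw [← h, mul_left_comm, mul_comm c, hc, mul_one]
  rw [this]
  exact Ideal.mul_mem_left _ _ (Ideal.mem_map_of_mem f ha)

theorem height_comap (hf : IsLocalizationHom f) (J : Ideal O) [J.IsPrime] :
    (J.comap f).height = J.height := by
  let := f.toAlgebra
  have := hf.isLocalization
  exact IsLocalization.height_under ((maximalIdeal O).comap f).primeCompl J

theorem comap_injective (hf : IsLocalizationHom f) {J J' : Ideal O} (h : J.comap f = J'.comap f) :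
    J = J' := by
  rw [← hf.map_comap J, h, hf.map_comap]

end IsLocalizationHom

/-! ### Points of schemes as prime ideals -/

section Points

variable {X : Scheme.{u}}

theorem exists_isAffineOpen_mem (x : X) : ∃ V : X.Opens, IsAffineOpen V ∧ x ∈ V := by
  obtain ⟨_, ⟨V, hV, rfl⟩, hx, -⟩ :=
    X.isBasis_affineOpens.exists_subset_of_mem_open (Set.mem_univ x) isOpen_univ
  exact ⟨V, hV, hx⟩

theorem isLocalizationHom_germ {V : X.Opens} (hV : IsAffineOpen V) (x : X) (hx : x ∈ V) :
    IsLocalizationHom (X.presheaf.germ V x hx).hom := by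
  let := X.presheaf.algebra_section_stalk ⟨x, hx⟩
  have := hV.isLocalization_stalk ⟨x, hx⟩
  exact .of_isLocalization (hV.primeIdealOf ⟨x, hx⟩).asIdeal

/-- The prime ideal of a point. -/
def pointIdeal (V : X.Opens) (x : X) (hx : x ∈ V) : Ideal Γ(X, V) :=
  (maximalIdeal (X.presheaf.stalk x)).comap (X.presheaf.germ V x hx).hom

instance (V : X.Opens) (x : X) (hx : x ∈ V) : (pointIdeal V x hx).IsPrime :=
  inferInstanceAs (Ideal.comap _ _).IsPrime

theorem primeIdealOf_asIdeal {V : X.Opens} (hV : IsAffineOpen V) (x : X) (hx : x ∈ V) :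
    (hV.primeIdealOf ⟨x, hx⟩).asIdeal = pointIdeal V x hx := by
  rw [hV.primeIdealOf_eq_map_closedPoint]
  rfl

theorem eq_of_pointIdeal_eq {V : X.Opens} (hV : IsAffineOpen V) {x y : X} (hx : x ∈ V)
    (hy : y ∈ V) (h : pointIdeal V x hx = pointIdeal V y hy) : x = y := by
  rw [← primeIdealOf_asIdeal hV, ← primeIdealOf_asIdeal hV] at h
  have h1 := hV.fromSpec_primeIdealOf ⟨x, hx⟩
  rw [PrimeSpectrum.ext h, hV.fromSpec_primeIdealOf] at h1
  exact h1.symm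

theorem height_pointIdeal {V : X.Opens} (hV : IsAffineOpen V) (x : X) (hx : x ∈ V) :
    (pointIdeal V x hx).height = Order.coheight x := by
  rw [pointIdeal, (isLocalizationHom_germ hV x hx).height_comap]
  have := maximalIdeal_height_eq_ringKrullDim (R := X.presheaf.stalk x)
  rw [ringKrullDim_stalk_eq_coheight] at this
  exact_mod_cast this

theorem germ_stalkSpecializes_apply {V : X.Opens} {x y : X} (h : x ⤳ y) (hy : y ∈ V) (f : Γ(X, V)) :
    (X.presheaf.stalkSpecializes h).hom ((X.presheaf.germ V y hy).hom f) =
      (X.presheaf.germ V x (h.mem_open V.isOpen hy)).hom f := by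
  have := X.presheaf.germ_stalkSpecializes hy h
  exact DFunLike.congr_fun (CommRingCat.hom_ext_iff.mp this) f

theorem isLocalizationHom_stalkSpecializes {x y : X} (h : x ⤳ y) :
    IsLocalizationHom (X.presheaf.stalkSpecializes h).hom := by
  obtain ⟨V, hV, hy⟩ := exists_isAffineOpen_mem y
  refine .of_comp (isLocalizationHom_germ hV y hy) ?_
  convert isLocalizationHom_germ hV x (h.mem_open V.isOpen hy)
  ext f
  exact germ_stalkSpecializes_apply h hy f

/-- The prime ideal of a generization. -/
def genIdeal {x y : X} (h : x ⤳ y) : Ideal (X.presheaf.stalk y) :=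
  (maximalIdeal (X.presheaf.stalk x)).comap (X.presheaf.stalkSpecializes h).hom

instance {x y : X} (h : x ⤳ y) : (genIdeal h).IsPrime :=
  inferInstanceAs (Ideal.comap _ _).IsPrime

theorem height_genIdeal {x y : X} (h : x ⤳ y) : (genIdeal h).height = Order.coheight x := by
  rw [genIdeal, (isLocalizationHom_stalkSpecializes h).height_comap]
  have := maximalIdeal_height_eq_ringKrullDim (R := X.presheaf.stalk x)
  rw [ringKrullDim_stalk_eq_coheight] at this
  exact_mod_cast this

theorem comap_germ_genIdeal {V : X.Opens} {x y : X} (h : x ⤳ y) (hy : y ∈ V) :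
    (genIdeal h).comap (X.presheaf.germ V y hy).hom =
      pointIdeal V x (h.mem_open V.isOpen hy) := by
  ext f
  change (X.presheaf.stalkSpecializes h).hom ((X.presheaf.germ V y hy).hom f) ∈
    maximalIdeal (X.presheaf.stalk x) ↔ (X.presheaf.germ V x _).hom f ∈ maximalIdeal _
  rw [germ_stalkSpecializes_apply]

theorem exists_genIdeal_eq {y : X} (J : Ideal (X.presheaf.stalk y)) [hJ : J.IsPrime] :
    ∃ (x : X) (h : x ⤳ y), genIdeal h = J := by
  obtain ⟨V, hV, hy⟩ := exists_isAffineOpen_mem y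
  set q : PrimeSpectrum Γ(X, V) := ⟨J.comap (X.presheaf.germ V y hy).hom, inferInstance⟩ with hq
  have hle : q ≤ hV.primeIdealOf ⟨y, hy⟩ := by
    change q.asIdeal ≤ (hV.primeIdealOf ⟨y, hy⟩).asIdeal
    rw [primeIdealOf_asIdeal]
    exact Ideal.comap_mono (le_maximalIdeal hJ.ne_top)
  have hs := ((PrimeSpectrum.le_iff_specializes _ _).1 hle).map hV.fromSpec.continuous
  rw [hV.fromSpec_primeIdealOf] at hs
  refine ⟨_, hs, (isLocalizationHom_germ hV y hy).comap_injective ?_⟩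
  rw [comap_germ_genIdeal hs hy, ← primeIdealOf_asIdeal hV]
  change _ = q.asIdeal
  congr 1
  exact hV.fromSpec.isOpenEmbedding.injective (hV.fromSpec_primeIdealOf _)

section Morphisms

variable {Y : Scheme.{u}} (f : Y ⟶ X)

theorem germ_stalkMap_apply {V : X.Opens} {y : Y} (hy : f y ∈ V) (b : Γ(X, V)) :
    (f.stalkMap y).hom ((X.presheaf.germ V (f y) hy).hom b) =
      (Y.presheaf.germ (f ⁻¹ᵁ V) y hy).hom ((f.app V).hom b) :=
  Scheme.Hom.germ_stalkMap_apply f V y hy b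

theorem comap_app_pointIdeal {V : X.Opens} {y : Y} (hy : f y ∈ V) :
    (pointIdeal (f ⁻¹ᵁ V) y hy).comap (f.app V).hom = pointIdeal V (f y) hy := by
  ext b
  change (Y.presheaf.germ (f ⁻¹ᵁ V) y hy).hom ((f.app V).hom b) ∈
    maximalIdeal (Y.presheaf.stalk y) ↔ (X.presheaf.germ V (f y) hy).hom b ∈ maximalIdeal _
  rw [← germ_stalkMap_apply, mem_maximalIdeal, mem_maximalIdeal, mem_nonunits_iff, mem_nonunits_iff,
    isUnit_map_iff]

theorem map_stalkMap_maximalIdeal {V : X.Opens} (hV : IsAffineOpen V) {y : Y} (hy : f y ∈ V) :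
    (maximalIdeal (X.presheaf.stalk (f y))).map (f.stalkMap y).hom =
      (pointIdeal V (f y) hy).map
        ((Y.presheaf.germ (f ⁻¹ᵁ V) y hy).hom.comp (f.app V).hom) := by
  rw [← (isLocalizationHom_germ hV (f y) hy).map_comap (maximalIdeal _), Ideal.map_map]
  congr 1
  ext b
  exact germ_stalkMap_apply f hy b

end Morphisms

theorem isLocalEquation_iff {x : X} {E : PrimeDivisor X} {y : X.presheaf.stalk x} :
    IsLocalEquation x E y ↔ ∃ h : E.1 ⤳ x, genIdeal h = Ideal.span {y} := Iff.rfl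

end Points

theorem map_prod_iterate_eq {R : Type*} [CommRing R] {σ : R →+* R} {p : ℕ} (hp : p ≠ 0)
    (hper : ∀ a, σ^[p] a = a) (t : R) :
    σ (∏ l ∈ Finset.range p, σ^[l] t) = ∏ l ∈ Finset.range p, σ^[l] t := by
  obtain ⟨q, rfl⟩ := Nat.exists_eq_succ_of_ne_zero hp
  simp only [map_prod, ← Function.iterate_succ_apply' (f := σ)]
  rw [Finset.prod_range_succ, Finset.prod_range_succ' _ q, hper, Function.iterate_zero, id_eq]

/-! ### The action on sections over the quotient -/

section Action

variable {U X : Scheme.{u}} (σ : U ≅ U) {π : U ⟶ X} (hπ : IsQuotientBy σ π) {p : ℕ}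

theorem le_preimage_hom (hπ : IsQuotientBy σ π) (V : X.Opens) :
    π ⁻¹ᵁ V ≤ σ.hom ⁻¹ᵁ (π ⁻¹ᵁ V) := by
  rw [← Scheme.Hom.comp_preimage, hπ.invariant]

theorem le_preimage_inv (hπ : IsQuotientBy σ π) (V : X.Opens) :
    π ⁻¹ᵁ V ≤ σ.inv ⁻¹ᵁ (π ⁻¹ᵁ V) := by
  have : σ.inv ≫ π = π := by rw [Iso.inv_comp_eq, hπ.invariant]
  rw [← Scheme.Hom.comp_preimage, this]

/-- The action of `σ` on the functions on the preimage of an open subset of the quotient. -/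
def sectionAction (V : X.Opens) : Γ(U, π ⁻¹ᵁ V) →+* Γ(U, π ⁻¹ᵁ V) :=
  (σ.inv.appLE (π ⁻¹ᵁ V) (π ⁻¹ᵁ V) (le_preimage_inv σ hπ V)).hom

/-- The pullback by `σ` of functions on the preimage of an open subset of the quotient. -/
def sectionPullback (V : X.Opens) : Γ(U, π ⁻¹ᵁ V) →+* Γ(U, π ⁻¹ᵁ V) :=
  (σ.hom.appLE (π ⁻¹ᵁ V) (π ⁻¹ᵁ V) (le_preimage_hom σ hπ V)).hom

theorem appLE_eq_id_of_eq {Y : Scheme.{u}} (g : Y ⟶ Y) (hg : g = 𝟙 Y) (W : Y.Opens) (h : W ≤ g ⁻¹ᵁ W)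
    (f : Γ(Y, W)) : (g.appLE W W h).hom f = f := by
  subst hg
  have : Scheme.Hom.appLE (𝟙 Y) W W h = 𝟙 _ := by
    rw [← Scheme.Hom.id_app W]
    exact Scheme.Hom.appLE_eq_app (𝟙 Y)
  rw [this]
  rfl

theorem sectionPullback_sectionAction (V : X.Opens) (f : Γ(U, π ⁻¹ᵁ V)) :
    sectionPullback σ hπ V (sectionAction σ hπ V f) = f := by
  have h := Scheme.Hom.appLE_comp_appLE σ.hom σ.inv (π ⁻¹ᵁ V) (π ⁻¹ᵁ V) (π ⁻¹ᵁ V)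
    (le_preimage_inv σ hπ V) (le_preimage_hom σ hπ V)
  refine (DFunLike.congr_fun (CommRingCat.hom_ext_iff.mp h) f).trans ?_
  exact appLE_eq_id_of_eq _ (Iso.hom_inv_id σ) _ _ f

theorem sectionAction_sectionPullback (V : X.Opens) (f : Γ(U, π ⁻¹ᵁ V)) :
    sectionAction σ hπ V (sectionPullback σ hπ V f) = f := by
  have h := Scheme.Hom.appLE_comp_appLE σ.inv σ.hom (π ⁻¹ᵁ V) (π ⁻¹ᵁ V) (π ⁻¹ᵁ V)
    (le_preimage_hom σ hπ V) (le_preimage_inv σ hπ V)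
  refine (DFunLike.congr_fun (CommRingCat.hom_ext_iff.mp h) f).trans ?_
  exact appLE_eq_id_of_eq _ (Iso.inv_hom_id σ) _ _ f

theorem sectionPullback_iterate (V : X.Opens) (k : ℕ) :
    ∃ h : π ⁻¹ᵁ V ≤ ((fun f : U ⟶ U => f ≫ σ.hom)^[k] (𝟙 U)) ⁻¹ᵁ (π ⁻¹ᵁ V), ∀ f,
      (((fun f : U ⟶ U => f ≫ σ.hom)^[k] (𝟙 U)).appLE _ _ h).hom f =
        (sectionPullback σ hπ V)^[k] f := by
  induction k with
  | zero => exact ⟨le_rfl, appLE_eq_id_of_eq _ rfl _ _⟩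
  | succ k ih =>
    obtain ⟨h, ih⟩ := ih
    rw [Function.iterate_succ_apply']
    have hc := Scheme.Hom.appLE_comp_appLE ((fun f : U ⟶ U => f ≫ σ.hom)^[k] (𝟙 U)) σ.hom
      (π ⁻¹ᵁ V) (π ⁻¹ᵁ V) (π ⁻¹ᵁ V) (le_preimage_hom σ hπ V) h
    refine ⟨_, fun f => (DFunLike.congr_fun (CommRingCat.hom_ext_iff.mp hc) f).symm.trans ?_⟩
    rw [Function.iterate_succ_apply, ← ih]
    rfl

theorem sectionAction_iterate (hσ : (fun f : U ⟶ U => f ≫ σ.hom)^[p] (𝟙 U) = 𝟙 U) (V : X.Opens)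
    (f : Γ(U, π ⁻¹ᵁ V)) : (sectionAction σ hπ V)^[p] f = f := by
  obtain ⟨h, hk⟩ := sectionPullback_iterate σ hπ V p
  have h1 : (sectionPullback σ hπ V)^[p] f = f := by
    rw [← hk]
    exact appLE_eq_id_of_eq _ hσ _ _ f
  have h2 : Function.LeftInverse (sectionAction σ hπ V) (sectionPullback σ hπ V) :=
    sectionAction_sectionPullback σ hπ V
  conv_lhs => rw [← h1]
  exact h2.iterate p f

/-- Pullback by `σ` and by `σ⁻¹` have the same fixed functions; the quotient is defined by the
former, the action by the latter. -/
theorem mem_range_app_iff (V : X.Opens) (f : Γ(U, π ⁻¹ᵁ V)) :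
    f ∈ Set.range (π.app V).hom ↔ sectionAction σ hπ V f = f := by
  rw [hπ.mem_range_iff]
  constructor
  · rintro ⟨h, hf⟩
    conv_lhs => rw [← hf]
    exact sectionAction_sectionPullback σ hπ V f
  · intro h
    refine ⟨le_preimage_hom σ hπ V, ?_⟩
    conv_lhs => rw [← h]
    exact sectionPullback_sectionAction σ hπ V f

theorem sectionAction_map {V V' : X.Opens} (i : π ⁻¹ᵁ V' ⟶ π ⁻¹ᵁ V) (f : Γ(U, π ⁻¹ᵁ V)) :
    sectionAction σ hπ V' ((U.presheaf.map i.op).hom f) =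
      (U.presheaf.map i.op).hom (sectionAction σ hπ V f) := by
  have h : U.presheaf.map i.op ≫ σ.inv.appLE (π ⁻¹ᵁ V') (π ⁻¹ᵁ V') (le_preimage_inv σ hπ V') =
      σ.inv.appLE (π ⁻¹ᵁ V) (π ⁻¹ᵁ V) (le_preimage_inv σ hπ V) ≫ U.presheaf.map i.op := by
    rw [Scheme.Hom.map_appLE, Scheme.Hom.appLE_map]
  exact DFunLike.congr_fun (CommRingCat.hom_ext_iff.mp h) f

theorem sectionAction_iterate_map {V V' : X.Opens} (i : π ⁻¹ᵁ V' ⟶ π ⁻¹ᵁ V) (f : Γ(U, π ⁻¹ᵁ V))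
    (k : ℕ) : (sectionAction σ hπ V')^[k] ((U.presheaf.map i.op).hom f) =
      (U.presheaf.map i.op).hom ((sectionAction σ hπ V)^[k] f) := by
  induction k with
  | zero => rfl
  | succ k ih => rw [Function.iterate_succ_apply', ih, sectionAction_map,
      Function.iterate_succ_apply']

end Action

/-! ### Invariant affine neighborhoods of a fixed point -/

section FixedPoint

variable {U X : Scheme.{u}} (σ : U ≅ U) {π : U ⟶ X} (hπ : IsQuotientBy σ π) {p : ℕ}
  {P : U} (hP : σ.hom P = P)

theorem stalkAction_germ (V : X.Opens) (hV : P ∈ π ⁻¹ᵁ V) (f : Γ(U, π ⁻¹ᵁ V)) :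
    stalkAction σ P hP ((U.presheaf.germ (π ⁻¹ᵁ V) P hV).hom f) =
      (U.presheaf.germ (π ⁻¹ᵁ V) P hV).hom (sectionAction σ hπ V f) := by
  have hsp : σ.inv P ⤳ P := specializes_of_eq (inv_apply_eq σ hP)
  change (σ.inv.stalkMap P).hom ((U.presheaf.stalkSpecializes hsp).hom
    ((U.presheaf.germ (π ⁻¹ᵁ V) P hV).hom f)) = _
  rw [germ_stalkSpecializes_apply, germ_stalkMap_apply]
  exact (U.presheaf.germ_res_apply (homOfLE (le_preimage_inv σ hπ V)) P hV
    ((σ.inv.app (π ⁻¹ᵁ V)).hom f)).symm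

theorem stalkAction_iterate_germ (V : X.Opens) (hV : P ∈ π ⁻¹ᵁ V) (f : Γ(U, π ⁻¹ᵁ V)) (k : ℕ) :
    (stalkAction σ P hP)^[k] ((U.presheaf.germ (π ⁻¹ᵁ V) P hV).hom f) =
      (U.presheaf.germ (π ⁻¹ᵁ V) P hV).hom ((sectionAction σ hπ V)^[k] f) := by
  induction k with
  | zero => rfl
  | succ k ih => rw [Function.iterate_succ_apply', ih, stalkAction_germ,
      Function.iterate_succ_apply']

theorem isAffineOpen_preimage (hπ : IsQuotientBy σ π) {V : X.Opens} (hV : IsAffineOpen V) :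
    IsAffineOpen (π ⁻¹ᵁ V) :=
  have := hπ.isAffineHom
  hV.preimage π

theorem stalkAction_iterate (hπ : IsQuotientBy σ π)
    (hσ : (fun f : U ⟶ U => f ≫ σ.hom)^[p] (𝟙 U) = 𝟙 U) (a : U.presheaf.stalk P) :
    (stalkAction σ P hP)^[p] a = a := by
  obtain ⟨V, hV, hPV⟩ := exists_isAffineOpen_mem (π P)
  replace hPV : P ∈ π ⁻¹ᵁ V := hPV
  have hg := isLocalizationHom_germ (isAffineOpen_preimage σ hπ hV) P hPV
  have key : ∀ f, (stalkAction σ P hP)^[p] ((U.presheaf.germ (π ⁻¹ᵁ V) P hPV).hom f) =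
      (U.presheaf.germ (π ⁻¹ᵁ V) P hPV).hom f := fun f => by
    rw [stalkAction_iterate_germ σ hπ, sectionAction_iterate σ hπ hσ]
  obtain ⟨f, t, ht, h⟩ := hg.surj a
  refine ht.mul_left_injective ?_
  dsimp only
  rw [← key t, ← RingHom.coe_pow, ← map_mul, h, RingHom.coe_pow, key f, ← h, key]

/-- The preimages of affine open subsets form a neighborhood basis at a fixed point. -/
theorem exists_preimage_le (hπ : IsQuotientBy σ π) (hp : p ≠ 0)
    (hσ : (fun f : U ⟶ U => f ≫ σ.hom)^[p] (𝟙 U) = 𝟙 U) (hP : σ.hom P = P) (W : U.Opens)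
    (hW : P ∈ W) : ∃ V : X.Opens, IsAffineOpen V ∧ P ∈ π ⁻¹ᵁ V ∧ π ⁻¹ᵁ V ≤ W := by
  obtain ⟨V, hV, hPV⟩ := exists_isAffineOpen_mem (π P)
  replace hPV : P ∈ π ⁻¹ᵁ V := hPV
  obtain ⟨t, htW, ht⟩ := (isAffineOpen_preimage σ hπ hV).exists_basicOpen_le ⟨P, hW⟩ hPV
  -- The norm of `t` is invariant, so its basic open set is a preimage from `X`; it still contains
  -- `P`, which is fixed.
  set N := ∏ l ∈ Finset.range p, (sectionAction σ hπ V)^[l] t with hN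
  obtain ⟨b, hb⟩ := (mem_range_app_iff σ hπ V N).2
    (map_prod_iterate_eq hp (sectionAction_iterate σ hπ hσ V) t)
  have hPN : P ∈ U.basicOpen N := by
    replace ht : P ∈ U.basicOpen t := ht
    rw [Scheme.mem_basicOpen _ _ _ hPV] at ht ⊢
    rw [hN, map_prod, IsUnit.prod_iff]
    intro l _
    have := ht.map ((stalkAction σ P hP) ^ l)
    rw [RingHom.coe_pow] at this
    exact (stalkAction_iterate_germ σ hπ hP V hPV t l) ▸ this
  have hNb : U.basicOpen N = π ⁻¹ᵁ (X.basicOpen b) := by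
    rw [← hb]
    exact (Scheme.preimage_basicOpen π b).symm
  refine ⟨X.basicOpen b, hV.basicOpen b, ?_, ?_⟩
  · rw [hNb] at hPN
    exact hPN
  · rw [← hNb]
    refine le_trans ?_ htW
    obtain ⟨d, hd⟩ : t ∣ N := by
      rw [hN]
      exact Finset.dvd_prod_of_mem (fun l => (sectionAction σ hπ V)^[l] t)
        (Finset.mem_range.2 (Nat.pos_of_ne_zero hp))
    rw [hd, Scheme.basicOpen_mul]
    exact inf_le_left

/-- An element of the local ring at a fixed point that has norm one extends to a function of norm
one on an invariant affine neighborhood. -/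
theorem exists_section_norm_eq_one (hp : p ≠ 0)
    (hσ : (fun f : U ⟶ U => f ≫ σ.hom)^[p] (𝟙 U) = 𝟙 U) {c : U.presheaf.stalk P}
    (hc : ∏ l ∈ Finset.range p, (stalkAction σ P hP)^[l] c = 1) :
    ∃ V : X.Opens, IsAffineOpen V ∧ ∃ (hPV : P ∈ π ⁻¹ᵁ V) (C : Γ(U, π ⁻¹ᵁ V)),
      (U.presheaf.germ (π ⁻¹ᵁ V) P hPV).hom C = c ∧
        ∏ l ∈ Finset.range p, (sectionAction σ hπ V)^[l] C = 1 := by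
  obtain ⟨W, hPW, C₀, rfl⟩ := U.presheaf.exists_germ_eq c
  obtain ⟨V, -, hPV, hVW⟩ := exists_preimage_le σ hπ hp hσ hP W hPW
  set C₁ : Γ(U, π ⁻¹ᵁ V) := (U.presheaf.map (homOfLE hVW).op).hom C₀
  have hC₁ : (U.presheaf.germ (π ⁻¹ᵁ V) P hPV).hom C₁ = (U.presheaf.germ W P hPW).hom C₀ :=
    U.presheaf.germ_res_apply (homOfLE hVW) P hPV C₀
  -- The norm of `C₁` has germ one at `P`, hence equals one on a smaller neighborhood.
  obtain ⟨W', hPW', i, j, hij⟩ := U.presheaf.germ_eq P hPV hPV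
    (∏ l ∈ Finset.range p, (sectionAction σ hπ V)^[l] C₁) 1 (by
      change (U.presheaf.germ (π ⁻¹ᵁ V) P hPV).hom _ = (U.presheaf.germ (π ⁻¹ᵁ V) P hPV).hom _
      rw [map_prod, map_one, ← hc]
      refine Finset.prod_congr rfl fun l _ => ?_
      rw [← stalkAction_iterate_germ σ hπ hP, hC₁])
  obtain ⟨V', hV', hPV', hVW'⟩ := exists_preimage_le σ hπ hp hσ hP W' hPW'
  refine ⟨V', hV', hPV', (U.presheaf.map (homOfLE hVW' ≫ i).op).hom C₁, ?_, ?_⟩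
  · rw [← hC₁]
    exact U.presheaf.germ_res_apply (homOfLE hVW' ≫ i) P hPV' C₁
  · simp only [sectionAction_iterate_map σ hπ]
    rw [← map_prod, op_comp, Functor.map_comp]
    have h2 := congrArg (U.presheaf.map (homOfLE hVW').op).hom hij
    refine h2.trans ?_
    change (U.presheaf.map (homOfLE hVW').op).hom ((U.presheaf.map j.op).hom 1) = 1
    rw [map_one, map_one]

end FixedPoint

/-! ### Localization of eigengroups and of the graded ring -/

namespace TwistDatum

theorem mem_eigen_zero {p : ℕ} {A : Type*} [CommRing A] (D : TwistDatum p A) {a : A} :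
    a ∈ D.eigen 0 ↔ D.σ a = a := by
  rw [mem_eigen, pow_zero, one_mul]

namespace IsCompatible

variable {p : ℕ} {A A' : Type u} [CommRing A] [CommRing A'] {D : TwistDatum p A}
  {D' : TwistDatum p A'} {g : A →+* A'} (h : IsCompatible D D' g) [hp : Fact p.Prime]

theorem map_iterate (h : IsCompatible D D' g) (l : ℕ) (a : A) : g (D.σ^[l] a) = D'.σ^[l] (g a) := by
  induction l with
  | zero => rfl
  | succ l ih => rw [Function.iterate_succ_apply', h.map_σ, ih, Function.iterate_succ_apply']

/-- An invariant multiple of an element of `A` that becomes invertible in `A'`. -/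
theorem exists_dvd_mem_eigen_zero (h : IsCompatible D D' g) {t : A} (ht : IsUnit (g t)) :
    ∃ d, t * d ∈ D.eigen 0 ∧ IsUnit (g (t * d)) := by
  obtain ⟨d, hd⟩ : t ∣ ∏ l ∈ Finset.range p, D.σ^[l] t :=
    Finset.dvd_prod_of_mem (fun l => D.σ^[l] t) (Finset.mem_range.2 hp.out.pos)
  refine ⟨d, ?_, ?_⟩
  · rw [← hd, mem_eigen_zero]
    exact map_prod_iterate_eq hp.out.ne_zero D.iterate_eq t
  · rw [← hd, map_prod, IsUnit.prod_iff]
    intro l _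
    rw [h.map_iterate, ← RingHom.coe_pow]
    exact ht.map _

/-- Clear the denominator, then kill the defect `σ (f d) - c ^ k f d`, which vanishes in the
localization. Both multipliers are completed to norms so that they have weight zero and do not
disturb the weight. -/
theorem exists_eigen_lift (h : IsCompatible D D' g) (hg : IsLocalizationHom g) {k : ℕ} {a : A'}
    (ha : a ∈ D'.eigen k) :
    ∃ f ∈ D.eigen k, ∃ t ∈ D.eigen 0, IsUnit (g t) ∧ a * g t = g f := by
  obtain ⟨f, t, ht, hft⟩ := hg.surj a
  obtain ⟨d, hd0, hd⟩ := h.exists_dvd_mem_eigen_zero ht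
  have h1 : g (D.σ (f * d) - D.c ^ k * (f * d)) = 0 := by
    have h2 : g (f * d) = a * g (t * d) := by rw [map_mul, ← hft, map_mul, mul_assoc]
    have h3 : D'.σ (g (t * d)) = g (t * d) := by rw [← h.map_σ, D.mem_eigen_zero.1 hd0]
    rw [map_sub, h.map_σ, map_mul g (D.c ^ k), map_pow, h.map_c, h2, map_mul, h3, D'.mem_eigen.1 ha]
    ring
  obtain ⟨t', ht', h4⟩ := hg.exists_of_map_eq_zero _ h1
  obtain ⟨d', hd0', hd'⟩ := h.exists_dvd_mem_eigen_zero ht'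
  refine ⟨t' * d' * (f * d), ?_, t' * d' * (t * d), D.mul_mem_eigen hd0' hd0, ?_, ?_⟩
  · rw [mem_eigen, map_mul, D.mem_eigen_zero.1 hd0']
    linear_combination d' * h4
  · rw [map_mul]
    exact hd'.mul hd
  · rw [map_mul, map_mul g _ (f * d), map_mul g f, ← hft, map_mul g t]
    ring

/-- Denominators can be chosen of weight zero, so the homogeneous components are treated one at a
time. -/
theorem isLocalizationHom_mapFixed (h : IsCompatible D D' g) (hg : IsLocalizationHom g) :
    IsLocalizationHom h.mapFixed where
  surj r := by
    have hu : ∀ t (ht : t ∈ D.eigen 0), IsUnit (g t) → IsUnit (h.mapFixed (D.mono 0 t ht)) :=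
      fun t ht hgt => by
        rw [h.mapFixed_mono]
        exact mono_mul_unit _ _ hgt
    suffices key : ∀ s : Finset ℕ, ∃ (x : D.fixedRing) (t : A) (ht : t ∈ D.eigen 0), IsUnit (g t) ∧
        (∑ k ∈ s, D'.mono k (D'.coef k (r : D'.Cover)) (D'.coef_mem_eigen r k)) *
          h.mapFixed (D.mono 0 t ht) = h.mapFixed x by
      obtain ⟨x, t, ht, hgt, hx⟩ := key (Finset.range p)
      rw [D'.sum_mono_coef] at hx
      exact ⟨x, _, hu t ht hgt, hx⟩
    intro s
    induction s using Finset.induction_on with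
    | empty => exact ⟨0, 1, D.one_mem_eigen, by simp, by simp⟩
    | insert k s hk ih =>
      obtain ⟨x, t, ht, hgt, hx⟩ := ih
      obtain ⟨f, hf, t', ht', hgt', hft⟩ := h.exists_eigen_lift hg (D'.coef_mem_eigen r k)
      refine ⟨D.mono k f hf * D.mono 0 t ht + x * D.mono 0 t' ht', t' * t,
        D.mul_mem_eigen ht' ht, ?_, ?_⟩
      · rw [map_mul]
        exact hgt'.mul hgt
      · have e1 : D.mono 0 (t' * t) (D.mul_mem_eigen ht' ht) = D.mono 0 t' ht' * D.mono 0 t ht :=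
          (D.mono_mul_mono ht' ht).symm
        have e2 : D'.mono k (D'.coef k (r : D'.Cover)) (D'.coef_mem_eigen r k) *
            h.mapFixed (D.mono 0 t' ht') = h.mapFixed (D.mono k f hf) := by
          rw [h.mapFixed_mono, h.mapFixed_mono, mono_mul_mono]
          exact D'.mono_congr _ _ (add_zero k) hft
        rw [Finset.sum_insert hk, e1, map_mul, map_add, map_mul, map_mul, ← e2, ← hx]
        ring
  exists_of_map_eq_zero r hr := by
    have h0 : ∀ k, g (D.coef k (r : D.Cover)) = 0 := fun k => by
      rcases lt_or_ge k p with hk | hk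
      · rw [← h.coef_mapFixed r hk, hr]
        simp
      · rw [D.coef_eq_zero_of_le hk, map_zero]
    suffices key : ∀ s : Finset ℕ, ∃ t ∈ D.eigen 0, IsUnit (g t) ∧
        ∀ k ∈ s, t * D.coef k (r : D.Cover) = 0 by
      obtain ⟨t, ht, hgt, h1⟩ := key (Finset.range p)
      refine ⟨D.mono 0 t ht, ?_, Subtype.ext (D.cover_ext fun k hk => ?_)⟩
      · rw [h.mapFixed_mono]
        exact mono_mul_unit _ _ hgt
      · rw [Subring.coe_mul, coe_mono, pow_zero, mul_one, coef_incl_mul, h1 k (Finset.mem_range.2 hk)]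
        simp
    intro s
    induction s using Finset.induction_on with
    | empty => exact ⟨1, D.one_mem_eigen, by simp, by simp⟩
    | insert k s hk ih =>
      obtain ⟨t, ht, hgt, h1⟩ := ih
      obtain ⟨t', ht', h2⟩ := hg.exists_of_map_eq_zero _ (h0 k)
      obtain ⟨d', hd0', hd'⟩ := h.exists_dvd_mem_eigen_zero ht'
      refine ⟨t' * d' * t, D.mul_mem_eigen hd0' ht, ?_, fun j hj => ?_⟩
      · rw [map_mul]
        exact hd'.mul hgt
      · rcases Finset.mem_insert.1 hj with rfl | hj
        · linear_combination d' * t * h2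
        · linear_combination t' * d' * h1 j hj

end IsCompatible

end TwistDatum

/-- Two local localizations at the same prime ideal are isomorphic. -/
theorem exists_ringEquiv_of_isLocalizationHom {R O O' : Type*} [CommRing R] [CommRing O]
    [CommRing O'] [IsLocalRing O] [IsLocalRing O'] {f : R →+* O} {f' : R →+* O'}
    (hf : IsLocalizationHom f) (hf' : IsLocalizationHom f')
    (h : (maximalIdeal O).comap f = (maximalIdeal O').comap f') :
    ∃ ψ : O ≃+* O', ∀ r, ψ (f r) = f' r := by
  let := f.toAlgebra
  let := f'.toAlgebra
  have h1 := hf.isLocalization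
  have h2 := hf'.isLocalization
  have h3 : IsLocalization ((maximalIdeal O).comap f).primeCompl O' := by
    simp only [h]
    exact h2
  have h4 : IsLocalization ((maximalIdeal O).comap f).primeCompl O := h1
  exact ⟨(IsLocalization.algEquiv ((maximalIdeal O).comap f).primeCompl O O').toRingEquiv,
    fun r => (IsLocalization.algEquiv ((maximalIdeal O).comap f).primeCompl O O').commutes r⟩

theorem IsLocalizationHom.comp_equiv {R R' O : Type*} [CommRing R] [CommRing R'] [CommRing O]
    {f : R →+* O} (hf : IsLocalizationHom f) (e : R' ≃+* R) :
    IsLocalizationHom (f.comp e.toRingHom) where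
  surj s := by
    obtain ⟨a, b, hb, h⟩ := hf.surj s
    exact ⟨e.symm a, e.symm b, by simpa using hb, by simpa using h⟩
  exists_of_map_eq_zero a ha := by
    obtain ⟨t, ht, h⟩ := hf.exists_of_map_eq_zero (e a) ha
    exact ⟨e.symm t, by simpa using ht, e.injective (by simpa using h)⟩

/-! ### Local rings of `Q` and its map to `X` -/

namespace MuQuotient

variable {p : ℕ} {X : Scheme.{u}} (Q : MuQuotient p X)

theorem isLocalizationHom_germ (x : Q.scheme) : IsLocalizationHom (Q.germ x) :=
  (ToricDivisors.isLocalizationHom_germ (isAffineOpen_top Q.scheme) x trivial).comp_equiv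
    (Scheme.ΓSpecIso Q.R).symm.commRingCatIsoToRingEquiv

theorem isUnit_germ_iff (x : Q.scheme) (r : Q.R) : IsUnit (Q.germ x r) ↔ r ∉ x.asIdeal := by
  have h := Scheme.mem_basicOpen Q.scheme ((Scheme.ΓSpecIso Q.R).inv.hom r) x trivial
  refine h.symm.trans ?_
  rw [basicOpen_eq_of_affine]
  exact Iff.rfl

theorem comap_germ_maximalIdeal (x : Q.scheme) :
    (maximalIdeal (Q.scheme.presheaf.stalk x)).comap (Q.germ x) = x.asIdeal := by
  ext r
  rw [Ideal.mem_comap, mem_maximalIdeal, mem_nonunits_iff, isUnit_germ_iff, not_not]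

/-- The pullback of functions along the quotient map. -/
def pull : Γ(X, Q.V) →+* Q.R :=
  (SetLike.GradeZero.subring Q.grading).subtype.comp Q.iso.toRingHom

theorem toX_mem (x : Q.scheme) : Q.toX x ∈ Q.V := by
  have : Q.isAffineOpen.fromSpec (Spec.map (CommRingCat.ofHom Q.pull) x) ∈
    Set.range Q.isAffineOpen.fromSpec := ⟨_, rfl⟩
  rw [Q.isAffineOpen.range_fromSpec] at this
  exact this

theorem stalkMap_toX_germ (x : Q.scheme) (b : Γ(X, Q.V)) :
    (Q.toX.stalkMap x).hom ((X.presheaf.germ Q.V (Q.toX x) (Q.toX_mem x)).hom b) =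
      Q.germ x (Q.pull b) := by
  set g := Spec.map (CommRingCat.ofHom Q.pull) with hg
  set i := Q.isAffineOpen.fromSpec with hi
  have hix : i (g x) ∈ Q.V := Q.toX_mem x
  have h1 := Scheme.Hom.stalkMap_comp g i x
  have h2 : (Q.toX.stalkMap x).hom ((X.presheaf.germ Q.V (Q.toX x) (Q.toX_mem x)).hom b) =
      (g.stalkMap x).hom ((i.stalkMap (g x)).hom ((X.presheaf.germ Q.V (i (g x)) hix).hom b)) :=
    DFunLike.congr_fun (CommRingCat.hom_ext_iff.mp h1) _
  have h3 : ((Spec Γ(X, Q.V)).presheaf.germ (i ⁻¹ᵁ Q.V) (g x) hix).hom ((i.app Q.V).hom b) =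
      ((Spec Γ(X, Q.V)).presheaf.germ ⊤ (g x) trivial).hom
        ((Scheme.ΓSpecIso Γ(X, Q.V)).inv.hom b) := by
    have e := DFunLike.congr_fun (CommRingCat.hom_ext_iff.mp Q.isAffineOpen.fromSpec_app_self) b
    refine (congrArg ((Spec Γ(X, Q.V)).presheaf.germ (i ⁻¹ᵁ Q.V) (g x) hix).hom e).trans ?_
    exact (Spec Γ(X, Q.V)).presheaf.germ_res_apply
      (eqToHom Q.isAffineOpen.fromSpec_preimage_self) (g x) hix _
  have h4 := Scheme.ΓSpecIso_inv_naturality (CommRingCat.ofHom Q.pull)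
  have h5 : (g.appTop).hom ((Scheme.ΓSpecIso Γ(X, Q.V)).inv.hom b) =
      (Scheme.ΓSpecIso Q.R).inv.hom (Q.pull b) :=
    (DFunLike.congr_fun (CommRingCat.hom_ext_iff.mp h4) b).symm
  rw [h2, germ_stalkMap_apply i hix, h3]
  refine (germ_stalkMap_apply g (V := ⊤) trivial _).trans ?_
  exact congrArg (Q.scheme.presheaf.germ ⊤ x trivial).hom h5

theorem mem_pointIdeal_toX_iff (x : Q.scheme) (b : Γ(X, Q.V)) :
    b ∈ pointIdeal Q.V (Q.toX x) (Q.toX_mem x) ↔ Q.pull b ∈ x.asIdeal := by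
  rw [← Q.comap_germ_maximalIdeal, Ideal.mem_comap, ← stalkMap_toX_germ, mem_maximalIdeal,
    mem_nonunits_iff, isUnit_map_iff]
  exact Iff.rfl

theorem map_stalkMap_toX (x : Q.scheme) :
    (maximalIdeal (X.presheaf.stalk (Q.toX x))).map (Q.toX.stalkMap x).hom =
      (pointIdeal Q.V (Q.toX x) (Q.toX_mem x)).map ((Q.germ x).comp Q.pull) := by
  rw [map_stalkMap_maximalIdeal Q.toX Q.isAffineOpen (Q.toX_mem x)]
  congr 1
  ext b
  rw [RingHom.comp_apply, RingHom.comp_apply, ← stalkMap_toX_germ]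
  exact (germ_stalkMap_apply Q.toX (Q.toX_mem x) b).symm

end MuQuotient

theorem length_quotient_maximalIdeal (O : Type*) [CommRing O] [IsLocalRing O] :
    Module.length O (O ⧸ maximalIdeal O) = 1 := by
  rw [Module.length_eq_one_iff, isSimpleModule_iff_isCoatom]
  exact (maximalIdeal.isMaximal O).out

theorem height_span_singleton_of_prime {A : Type*} [CommRing A] [IsDomain A] [IsNoetherianRing A]
    {y : A} (hy : Prime y) : (Ideal.span {y}).height = 1 :=
  Ideal.height_span_singleton_eq_one_of_mem_nonZeroDivisors
    (mem_nonZeroDivisors_of_ne_zero hy.ne_zero) hy.not_isUnit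

theorem pointIdeal_congr {X : Scheme.{u}} {V : X.Opens} {x y : X} (hx : x ∈ V) (hy : y ∈ V)
    (h : x = y) : pointIdeal V x hx = pointIdeal V y hy := by
  subst h
  rfl

/-! ### Local equations of prime divisors -/

section LocalEquations

variable {U : Scheme.{u}} {P : U} {E : PrimeDivisor U} {y : U.presheaf.stalk P}

theorem IsLocalEquation.prime (h : IsLocalEquation P E y) : Prime y := by
  obtain ⟨hE, hy⟩ := isLocalEquation_iff.1 h
  have h1 : (Ideal.span {y}).IsPrime := hy ▸ inferInstance
  rw [Ideal.span_singleton_prime] at h1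
  · exact h1
  · rintro rfl
    have h2 := height_genIdeal hE
    rw [hy, E.2, Ideal.span_singleton_eq_bot.2 rfl] at h2
    rw [Ideal.height_bot] at h2
    exact zero_ne_one h2

theorem IsLocalEquation.mem_maximalIdeal (h : IsLocalEquation P E y) :
    y ∈ maximalIdeal (U.presheaf.stalk P) :=
  (IsLocalRing.mem_maximalIdeal _).2 h.prime.not_isUnit

theorem IsLocalEquation.mul_unit (h : IsLocalEquation P E y) (w : (U.presheaf.stalk P)ˣ) :
    IsLocalEquation P E (y * w) := by
  obtain ⟨hE, hy⟩ := h
  exact ⟨hE, hy.trans (Ideal.span_singleton_mul_right_unit w.isUnit y).symm⟩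

theorem IsLocalEquation.mem_pointIdeal_iff (h : IsLocalEquation P E y) {W : U.Opens} (hP : P ∈ W)
    (hE : E.1 ∈ W) (f : Γ(U, W)) :
    f ∈ pointIdeal W E.1 hE ↔ y ∣ (U.presheaf.germ W P hP).hom f := by
  obtain ⟨hsp, hy⟩ := isLocalEquation_iff.1 h
  rw [← Ideal.mem_span_singleton, ← hy, ← Ideal.mem_comap, comap_germ_genIdeal hsp hP]

theorem exists_isLocalEquation [IsDomain (U.presheaf.stalk P)]
    [IsNoetherianRing (U.presheaf.stalk P)] (hy : Prime y) :
    ∃ E : PrimeDivisor U, IsLocalEquation P E y := by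
  have : (Ideal.span {y}).IsPrime := (Ideal.span_singleton_prime hy.ne_zero).2 hy
  obtain ⟨x, h, hx⟩ := exists_genIdeal_eq (Ideal.span {y})
  exact ⟨⟨x, by rw [← height_genIdeal h, hx, height_span_singleton_of_prime hy]⟩, h, hx⟩

end LocalEquations

theorem pullbackCoeff_of_eq {X Y : Scheme.{u}} {f : Y ⟶ X} {F : PrimeDivisor X} {η : PrimeDivisor Y}
    (h : f η.1 = F.1) : pullbackCoeff f F η = Module.length (Y.presheaf.stalk η.1)
      (Y.presheaf.stalk η.1 ⧸
        (maximalIdeal (X.presheaf.stalk (f η.1))).map (f.stalkMap η.1).hom) :=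
  if_pos h

theorem pullbackCoeff_of_ne {X Y : Scheme.{u}} {f : Y ⟶ X} {F : PrimeDivisor X} {η : PrimeDivisor Y}
    (h : f η.1 ≠ F.1) : pullbackCoeff f F η = 0 :=
  if_neg h

theorem IsDivisorPullback.apply_eq {X Y : Scheme.{u}} {f : Y ⟶ X} {F : PrimeDivisor X}
    {E : PrimeDivisor Y} (h : IsDivisorPullback f F E) : f E.1 = F.1 := by
  by_contra hne
  have h1 := h E
  rw [pullbackCoeff_of_ne hne, if_pos rfl] at h1
  exact zero_ne_one h1

variable {p : ℕ} {U X : Scheme.{u}} {σ : U ≅ U} {π : U ⟶ X}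

/-- An extension of the action and the cocycle on the local ring at a fixed point to an invariant
affine neighborhood. -/
structure LocalModel (hπ : IsQuotientBy σ π) {P : U} (D₀ : TwistDatum p (U.presheaf.stalk P)) where
  V : X.Opens
  isAffineOpen : IsAffineOpen V
  mem : P ∈ π ⁻¹ᵁ V
  D : TwistDatum p Γ(U, π ⁻¹ᵁ V)
  D_σ : D.σ = sectionAction σ hπ V
  compatible : D.IsCompatible D₀ (U.presheaf.germ (π ⁻¹ᵁ V) P mem).hom

theorem exists_localModel [hp : Fact p.Prime] (hσ : (fun f : U ⟶ U => f ≫ σ.hom)^[p] (𝟙 U) = 𝟙 U)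
    (hπ : IsQuotientBy σ π) {P : U} (hP : σ.hom P = P)
    {D₀ : TwistDatum p (U.presheaf.stalk P)} (hD₀ : D₀.σ = stalkAction σ P hP) :
    Nonempty (LocalModel hπ D₀) := by
  obtain ⟨V, hV, hPV, C, hC, hN⟩ := exists_section_norm_eq_one σ hπ hP hp.out.ne_zero hσ
    (c := D₀.c) (by rw [← hD₀]; exact D₀.norm_eq_one)
  exact ⟨⟨V, hV, hPV, ⟨sectionAction σ hπ V, C, sectionAction_iterate σ hπ hσ V, hN⟩, rfl,
    fun f => by rw [hD₀, stalkAction_germ σ hπ], hC⟩⟩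

/-! ### Descent of a stable divisor to the quotient -/

namespace LocalModel

variable {hπ : IsQuotientBy σ π} {P : U} {D₀ : TwistDatum p (U.presheaf.stalk P)}
  (M : LocalModel hπ D₀)

/-- The germ at the fixed point. -/
abbrev germ : Γ(U, π ⁻¹ᵁ M.V) →+* U.presheaf.stalk P :=
  (U.presheaf.germ (π ⁻¹ᵁ M.V) P M.mem).hom

/-- The pullback of functions from the quotient. -/
abbrev pull : Γ(X, M.V) →+* Γ(U, π ⁻¹ᵁ M.V) := (π.app M.V).hom

theorem isLocalizationHom_germ : IsLocalizationHom M.germ :=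
  ToricDivisors.isLocalizationHom_germ (isAffineOpen_preimage σ hπ M.isAffineOpen) P M.mem

theorem mem_range_pull_iff (f : Γ(U, π ⁻¹ᵁ M.V)) : f ∈ Set.range M.pull ↔ M.D.σ f = f := by
  rw [M.D_σ]
  exact mem_range_app_iff σ hπ M.V f

theorem pull_mem_eigen (b : Γ(X, M.V)) : M.pull b ∈ M.D.eigen 0 :=
  M.D.mem_eigen_zero.2 ((M.mem_range_pull_iff _).1 ⟨b, rfl⟩)

theorem germ_pull_mem_eigen (b : Γ(X, M.V)) : M.germ (M.pull b) ∈ D₀.eigen 0 :=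
  M.compatible.map_mem_eigen (M.pull_mem_eigen b)

variable [hp : Fact p.Prime]

theorem exists_germ_pull_eq {g : U.presheaf.stalk P} (hg : g ∈ D₀.eigen 0) :
    ∃ (b : Γ(X, M.V)) (t : U.presheaf.stalk P), IsUnit t ∧ t ∈ D₀.eigen 0 ∧
      g * t = M.germ (M.pull b) := by
  obtain ⟨f, hf, t, ht, htu, h⟩ := M.compatible.exists_eigen_lift M.isLocalizationHom_germ hg
  obtain ⟨b, rfl⟩ := (M.mem_range_pull_iff f).2 (M.D.mem_eigen_zero.1 hf)
  exact ⟨b, _, htu, M.compatible.map_mem_eigen ht, h⟩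

/-- `F` is the image of `E`, of codimension one since quotients preserve heights. The invariant `g`
vanishes exactly once along `E`, so the ramification index is one, and `hstab` makes `E` the only
prime divisor over `F`. -/
theorem exists_isDivisorPullback (M : LocalModel hπ D₀) {E : PrimeDivisor U}
    {y : U.presheaf.stalk P} (hE : IsLocalEquation P E y) (hstab : y ∣ D₀.σ y)
    (hnot : ∃ g ∈ D₀.eigen 0, ∃ a, g = y * a ∧ ¬ y ∣ a) :
    ∃ F : PrimeDivisor X, IsDivisorPullback π F E := by
  obtain ⟨hsp, hy⟩ := isLocalEquation_iff.1 hE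
  have hEV : E.1 ∈ π ⁻¹ᵁ M.V := hsp.mem_open (π ⁻¹ᵁ M.V).isOpen M.mem
  have hW := isAffineOpen_preimage σ hπ M.isAffineOpen
  have hinj : Function.Injective M.pull := hπ.injective M.V
  have hheight : Order.coheight (π E.1) = 1 := by
    rw [← height_pointIdeal M.isAffineOpen (π E.1) hEV, ← comap_app_pointIdeal π hEV,
      M.D.height_comap M.pull hinj M.mem_range_pull_iff, height_pointIdeal hW, E.2]
  obtain ⟨F, hF⟩ : ∃ F : PrimeDivisor X, π E.1 = F.1 := ⟨⟨π E.1, hheight⟩, rfl⟩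
  refine ⟨F, fun η => ?_⟩
  by_cases hη : η = E
  · subst hη
    rw [if_pos rfl, pullbackCoeff_of_eq hF]
    have hmax : (maximalIdeal (X.presheaf.stalk (π η.1))).map (π.stalkMap η.1).hom =
        maximalIdeal (U.presheaf.stalk η.1) := by
      refine le_antisymm (Ideal.map_le_iff_le_comap.2 fun a ha =>
        (map_mem_nonunits_iff (π.stalkMap η.1).hom a).2 ha) ?_
      rw [← (isLocalizationHom_stalkSpecializes hsp).map_comap (maximalIdeal _)]
      change (genIdeal hsp).map _ ≤ _
      rw [hy, Ideal.map_span, Set.image_singleton, Ideal.span_singleton_le_iff_mem,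
        map_stalkMap_maximalIdeal π M.isAffineOpen hEV]
      obtain ⟨g, hg, a, rfl, hya⟩ := hnot
      obtain ⟨b, t, ht, -, hb⟩ := M.exists_germ_pull_eq hg
      have hbE : b ∈ pointIdeal M.V (π η.1) hEV := by
        rw [← comap_app_pointIdeal π hEV, Ideal.mem_comap, hE.mem_pointIdeal_iff M.mem]
        exact ⟨a * t, by rw [← mul_assoc]; exact hb.symm⟩
      have h1 := Ideal.mem_map_of_mem
        ((U.presheaf.germ (π ⁻¹ᵁ M.V) η.1 hEV).hom.comp (π.app M.V).hom) hbE
      have hau : IsUnit ((U.presheaf.stalkSpecializes hsp).hom a) := by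
        by_contra hcon
        have : a ∈ genIdeal hsp := hcon
        rw [hy, Ideal.mem_span_singleton] at this
        exact hya this
      have h2 : ((U.presheaf.germ (π ⁻¹ᵁ M.V) η.1 hEV).hom.comp (π.app M.V).hom) b =
          (U.presheaf.stalkSpecializes hsp).hom y * ((U.presheaf.stalkSpecializes hsp).hom a *
            (U.presheaf.stalkSpecializes hsp).hom t) := by
        rw [← map_mul, ← map_mul, ← mul_assoc, hb]
        exact (germ_stalkSpecializes_apply hsp M.mem (M.pull b)).symm
      rw [h2] at h1
      exact (Ideal.mul_unit_mem_iff_mem _ (hau.mul (ht.map _))).1 h1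
    rw [hmax]
    exact length_quotient_maximalIdeal _
  · rw [if_neg hη]
    refine pullbackCoeff_of_ne fun hπη => ?_
    refine hη (Subtype.ext ?_)
    have hηV : η.1 ∈ π ⁻¹ᵁ M.V := by
      change π η.1 ∈ M.V
      rw [hπη, ← hF]
      exact hEV
    refine eq_of_pointIdeal_eq hW hηV hEV ?_
    refine M.D.eq_of_comap_eq M.pull M.mem_range_pull_iff (fun f hf => ?_) ?_
    · rw [hE.mem_pointIdeal_iff M.mem] at hf ⊢
      rw [M.compatible.map_σ]
      exact hstab.trans (map_dvd D₀.σ hf)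
    · rw [comap_app_pointIdeal π hηV, comap_app_pointIdeal π hEV]
      exact (pointIdeal_congr _ _ (hπη.trans hF.symm)).symm

end LocalModel

theorem IsLocalizationHom.height_comap_maximalIdeal {X : Scheme.{u}} {x : X} {R : Type*} [CommRing R]
    {f : R →+* X.presheaf.stalk x} (hf : IsLocalizationHom f) :
    ((maximalIdeal (X.presheaf.stalk x)).comap f).height = Order.coheight x := by
  rw [hf.height_comap]
  have := maximalIdeal_height_eq_ringKrullDim (R := X.presheaf.stalk x)
  rw [ringKrullDim_stalk_eq_coheight] at this
  exact_mod_cast this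

theorem IsCoordinateSystem.map_equiv {A B : Type*} [CommRing A] [CommRing B] [IsRegularLocalRing A]
    [IsRegularLocalRing B] (e : A ≃+* B) {n : ℕ} {t : Fin n → A} (ht : IsCoordinateSystem t) :
    IsCoordinateSystem (fun i => e (t i)) := by
  refine isCoordinateSystem_of_span_eq ?_ ?_
  · have h : Set.range (fun i => e (t i)) = e '' Set.range t := by
      rw [← Set.range_comp]
      rfl
    rw [h, ← Ideal.map_span e, ht.span_eq]
    have hm : ((maximalIdeal A).map e).IsMaximal := Ideal.map_isMaximal_of_equiv e
    exact eq_maximalIdeal hm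
  · have h1 := (IsRegularLocalRing.iff_finrank_cotangentSpace A).1 inferInstance
    have h2 := (IsRegularLocalRing.iff_finrank_cotangentSpace B).1 inferInstance
    rw [← ringKrullDim_eq_of_ringEquiv e, ← h1, ht.finrank_eq] at h2
    exact_mod_cast h2.ge

/-! ### Construction of `Q` and its fixed point -/

namespace LocalModel

variable {p : ℕ} {U X : Scheme.{u}} {σ : U ≅ U} {π : U ⟶ X} {hπ : IsQuotientBy σ π} {P : U}
  {D₀ : TwistDatum p (U.presheaf.stalk P)} [hp : Fact p.Prime] (M : LocalModel hπ D₀)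

/-- The scheme with an action of `μ_p` whose quotient is the given neighborhood. -/
def quotient : MuQuotient p X where
  V := M.V
  isAffineOpen := M.isAffineOpen
  R := CommRingCat.of M.D.fixedRing
  grading := M.D.grading
  iso := M.D.gradeZeroEquiv M.pull (hπ.injective M.V) M.mem_range_pull_iff

/-- The homogeneous function `f T ^ k`. -/
def mono (k : ℕ) (f : Γ(U, π ⁻¹ᵁ M.V)) (hf : f ∈ M.D.eigen k) : M.quotient.R := M.D.mono k f hf

theorem mono_mem_grading {k : ℕ} {f : Γ(U, π ⁻¹ᵁ M.V)} (hf : f ∈ M.D.eigen k) :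
    M.mono k f hf ∈ M.quotient.grading k :=
  M.D.mono_mem_grading hf rfl

/-- The homomorphism to the local version of the ring of functions. -/
def toLocal : M.quotient.R →+* D₀.fixedRing := M.compatible.mapFixed

theorem isLocalizationHom_toLocal : IsLocalizationHom M.toLocal :=
  M.compatible.isLocalizationHom_mapFixed M.isLocalizationHom_germ

theorem toLocal_mono {k : ℕ} {f : Γ(U, π ⁻¹ᵁ M.V)} (hf : f ∈ M.D.eigen k) :
    M.toLocal (M.mono k f hf) = D₀.mono k (M.germ f) (M.compatible.map_mem_eigen hf) :=
  M.compatible.mapFixed_mono hf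

theorem toLocal_mem_grading {b : ZMod p} {r : M.quotient.R} (hr : r ∈ M.quotient.grading b) :
    M.toLocal r ∈ D₀.grading b :=
  M.compatible.mapFixed_mem_grading hr

theorem quotient_pull (b : Γ(X, M.V)) :
    M.quotient.pull b = M.mono 0 (M.pull b) (M.pull_mem_eigen b) := by
  refine Subtype.ext ?_
  change M.D.incl (M.pull b) = M.D.incl (M.pull b) * M.D.T ^ 0
  rw [pow_zero, mul_one]

theorem toLocal_pull (b : Γ(X, M.V)) :
    M.toLocal (M.quotient.pull b) = D₀.mono 0 (M.germ (M.pull b)) (M.germ_pull_mem_eigen b) := by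
  rw [quotient_pull, toLocal_mono]

variable [IsLocalRing D₀.fixedRing]

/-- The fixed point over the image of `P`. -/
def fixedPoint : M.quotient.scheme :=
  ⟨(maximalIdeal D₀.fixedRing).comap M.toLocal, inferInstance⟩

theorem exists_stalk_equiv (M : LocalModel hπ D₀) :
    ∃ ψ : M.quotient.scheme.presheaf.stalk M.fixedPoint ≃+* D₀.fixedRing,
      ∀ r, ψ (M.quotient.germ M.fixedPoint r) = M.toLocal r :=
  exists_ringEquiv_of_isLocalizationHom (M.quotient.isLocalizationHom_germ _)
    M.isLocalizationHom_toLocal (M.quotient.comap_germ_maximalIdeal _)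

theorem exists_hom_stalk {η : M.quotient.scheme} (hη : η ⤳ M.fixedPoint) :
    ∃ l : D₀.fixedRing →+* M.quotient.scheme.presheaf.stalk η, IsLocalizationHom l ∧
      ∀ r, l (M.toLocal r) = M.quotient.germ η r := by
  obtain ⟨ψ, hψ⟩ := M.exists_stalk_equiv
  set l := (M.quotient.scheme.presheaf.stalkSpecializes hη).hom.comp ψ.symm.toRingHom with hl
  have hlr : ∀ r, l (M.toLocal r) = M.quotient.germ η r := fun r => by
    have : ψ.symm (M.toLocal r) = M.quotient.germ M.fixedPoint r := by
      rw [← hψ, RingEquiv.symm_apply_apply]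
    change (M.quotient.scheme.presheaf.stalkSpecializes hη).hom (ψ.symm (M.toLocal r)) = _
    rw [this]
    exact germ_stalkSpecializes_apply (V := ⊤) hη trivial _
  refine ⟨l, .of_comp M.isLocalizationHom_toLocal ?_, hlr⟩
  have : l.comp M.toLocal = M.quotient.germ η := RingHom.ext hlr
  rw [this]
  exact M.quotient.isLocalizationHom_germ η

theorem exists_point (M : LocalModel hπ D₀) (q : Ideal D₀.fixedRing) [hq : q.IsPrime] :
    ∃ η : M.quotient.scheme, η ⤳ M.fixedPoint ∧ η.asIdeal = q.comap M.toLocal := by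
  refine ⟨⟨q.comap M.toLocal, inferInstance⟩, (PrimeSpectrum.le_iff_specializes _ _).1 ?_, rfl⟩
  exact Ideal.comap_mono (le_maximalIdeal hq.ne_top)

theorem exists_primeDivisor (M : LocalModel hπ D₀) (q : Ideal D₀.fixedRing) [hq : q.IsPrime]
    (hq1 : q.height = 1) :
    ∃ (η : PrimeDivisor M.quotient.scheme) (l : D₀.fixedRing →+* M.quotient.scheme.presheaf.stalk η.1),
      η.1 ⤳ M.fixedPoint ∧ IsLocalizationHom l ∧ (∀ r, l (M.toLocal r) = M.quotient.germ η.1 r) ∧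
      (maximalIdeal _).comap l = q := by
  obtain ⟨η, hη, hηq⟩ := M.exists_point q
  obtain ⟨l, hl, hlr⟩ := M.exists_hom_stalk hη
  have h1 : (maximalIdeal _).comap l = q := by
    refine M.isLocalizationHom_toLocal.comap_injective ?_
    have : l.comp M.toLocal = M.quotient.germ η := RingHom.ext hlr
    rw [← hηq, ← M.quotient.comap_germ_maximalIdeal η, Ideal.comap_comap, this]
  exact ⟨⟨η, by rw [← hl.height_comap_maximalIdeal, h1, hq1]⟩, l, hη, hl, hlr, h1⟩

theorem isCoordinateSystem_germ (M : LocalModel hπ D₀) [IsRegularLocalRing D₀.fixedRing] {n : ℕ}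
    {t : Fin n → M.quotient.R} (ht : IsCoordinateSystem fun i => M.toLocal (t i)) :
    IsCoordinateSystem fun i => M.quotient.germ M.fixedPoint (t i) := by
  obtain ⟨ψ, hψ⟩ := M.exists_stalk_equiv
  have := IsRegularLocalRing.of_ringEquiv ψ.symm
  have h := ht.map_equiv ψ.symm
  simpa only [← hψ, RingEquiv.symm_apply_apply] using h

theorem isRegularFixedPointOver (M : LocalModel hπ D₀) [IsRegularLocalRing D₀.fixedRing]
    (hE : ∀ k, 0 < k → k < p → ∀ a ∈ D₀.eigen k, a ∈ maximalIdeal (U.presheaf.stalk P)) :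
    M.quotient.IsRegularFixedPointOver (π P) M.fixedPoint := by
  obtain ⟨ψ, hψ⟩ := M.exists_stalk_equiv
  refine ⟨?_, fun b hb h hh => ?_, IsRegularLocalRing.of_ringEquiv ψ.symm⟩
  · refine eq_of_pointIdeal_eq M.isAffineOpen (M.quotient.toX_mem _) M.mem ?_
    ext b
    rw [← comap_app_pointIdeal π M.mem]
    refine (M.quotient.mem_pointIdeal_toX_iff M.fixedPoint b).trans ?_
    change M.toLocal (M.quotient.pull b) ∈ maximalIdeal _ ↔ M.germ (M.pull b) ∈ maximalIdeal _
    rw [toLocal_pull, TwistDatum.mem_maximalIdeal_fixedRing_iff hE, TwistDatum.coe_mono,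
      D₀.coef_incl_mul_T_pow hp.out.pos, if_pos rfl]
  · obtain ⟨a, ha, rfl⟩ := M.D.exists_mono_of_mem_grading hh
    have h1 : M.mono b.val a ha ∈ (maximalIdeal _).comap (M.quotient.germ M.fixedPoint) ↔
        M.toLocal (M.mono b.val a ha) ∈ maximalIdeal _ := by
      rw [M.quotient.comap_germ_maximalIdeal]
      exact Iff.rfl
    refine h1.2 ?_
    rw [toLocal_mono]
    refine TwistDatum.mono_mem_maximalIdeal hE _ (hE b.val ?_ (ZMod.val_lt b) _ ?_)
    · exact Nat.pos_of_ne_zero ((ZMod.val_ne_zero b).2 hb)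
    · exact M.compatible.map_mem_eigen ha

end LocalModel

theorem isUnit_of_ord_eq_zero {O : Type*} [CommRing O] {s : O} (h : Ring.ord O s = 0) : IsUnit s := by
  rw [Ring.ord, Module.length_eq_zero_iff, Submodule.Quotient.subsingleton_iff] at h
  exact Ideal.span_singleton_eq_top.1 h

theorem span_eq_maximalIdeal_of_ord_eq_one {O : Type*} [CommRing O] [IsLocalRing O] {s : O}
    (h : Ring.ord O s = 1) : Ideal.span {s} = maximalIdeal O := by
  rw [Ring.ord, Module.length_eq_one_iff, isSimpleModule_iff_isCoatom] at h
  exact eq_maximalIdeal ⟨h⟩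

theorem ord_eq_one_of_span_eq {O : Type*} [CommRing O] [IsLocalRing O] {s : O}
    (h : Ideal.span {s} = maximalIdeal O) : Ring.ord O s = 1 := by
  rw [Ring.ord, h]
  exact length_quotient_maximalIdeal O

/-! ### Eigenfunctions defining the pullback of a divisor -/

namespace LocalModel

variable {p : ℕ} {U X : Scheme.{u}} {σ : U ≅ U} {π : U ⟶ X} {hπ : IsQuotientBy σ π} {P : U}
  {D₀ : TwistDatum p (U.presheaf.stalk P)} [hp : Fact p.Prime] (M : LocalModel hπ D₀)
  [IsDomain D₀.fixedRing]

/-- A homogeneous function with a local equation of `E` as its coefficient defines the pullback of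
the image of `E`. -/
theorem isEigenEquation_mono [IsLocalRing D₀.fixedRing] [IsDomain (U.presheaf.stalk P)]
    (M : LocalModel hπ D₀) {k : ℕ} {f : Γ(U, π ⁻¹ᵁ M.V)} (hf : f ∈ M.D.eigen k)
    {E : PrimeDivisor U} (hE : IsLocalEquation P E (M.germ f))
    (hnot : ∃ a ∈ D₀.eigen ((p - 1) * k), ¬ M.germ f ∣ a)
    {F : PrimeDivisor X} (hF : π E.1 = F.1) :
    M.quotient.IsEigenEquation M.fixedPoint F (M.mono k f hf) k := by
  refine ⟨M.mono_mem_grading hf, fun η hη => ?_⟩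
  obtain ⟨l, hl, hlr⟩ := M.exists_hom_stalk hη
  set z := M.germ f with hz
  have hzk : z ∈ D₀.eigen k := M.compatible.map_mem_eigen hf
  have hzp : Prime z := hE.prime
  have hEV : E.1 ∈ π ⁻¹ᵁ M.V := hE.choose.mem_open (π ⁻¹ᵁ M.V).isOpen M.mem
  have hFV : F.1 ∈ M.V := hF ▸ hEV
  have hFmem : ∀ b, b ∈ pointIdeal M.V F.1 hFV ↔ z ∣ M.germ (M.pull b) := fun b => by
    rw [← pointIdeal_congr (x := π E.1) hEV hFV hF, ← comap_app_pointIdeal π hEV, Ideal.mem_comap,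
      hE.mem_pointIdeal_iff M.mem]
  set q := (maximalIdeal (M.quotient.scheme.presheaf.stalk η.1)).comap l with hq
  have hqheight : q.height = 1 := by rw [hq, hl.height_comap_maximalIdeal, η.2]
  have hqmem : ∀ r, M.toLocal r ∈ q ↔ r ∈ η.1.asIdeal := fun r => by
    rw [hq, Ideal.mem_comap, hlr, ← M.quotient.comap_germ_maximalIdeal, Ideal.mem_comap]
  have hpull : ∀ b, b ∈ pointIdeal M.V (M.quotient.toX η.1) (M.quotient.toX_mem η.1) ↔
      D₀.mono 0 (M.germ (M.pull b)) (M.germ_pull_mem_eigen b) ∈ q := fun b => by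
    rw [← toLocal_pull, hqmem]
    exact M.quotient.mem_pointIdeal_toX_iff η.1 b
  have hlh : M.quotient.germ η.1 (M.mono k f hf) = l (D₀.mono k z hzk) := by
    rw [← hlr, toLocal_mono]
  have hlb : ∀ b : Γ(X, M.V), M.quotient.germ η.1 (M.quotient.pull b) =
      l (D₀.mono 0 (M.germ (M.pull b)) (M.germ_pull_mem_eigen b)) := fun b =>
    (hlr _).symm.trans (congrArg l (M.toLocal_pull b))
  by_cases hηF : M.quotient.toX η.1 = F.1
  · have hpc : pointIdeal M.V (M.quotient.toX η.1) (M.quotient.toX_mem η.1) =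
        pointIdeal M.V F.1 hFV := pointIdeal_congr _ _ hηF
    have hqF : ∀ b, D₀.mono 0 (M.germ (M.pull b)) (M.germ_pull_mem_eigen b) ∈ q ↔
        z ∣ M.germ (M.pull b) := fun b =>
      (hpull b).symm.trans ((SetLike.ext_iff.1 hpc b).trans (hFmem b))
    suffices h : (maximalIdeal (X.presheaf.stalk (M.quotient.toX η.1))).map
        (M.quotient.toX.stalkMap η.1).hom =
        Ideal.span {M.quotient.germ η.1 (M.mono k f hf)} by
      rw [pullbackCoeff_of_eq hηF, h]
      rfl
    rw [M.quotient.map_stalkMap_toX]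
    refine le_antisymm ?_ ?_
    · refine Ideal.map_le_iff_le_comap.2 fun b hb => ?_
      have hb' := TwistDatum.mono_zero_mem_span hzp.ne_zero hzk (M.germ_pull_mem_eigen b)
        ((hqF b).1 ((hpull b).1 hb))
      have h1 := Ideal.mem_map_of_mem l hb'
      rw [Ideal.map_span, Set.image_singleton, ← hlh] at h1
      rw [Ideal.mem_comap, RingHom.comp_apply]
      exact (hlb b) ▸ h1
    -- Multiplying `z T ^ k` by `a T ^ ((p - 1) * k)` gives, up to a unit, a function on `X`
    -- vanishing on `F`. The second factor is a unit at `η` because `z` does not divide `a`.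
    · obtain ⟨a, ha, hza⟩ := hnot
      obtain ⟨hg, hmul⟩ := TwistDatum.mono_mul_mono_eq_mono_zero hzk ha
      obtain ⟨b, t, ht, ht0, hb⟩ := M.exists_germ_pull_eq hg
      have hbF : b ∈ pointIdeal M.V (M.quotient.toX η.1) (M.quotient.toX_mem η.1) := by
        rw [hpull, hqF, ← hb]
        exact ⟨a * D₀.tau ^ k * t, by ring⟩
      have h1 := Ideal.mem_map_of_mem ((M.quotient.germ η.1).comp M.quotient.pull) hbF
      have h2 : ((M.quotient.germ η.1).comp M.quotient.pull) b =
          M.quotient.germ η.1 (M.mono k f hf) *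
            (l (D₀.mono ((p - 1) * k) a ha) * l (D₀.mono 0 t ht0)) := by
        refine (hlb b).trans ?_
        rw [hlh, ← map_mul, ← map_mul, ← mul_assoc, hmul,
          D₀.mono_mul_mono]
        exact congrArg l (D₀.mono_congr _ _ rfl hb.symm)
      have hua : IsUnit (l (D₀.mono ((p - 1) * k) a ha)) := by
        by_contra hcon
        refine TwistDatum.mono_notMem_of_not_dvd hzp (q := q) (fun g hg hgq => ?_) ha hza hcon
        obtain ⟨b, t, ht, ht0, hb⟩ := M.exists_germ_pull_eq hg
        have h3 : D₀.mono 0 (M.germ (M.pull b)) (M.germ_pull_mem_eigen b) ∈ q := by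
          rw [D₀.mono_congr _ (D₀.mul_mem_eigen hg ht0) rfl hb.symm, ← D₀.mono_mul_mono hg ht0]
          exact q.mul_mem_right _ hgq
        rw [hqF, ← hb] at h3
        exact ht.dvd_mul_right.1 h3
      rw [h2] at h1
      rw [Ideal.span_singleton_le_iff_mem]
      exact (Ideal.mul_unit_mem_iff_mem _
        (hua.mul ((D₀.mono_mul_unit ht0 ht).map l))).1 h1
  -- If `z T ^ k` vanished at `η`, then the functions on `X` vanishing there would be those
  -- divisible by `z`, and `η` would lie over `F`.
  · rw [pullbackCoeff_of_ne hηF, Ring.ord_of_isUnit]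
    by_contra hcon
    have hzq : D₀.mono k z hzk ∈ q := by
      rw [hlh] at hcon
      exact hcon
    refine hηF (eq_of_pointIdeal_eq M.isAffineOpen (M.quotient.toX_mem η.1) hFV ?_)
    ext b
    rw [hpull, hFmem, TwistDatum.mono_zero_mem_iff hzp hzk hqheight.le hzq]

/-- The eigenfunctions with the same divisor as a homogeneous coordinate. -/
theorem exists_unit_of_isEigenEquation [IsLocalRing D₀.fixedRing] [IsNoetherianRing D₀.fixedRing]
    [IsDomain (U.presheaf.stalk P)] (M : LocalModel hπ D₀)
    (hE : ∀ k, 0 < k → k < p → ∀ a ∈ D₀.eigen k, a ∈ maximalIdeal (U.presheaf.stalk P))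
    {F : PrimeDivisor X} {k : ℕ} {f : Γ(U, π ⁻¹ᵁ M.V)} {hf : f ∈ M.D.eigen k}
    (hprime : Prime (M.toLocal (M.mono k f hf))) (hf0 : M.germ f ≠ 0) {b₀ : ZMod p}
    (h₀ : M.quotient.IsEigenEquation M.fixedPoint F (M.mono k f hf) b₀)
    {h : M.quotient.R} {b : ZMod p} (hh : M.quotient.IsEigenEquation M.fixedPoint F h b) :
    (∃ v : D₀.fixedRingˣ, M.toLocal h = M.toLocal (M.mono k f hf) * v) ∧ b = k := by
  have hord : ∀ η : PrimeDivisor M.quotient.scheme, η.1 ⤳ M.fixedPoint →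
      Ring.ord _ (M.quotient.germ η.1 h) = Ring.ord _ (M.quotient.germ η.1 (M.mono k f hf)) :=
    fun η hη => (hh.2 η hη).symm.trans (h₀.2 η hη)
  set x := M.toLocal (M.mono k f hf) with hx
  have hspan : (Ideal.span {x}).IsPrime := (Ideal.span_singleton_prime hprime.ne_zero).2 hprime
  -- At the generic point of `{x = 0}` both functions have order one, so both generate the maximal
  -- ideal there.
  obtain ⟨η, l, hη, hl, hlr, hlx⟩ := M.exists_primeDivisor (Ideal.span {x})
    (height_span_singleton_of_prime hprime)
  have hmax : Ideal.span {l x} = maximalIdeal (M.quotient.scheme.presheaf.stalk η.1) := by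
    rw [← hl.map_comap (maximalIdeal _), hlx, Ideal.map_span, Set.image_singleton]
  have h1 : Ring.ord _ (M.quotient.germ η.1 h) = 1 := by
    rw [hord η hη, ← hlr]
    exact ord_eq_one_of_span_eq hmax
  have hmax' := span_eq_maximalIdeal_of_ord_eq_one h1
  rw [← hlr] at hmax'
  have hv : ∃ v : D₀.fixedRingˣ, M.toLocal h = x * v := by
    refine exists_unit_of_same_divisor hprime ?_ ?_ ?_
    · rw [← Ideal.mem_span_singleton, ← hlx, Ideal.mem_comap, ← hmax']
      exact Ideal.mem_span_singleton_self _
    -- Clearing denominators in `l x = l h * s` yields a multiplier `w` outside `(x)` with `w * x`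
    -- divisible by `h`.
    · obtain ⟨s, hs⟩ := Ideal.mem_span_singleton.1
        (hmax' ▸ hmax ▸ Ideal.mem_span_singleton_self (l x))
      obtain ⟨a, w, hw, hsw⟩ := hl.surj s
      have h2 : l (w * x - M.toLocal h * a) = 0 := by
        rw [map_sub, map_mul, map_mul, hs, ← hsw]
        ring
      obtain ⟨t, ht, htw⟩ := hl.exists_of_map_eq_zero _ h2
      have ht0 : t ≠ 0 := by
        rintro rfl
        rw [map_zero] at ht
        exact not_isUnit_zero ht
      refine ⟨w, fun hxw => ?_, a, sub_eq_zero.1 ((mul_eq_zero.1 htw).resolve_left ht0)⟩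
      rw [← Ideal.mem_span_singleton, ← hlx] at hxw
      exact hxw hw
    · intro q hq hq1 hxq hhq
      obtain ⟨η, l, hη, hl, hlr, hlq⟩ := M.exists_primeDivisor q hq1
      have hu : IsUnit (l x) := by
        by_contra hcon
        exact hxq (hlq ▸ hcon)
      have h2 := hord η hη
      rw [← hlr, ← hlr, Ring.ord_of_isUnit hu] at h2
      rw [← hlq] at hhq
      exact hhq (isUnit_of_ord_eq_zero h2)
  refine ⟨hv, ?_⟩
  obtain ⟨v, hv⟩ := hv
  have h3 := M.toLocal_mem_grading hh.1
  rw [hv, hx, toLocal_mono] at h3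
  refine D₀.eq_of_mono_mul_mem_grading _ (mul_ne_zero hf0 ?_) h3
  exact ((TwistDatum.isUnit_fixedRing_iff hE _).1 v.isUnit).ne_zero

end LocalModel

/-! ### Toric coordinates -/

namespace LocalModel

variable {p : ℕ} {U X : Scheme.{u}} {σ : U ≅ U} {π : U ⟶ X} {hπ : IsQuotientBy σ π} {P : U}
  {D₀ : TwistDatum p (U.presheaf.stalk P)} [hp : Fact p.Prime] {ε : U.presheaf.stalk P}

theorem exists_section_of_mem_eigen (M : LocalModel hπ D₀) {k : ℕ} {a : U.presheaf.stalk P}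
    (ha : a ∈ D₀.eigen k) :
    ∃ f ∈ M.D.eigen k, ∃ w : (U.presheaf.stalk P)ˣ, M.germ f = a * w := by
  obtain ⟨f, hf, t, -, ht, h⟩ := M.compatible.exists_eigen_lift M.isLocalizationHom_germ ha
  exact ⟨f, hf, ht.unit, h.symm⟩

/-- Suitable unit multiples of the `y j` are eigenelements and are completed by eigenelements of
`𝔪`; all of them extend over `V` after multiplication by units. -/
theorem exists_coordinates [IsRegularLocalRing (U.presheaf.stalk P)] [IsDomain (U.presheaf.stalk P)]
    (M : LocalModel hπ D₀) (h : D₀.IsAdmissible ε)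
    (hE : ∀ k, 0 < k → k < p → ∀ a ∈ D₀.eigen k, a ∈ maximalIdeal (U.presheaf.stalk P))
    {r n : ℕ} (hn : Module.finrank (ResidueField (U.presheaf.stalk P))
      (CotangentSpace (U.presheaf.stalk P)) = n)
    {y : Fin r → U.presheaf.stalk P} (hy : IndepModSq y)
    (hstab : ∀ j, ε * y j ∣ D₀.σ (y j) - y j) :
    ∃ (k : Fin n → ℕ) (f : Fin n → Γ(U, π ⁻¹ᵁ M.V)) (i : Fin r ↪ Fin n),
      (∀ l, f l ∈ M.D.eigen (k l)) ∧ (∀ l, k l < p) ∧ IsCoordinateSystem (fun l => M.germ (f l)) ∧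
        ∀ j, ∃ w : (U.presheaf.stalk P)ˣ, M.germ (f (i j)) = y j * w := by
  have hy0 : ∀ j, y j ≠ 0 := fun j h0 => hy.notMem_sq j (h0 ▸ zero_mem _)
  choose w k₀ hk₀ hyw using fun j => h.exists_mul_mem_eigen (hy0 j) (hstab j)
  have hyw' : IndepModSq (fun j => y j * w j) := (indepModSq_mul_unit_iff w).2 hy
  obtain ⟨t, i, ht, htH, hti⟩ := hyw'.exists_coordinates (h.span_homogeneous hE)
    (fun j => ⟨hyw'.choose j, k₀ j, hk₀ j, hyw j⟩) hn
  choose k hk htk using fun l => (htH l).2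
  choose f hf v hv using fun l => M.exists_section_of_mem_eigen (htk l)
  refine ⟨k, f, i, hf, hk, ?_, fun j => ⟨w j * v (i j), ?_⟩⟩
  · simpa only [hv] using ht.mul_unit v
  · rw [hv, hti, Units.val_mul, mul_assoc]

variable [IsDomain (U.presheaf.stalk P)]

/-- The invariant vanishing once along `E` is the product of `y w`, of weight `k`, an eigenelement
of weight `(p - 1) * k` not divisible by `y`, and `τ ^ k`. -/
theorem exists_isDivisorPullback_of_dvd (M : LocalModel hπ D₀) (h : D₀.IsAdmissible ε)
    {y : U.presheaf.stalk P} {E : PrimeDivisor U} (hE : IsLocalEquation P E y)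
    (hstab : ε * y ∣ D₀.σ y - y) (hnot : ¬ ∀ a, ε * y ∣ D₀.σ a - a) :
    ∃ F : PrimeDivisor X, IsDivisorPullback π F E := by
  have hy := hE.prime
  obtain ⟨w, k, -, hyw⟩ := h.exists_mul_mem_eigen hy.ne_zero hstab
  obtain ⟨a, ha, hya⟩ := h.exists_eigen_not_dvd hy hnot ((p - 1) * k)
  obtain ⟨hg, -⟩ := TwistDatum.mono_mul_mono_eq_mono_zero hyw ha
  refine M.exists_isDivisorPullback hE ?_ ⟨_, hg, w * a * D₀.tau ^ k, by ring, fun hcon => hya ?_⟩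
  · have := (Dvd.intro_left ε rfl).trans hstab
    exact (dvd_sub_self_right).1 this
  · rw [mul_comm (w : U.presheaf.stalk P), mul_assoc] at hcon
    exact (w.isUnit.mul (D₀.isUnit_tau.pow k)).dvd_mul_right.1 hcon

theorem exists_isEigenEquation (M : LocalModel hπ D₀) [IsLocalRing D₀.fixedRing]
    [IsDomain D₀.fixedRing] (h : D₀.IsAdmissible ε) {y : U.presheaf.stalk P} {E : PrimeDivisor U}
    (hE : IsLocalEquation P E y) (hnot : ¬ ∀ a, ε * y ∣ D₀.σ a - a)
    {F : PrimeDivisor X} (hF : IsDivisorPullback π F E) {k : ℕ} {f : Γ(U, π ⁻¹ᵁ M.V)}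
    (hf : f ∈ M.D.eigen k) {w : (U.presheaf.stalk P)ˣ} (hw : M.germ f = y * w) :
    M.quotient.IsEigenEquation M.fixedPoint F (M.mono k f hf) k := by
  obtain ⟨a, ha, hya⟩ := h.exists_eigen_not_dvd hE.prime hnot ((p - 1) * k)
  refine M.isEigenEquation_mono hf (hw ▸ hE.mul_unit w) ⟨a, ha, fun hcon => hya ?_⟩ hF.apply_eq
  rw [hw] at hcon
  exact (Dvd.intro _ rfl).trans hcon

theorem exists_eigenfunction (M : LocalModel hπ D₀) [IsLocalRing D₀.fixedRing]
    [IsDomain D₀.fixedRing] (h : D₀.IsAdmissible ε) {y : U.presheaf.stalk P} {E : PrimeDivisor U}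
    (hE : IsLocalEquation P E y) (hstab : ε * y ∣ D₀.σ y - y) (hnot : ¬ ∀ a, ε * y ∣ D₀.σ a - a)
    {F : PrimeDivisor X} (hF : IsDivisorPullback π F E) :
    ∃ (r : M.quotient.R) (b : ZMod p), M.quotient.IsEigenEquation M.fixedPoint F r b := by
  obtain ⟨w, k, -, hyw⟩ := h.exists_mul_mem_eigen hE.prime.ne_zero hstab
  obtain ⟨f, hf, v, hv⟩ := M.exists_section_of_mem_eigen hyw
  exact ⟨_, _, M.exists_isEigenEquation h hE hnot hF hf (w := w * v)
    (by rw [hv, Units.val_mul, mul_assoc])⟩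

theorem isToricCoordinates_mono (M : LocalModel hπ D₀) [IsRegularLocalRing (U.presheaf.stalk P)]
    [IsRegularLocalRing D₀.fixedRing] (h : D₀.IsAdmissible ε)
    (hE : ∀ k, 0 < k → k < p → ∀ a ∈ D₀.eigen k, a ∈ maximalIdeal (U.presheaf.stalk P))
    {n : ℕ} {k : Fin n → ℕ} {f : Fin n → Γ(U, π ⁻¹ᵁ M.V)} (hf : ∀ l, f l ∈ M.D.eigen (k l))
    (hcoord : IsCoordinateSystem (fun l => M.germ (f l))) :
    IsCoordinateSystem (fun l => M.toLocal (M.mono (k l) (f l) (hf l))) := by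
  simp only [toLocal_mono]
  exact h.isCoordinateSystem_mono hE (fun l => M.compatible.map_mem_eigen (hf l)) hcoord

/-- Eigenfunctions with the divisors of part of a coordinate system are part of a toric coordinate
system. -/
theorem exists_isToricCoordinates (M : LocalModel hπ D₀) [IsRegularLocalRing (U.presheaf.stalk P)]
    [IsRegularLocalRing D₀.fixedRing] [IsDomain D₀.fixedRing] (h : D₀.IsAdmissible ε)
    (hE : ∀ k, 0 < k → k < p → ∀ a ∈ D₀.eigen k, a ∈ maximalIdeal (U.presheaf.stalk P))
    {r n : ℕ} {k : Fin n → ℕ} {f : Fin n → Γ(U, π ⁻¹ᵁ M.V)} {i : Fin r ↪ Fin n}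
    (hf : ∀ l, f l ∈ M.D.eigen (k l)) (hcoord : IsCoordinateSystem (fun l => M.germ (f l)))
    {F : Fin r → PrimeDivisor X} {g : Fin r → M.quotient.R} {b : Fin r → ZMod p}
    (hF : ∀ j, M.quotient.IsEigenEquation M.fixedPoint (F j)
      (M.mono (k (i j)) (f (i j)) (hf (i j))) (k (i j)))
    (hg : ∀ j, M.quotient.IsEigenEquation M.fixedPoint (F j) (g j) (b j)) :
    (∀ j, b j = k (i j)) ∧ ∃ t : Fin n → M.quotient.R,
      M.quotient.IsToricCoordinates M.fixedPoint t (fun l => k l) ∧ ∀ j, t (i j) = g j := by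
  have hc := M.isToricCoordinates_mono h hE hf hcoord
  have hprime : ∀ l, Prime (M.toLocal (M.mono (k l) (f l) (hf l))) := fun l => by
    have hm := hc.choose l
    have h2 := (hc.indepModSq_comp (Function.Embedding.refl _)).notMem_sq l
    refine (Ideal.span_singleton_prime ?_).1 (isPrime_span_singleton hm h2)
    intro h0
    refine h2 ?_
    change M.toLocal (M.mono (k l) (f l) (hf l)) ∈ _
    rw [h0]
    exact zero_mem _
  have hf0 : ∀ l, M.germ (f l) ≠ 0 := fun l h0 => by
    have h2 := (hcoord.indepModSq_comp (Function.Embedding.refl _)).notMem_sq l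
    refine h2 ?_
    change M.germ (f l) ∈ _
    rw [h0]
    exact zero_mem _
  have key := fun j => M.exists_unit_of_isEigenEquation hE (hprime (i j)) (hf0 (i j)) (hF j) (hg j)
  choose v hv using fun j => (key j).1
  classical
  -- The coordinates at the positions `i j` are replaced by the given eigenfunctions and the others
  -- kept; each changes only by a unit.
  have hex : ∀ l, ∃ (t : M.quotient.R) (w : D₀.fixedRingˣ), t ∈ M.quotient.grading (k l) ∧
      M.toLocal t = M.toLocal (M.mono (k l) (f l) (hf l)) * w ∧ ∀ j, i j = l → t = g j := by
    intro l
    by_cases hl : ∃ j, i j = l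
    · obtain ⟨j, rfl⟩ := hl
      exact ⟨g j, v j, (key j).2 ▸ (hg j).1, hv j, fun j' hj' => by rw [i.injective hj']⟩
    · exact ⟨_, 1, M.mono_mem_grading (hf l), by rw [Units.val_one, mul_one],
        fun j hj => absurd ⟨j, hj⟩ hl⟩
  choose t w htk htw htg using hex
  refine ⟨fun j => (key j).2, t, ⟨htk, M.isCoordinateSystem_germ ?_⟩, fun j => htg _ j rfl⟩
  simpa only [htw] using hc.mul_unit w

end LocalModel

end ToricDivisors

end

/-! ### Proof of the theorem -/

open ToricDivisors

theorem theorem5p1 {U X : Scheme.{u}} (hU : ToricDivisors.IsRegularScheme U)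
    (p : ℕ) [Fact p.Prime] (σ : U ≅ U)
    -- `σ` composed with itself `p` times is the identity, so that `σ` generates an action of `ℤ/p`
    (hσ : (fun f : U ⟶ U => f ≫ σ.hom)^[p] (𝟙 U) = 𝟙 U)
    (π : U ⟶ X) (hπ : ToricDivisors.IsQuotientBy σ π)
    -- a closed point fixed by the group, with trivial action on its perfect residue field
    (P : U) (hPclosed : IsClosed ({P} : Set U)) (hP : σ.hom P = P)
    (hres : ∀ a, ToricDivisors.incr σ P hP a ∈ maximalIdeal (U.presheaf.stalk P))
    [CharP (ResidueField (U.presheaf.stalk P)) p]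
    [PerfectField (ResidueField (U.presheaf.stalk P))]
    (e s : U.presheaf.stalk P)
    (he : e ∈ maximalIdeal (U.presheaf.stalk P)) (he0 : e ≠ 0)
    (hs : s ∈ maximalIdeal (U.presheaf.stalk P)) (hs0 : s ≠ 0)
    (u : (U.presheaf.stalk P)ˣ) (hIs : ToricDivisors.incr σ P hP s = e * s * u)
    {n : ℕ} (x : Fin n → U.presheaf.stalk P) (hx : ToricDivisors.IsCoordinateSystem x)
    -- `e` is a greatest common divisor of the `I(x_i)`
    (he_dvd : ∀ i, e ∣ ToricDivisors.incr σ P hP (x i))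
    (he_gcd : ∀ d, (∀ i, d ∣ ToricDivisors.incr σ P hP (x i)) → d ∣ e)
    (hp : ∃ a ∈ maximalIdeal (U.presheaf.stalk P),
      (p : U.presheaf.stalk P) = e ^ (p - 1) * a) :
    -- (1)
    (∀ (y : U.presheaf.stalk P) (E : ToricDivisors.PrimeDivisor U),
      ToricDivisors.IsLocalEquation P E y → e * y ∣ ToricDivisors.incr σ P hP y →
        ∃ F : ToricDivisors.PrimeDivisor X, ToricDivisors.IsDivisorPullback π F E) ∧
    ((∀ i, ∃ a ∈ maximalIdeal (U.presheaf.stalk P),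
        ToricDivisors.incr σ P hP (x i) = e * a) →
      -- the linear map `φ(y) = I(y)/(eu)`; here `I(s) = (eu)s`
      ∃ φ : Module.End (ResidueField (U.presheaf.stalk P)) (CotangentSpace (U.presheaf.stalk P)),
        (∀ (y : U.presheaf.stalk P) (hy : y ∈ maximalIdeal (U.presheaf.stalk P)),
          ∃ (a : U.presheaf.stalk P) (ha : a ∈ maximalIdeal (U.presheaf.stalk P)),
            ToricDivisors.incr σ P hP y = (e * u) * a ∧
            φ (ToricDivisors.cotangentClass y hy) = ToricDivisors.cotangentClass a ha) ∧
      -- the scheme `Q` with its action of `μ_p` and its fixed point `z` over the image of `P`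
      ∃ (Q : ToricDivisors.MuQuotient p X) (z : Q.scheme),
        Q.IsRegularFixedPointOver (π P) z ∧
        (∃ (B : Module.Basis (Fin n) (ResidueField (U.presheaf.stalk P))
              (CotangentSpace (U.presheaf.stalk P)))
            (t : Fin n → Q.R) (c : Fin n → ZMod p),
          (∀ i, φ (B i) = ((c i).val : ResidueField (U.presheaf.stalk P)) • B i) ∧
          Q.IsToricCoordinates z t c) ∧
        -- (2)
        (∀ (y : U.presheaf.stalk P) (E : ToricDivisors.PrimeDivisor U)
            (F : ToricDivisors.PrimeDivisor X),
          ToricDivisors.IsLocalEquation P E y → e * y ∣ ToricDivisors.incr σ P hP y →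
          ToricDivisors.IsDivisorPullback π F E →
            ∃ (h : Q.R) (b : ZMod p), Q.IsEigenEquation z F h b) ∧
        -- (3)
        (∀ (r : ℕ) (y : Fin r → U.presheaf.stalk P),
          ToricDivisors.IndepModSq y →
          (∀ j, e * y j ∣ ToricDivisors.incr σ P hP (y j)) →
            (∀ j, ∃ E : ToricDivisors.PrimeDivisor U,
              ToricDivisors.IsLocalEquation P E (y j)) ∧
            ∀ (E : Fin r → ToricDivisors.PrimeDivisor U)
              (F : Fin r → ToricDivisors.PrimeDivisor X)
              (h : Fin r → Q.R) (b : Fin r → ZMod p),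
              (∀ j, ToricDivisors.IsLocalEquation P (E j) (y j)) →
              (∀ j, ToricDivisors.IsDivisorPullback π (F j) (E j)) →
              (∀ j, Q.IsEigenEquation z (F j) (h j) (b j)) →
                ToricDivisors.IndepModSq (fun j => Q.germ z (h j)) ∧
                (∃ (t : Fin n → Q.R) (c : Fin n → ZMod p) (i : Fin r ↪ Fin n),
                  Q.IsToricCoordinates z t c ∧ ∀ j, t (i j) = h j ∧ c (i j) = b j) ∧
                ∀ (j : Fin r) (hj : y j ∈ maximalIdeal (U.presheaf.stalk P)),
                  φ.HasEigenvector ((b j).val : ResidueField (U.presheaf.stalk P))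
                    (ToricDivisors.cotangentClass (y j) hj))) := by
  have hreg : IsRegularLocalRing (U.presheaf.stalk P) := hU.stalk_regular P
  have hdom : IsDomain (U.presheaf.stalk P) := isDomain_of_isRegularLocalRing _
  have hper := stalkAction_iterate σ hP hπ hσ
  set ε : U.presheaf.stalk P := e * u with hε
  have hεm : ε ∈ maximalIdeal (U.presheaf.stalk P) := Ideal.mul_mem_right _ _ he
  have hε0 : ε ≠ 0 := mul_ne_zero he0 u.ne_zero
  have hdvd_iff : ∀ y a, ε * y ∣ a ↔ e * y ∣ a := fun y a => by
    rw [hε, mul_right_comm]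
    exact u.isUnit.mul_right_dvd
  have hdvd : ∀ a, ε ∣ stalkAction σ P hP a - a := fun a => by
    rw [← mul_one ε, hdvd_iff, mul_one, ← Ideal.mem_span_singleton]
    exact sub_mem_of_span_eq (p := p) hres hx.span_eq
      (fun i => Ideal.mem_span_singleton.2 (he_dvd i)) a
  have hσs : stalkAction σ P hP s = s * (1 + ε) := by
    have h : stalkAction σ P hP s - s = e * s * u := hIs
    rw [hε]
    linear_combination h
  -- The cocycle comes from `σ s = s (1 + ε)`.
  obtain ⟨D₀, hD₀, hc⟩ : ∃ D₀ : TwistDatum p (U.presheaf.stalk P),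
      D₀.σ = stalkAction σ P hP ∧ D₀.c = 1 + ε :=
    ⟨⟨stalkAction σ P hP, 1 + ε, hper, prod_iterate_eq_one hper hs0 hσs⟩, rfl, rfl⟩
  have hadm : D₀.IsAdmissible ε := TwistDatum.isAdmissible hc hεm hε0 (by rwa [hD₀])
  obtain ⟨M⟩ := exists_localModel hσ hπ hP hD₀
  have hnot : ∀ y ∈ maximalIdeal (U.presheaf.stalk P), ¬ ∀ a, ε * y ∣ D₀.σ a - a := fun y hy =>
    hadm.not_dvd_of_gcd (x := x) (fun d hd => (he_gcd d (by rwa [hD₀] at hd)).mul_right _) hy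
  have hstab : ∀ y, e * y ∣ incr σ P hP y → ε * y ∣ D₀.σ y - y := fun y hy => by
    rw [hdvd_iff, hD₀]
    exact hy
  refine ⟨fun y E hE hy => M.exists_isDivisorPullback_of_dvd hadm hE (hstab y hy)
    (hnot y hE.mem_maximalIdeal), fun hxm => ?_⟩
  have hm : ∀ a, ∃ b ∈ maximalIdeal (U.presheaf.stalk P), stalkAction σ P hP a - a = ε * b := by
    intro a
    -- The same Nakayama argument, now with the ideal `e𝔪` in place of `(e)`.
    have h1 := sub_mem_of_span_eq (p := p) (K := Ideal.span {e} * maximalIdeal _) hres hx.span_eq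
      (fun i => by
        obtain ⟨b, hb, h⟩ := hxm i
        exact Ideal.mem_span_singleton_mul.2 ⟨b, hb, h.symm⟩) a
    obtain ⟨b, hb, h⟩ := Ideal.mem_span_singleton_mul.1 h1
    refine ⟨↑u⁻¹ * b, Ideal.mul_mem_left _ _ hb, ?_⟩
    rw [← h, hε, mul_assoc, Units.mul_inv_cancel_left]
  obtain ⟨φ, hφ⟩ := exists_isDivided hεm hε0 hm
  have hφ' : IsDivided D₀.σ ε φ := hD₀ ▸ hφ
  have hE := hadm.mem_maximalIdeal_of_mem_eigen hεm (by rwa [hD₀])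
  have hrank := hx.finrank_eq
  -- The empty family `y` already gives homogeneous coordinates, which suffice for the regularity of
  -- `Q` and the diagonalization of `φ`.
  obtain ⟨k, f, -, hf, hk, hcoord, -⟩ := M.exists_coordinates hadm hE hrank (r := 0)
    (y := fun j => j.elim0) ⟨fun j => j.elim0, linearIndependent_empty_type⟩ (fun j => j.elim0)
  have hregQ : IsRegularLocalRing D₀.fixedRing :=
    hadm.isRegularLocalRing_fixedRing hE (fun l => M.compatible.map_mem_eigen (hf l)) hcoord
  have hdomQ : IsDomain D₀.fixedRing := isDomain_of_isRegularLocalRing _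
  refine ⟨φ, hφ, M.quotient, M.fixedPoint, M.isRegularFixedPointOver hE, ?_, ?_, ?_⟩
  · refine ⟨hcoord.basis, fun l => M.mono (k l) (f l) (hf l), fun l => k l, fun l => ?_,
      fun l => M.mono_mem_grading (hf l),
      M.isCoordinateSystem_germ (M.isToricCoordinates_mono hadm hE hf hcoord)⟩
    rw [ZMod.val_natCast_of_lt (hk l), hcoord.basis_apply l (hcoord.choose l)]
    exact hφ'.apply_of_mem_eigen hεm hε0 hc _ (M.compatible.map_mem_eigen (hf l))
  · exact fun y E F hyE hy hF => M.exists_eigenfunction hadm hyE (hstab y hy)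
      (hnot y hyE.mem_maximalIdeal) hF
  · intro r y hyind hy
    have hprime : ∀ j, Prime (y j) := fun j => by
      have h2 := hyind.notMem_sq j
      refine (Ideal.span_singleton_prime ?_).1 (isPrime_span_singleton (hyind.choose j) h2)
      exact fun h0 => h2 (h0 ▸ zero_mem _)
    refine ⟨fun j => exists_isLocalEquation (hprime j), fun E F h b hyE hF hh => ?_⟩
    -- Only the coordinates are adapted to the `y j`; the model `M`, and with it `Q`, stays the
    -- same.
    obtain ⟨k, f, i, hf, hk, hcoord, hw⟩ := M.exists_coordinates hadm hE hrank hyind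
      (fun j => hstab _ (hy j))
    choose w hw using hw
    obtain ⟨hb, t, ht, hth⟩ := M.exists_isToricCoordinates hadm hE hf hcoord
      (fun j => M.exists_isEigenEquation hadm (hyE j) (hnot _ (hyind.choose j)) (hF j) (hf (i j))
        (hw j)) hh
    refine ⟨?_, ⟨t, fun l => k l, i, ht, fun j => ⟨hth j, (hb j).symm⟩⟩, fun j hj => ?_⟩
    · simpa only [hth] using ht.2.indepModSq_comp i
    · rw [Module.End.hasEigenvector_iff, Module.End.mem_eigenspace_iff, hb j,
        ZMod.val_natCast_of_lt (hk (i j))]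
      refine ⟨hφ'.apply_of_mul_mem_eigen hεm hε0 hc hj (w j) ?_, ?_⟩
      · rw [← hw]
        exact M.compatible.map_mem_eigen (hf (i j))
      · obtain ⟨hym, hli⟩ := hyind
        exact hli.ne_zero j
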